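/- Let $p\ge 3$ be a prime and let $A$ be an unbounded reduced Abelian $p$-group; $\mu_{fin}=\inf_n r(p^nB)$ denotes the final rank of a basic subgroup $B$ of $A$ (it does not depend on $B$), where $r$ is the rank. For an automorphism $\varepsilon$ with $\varepsilon^2=1$ put $A_\varepsilon^{\pm}=\{a\in A:\varepsilon a=\pm a\}$, so that $A=A_\varepsilon^+\oplus A_\varepsilon^-$. Call $\varepsilon$ an extreme involution, $Extreme(\varepsilon)$, if it has order $2$ and one of $A_\varepsilon^{+},A_\varepsilon^{-}$ is indecomposable; that one is denoted $A_\varepsilon$, the other one $A_\varepsilon^{\perp}$, and $ord(\varepsilon)=|A_\varepsilon|$. A pair $(\xi,\varepsilon)$ consists of automorphisms with $\xi^2=1$, $Extreme(\varepsilon)$ and $\xi\varepsilon=\varepsilon\xi$; $A_{(\xi,\varepsilon)}$ is the one of $A_\xi^+,A_\xi^-$ that contains $A_\varepsilon$, and $A_{\overline{(\xi,\varepsilon)}}$ is the other one. For extreme $\varepsilon'$ and a subgroup $H$ of $A$ we say that $\varepsilon'$ lies in $H$ if $A_{\varepsilon'}\subset H$, and then $\varepsilon'\in(\xi,\varepsilon)$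 means that $\varepsilon'$ lies in $A_{(\xi,\varepsilon)}$; $(\xi_1,\varepsilon_1)\subsetneq(\xi_0,\varepsilon_0)$ means $A_{(\xi_1,\varepsilon_1)}\subsetneq A_{(\xi_0,\varepsilon_0)}$. For an automorphism $f$ and extreme involutions $\varepsilon_1,\varepsilon_2$ let $\varepsilon_1\overset{f}{\mapsto}\varepsilon_2$ mean that $A_{\varepsilon_1}\cap A_{\varepsilon_2}=0$, $f(A_{\varepsilon_1})\subset A_{\varepsilon_1}\oplus A_{\varepsilon_2}$, $f(A_{\varepsilon_1}^\perp)\supset A_{\varepsilon_1}^\perp\cap A_{\varepsilon_2}^\perp$, $f(A_{\varepsilon_1})\ne A_{\varepsilon_1}$ and $f(A_{\varepsilon_1})\neq A_{\varepsilon_2}$. Define $$ByOrd(\xi,\varepsilon)\iff\forall\varepsilon'\Big(Extreme(\varepsilon')\wedge\xi\varepsilon'=\varepsilon'\xi\Rightarrow\big(\varepsilon'\in(\xi,\varepsilon)\Leftrightarrow ord(\varepsilon')\ge ord(\varepsilon)\big)\Big),$$ and, for a pair $(\xi_0,\varepsilon_0)$, let $Final(\xi_0,\varepsilon_0)$ mean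 that $ByOrd(\xi_0,\varepsilon_0)$ holds and that for every pair $(\xi_1,\varepsilon_1)\subsetneq(\xi_0,\varepsilon_0)$ with $ByOrd(\xi_1,\varepsilon_1)$ there is an automorphism $f$ of $A$ such that $f(A_\varepsilon)=A_\varepsilon$ for every extreme involution $\varepsilon$ lying in $A_{\overline{(\xi_1,\varepsilon_1)}}$, and such that for every extreme involution $\varepsilon$ lying in $A_{(\xi_0,\varepsilon_0)}\cap A_{\overline{(\xi_1,\varepsilon_1)}}$ there is an extreme involution $\varepsilon'\in(\xi_1,\varepsilon_1)$ with $\varepsilon'\overset{f}{\mapsto}\varepsilon$. Then: (1) the property "$(\xi_0,\varepsilon_0)$ is a pair and $Final(\xi_0,\varepsilon_0)$ holds" of two elements of the group $\operatorname{Aut}A$ is expressed by a first-order formula of the language of groups, which is the same for all $p\geq 3$ and all such $A$; (2) this formula specifies the decompositions $A=A_{low}\oplus A_{fin}$ in which every indecomposable direct summand of $A_{low}$ has smaller order than every indecomposable direct summand of $A_{fin}$ and the basic subgroup of $A_{fin}$ has rank $\mu_{fin}$: for subgroups $A_{low},A_{fin}$ of $A$, these conditions hold if and only if $A_{low}=A_{\overline{(\xi_0,\varepsilon_0)}}$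 and $A_{fin}=A_{(\xi_0,\varepsilon_0)}$ for some pair $(\xi_0,\varepsilon_0)$ with $Final(\xi_0,\varepsilon_0)$; (3) such a decomposition exists. -/

import Mathlib

open Cardinal

noncomputable section

namespace AutFinal

/-! ### The first-order language of groups and its structure on `Aut A` -/

/-- The operation symbols of the language of groups. -/
inductive GroupFunc : ℕ → Type
  | mul : GroupFunc 2
  | inv : GroupFunc 1
  | one : GroupFunc 0

/-- The first-order language of groups `(·, ⁻¹, 1)`, with equality and no other relation. -/
def groupLang : FirstOrder.Language where
  Functions := GroupFunc
  Relations := fun _ => Empty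

/-- `Aut A` as a first-order structure: `f · g` is the composite `a ↦ f (g a)`. -/
instance autStructure (A : Type*) [AddCommGroup A] : groupLang.Structure (A ≃+ A) where
  funMap := fun {n} s =>
    match n, s with
    | _, GroupFunc.mul => fun x => (x 1).trans (x 0)
    | _, GroupFunc.inv => fun x => (x 0).symm
    | _, GroupFunc.one => fun _ => AddEquiv.refl A
  RelMap := fun r => r.elim

/-! ### Abelian `p`-groups -/

section Groups

variable {A : Type*} [AddCommGroup A]

/-- Every element of `A` has order a power of `p`. -/
def IsAbelianPGroup (p : ℕ) (A : Type*) [AddCommGroup A] : Prop :=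
  ∀ a : A, ∃ n : ℕ, p ^ n • a = 0

/-- `A` has no nonzero divisible subgroup. -/
def IsReducedGroup (A : Type*) [AddCommGroup A] : Prop :=
  ∀ D : AddSubgroup A, (∀ n : ℕ, n ≠ 0 → ∀ x ∈ D, ∃ y ∈ D, n • y = x) → D = ⊥

/-- No positive integer annihilates `A`. -/
def IsUnboundedGroup (A : Type*) [AddCommGroup A] : Prop :=
  ∀ n : ℕ, n ≠ 0 → ∃ a : A, n • a ≠ 0

/-- The subgroup `H` is nonzero and is not a direct sum of two nonzero subgroups. -/
def Indecomposable (H : AddSubgroup A) : Prop :=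
  H ≠ ⊥ ∧ ∀ X Y : AddSubgroup A, X ⊓ Y = ⊥ → X ⊔ Y = H → X = ⊥ ∨ Y = ⊥

/-- `X` is an indecomposable direct summand of the subgroup `H`. -/
def IsIndecSummand (X H : AddSubgroup A) : Prop :=
  Indecomposable X ∧ ∃ Y : AddSubgroup A, X ⊓ Y = ⊥ ∧ X ⊔ Y = H

/-- The elements of `s` are independent: the sum of the cyclic groups they generate is direct. -/
def IndependentElems (s : Set A) : Prop :=
  iSupIndep fun a : s => AddSubgroup.zmultiples (a : A)

/-- An independent system consisting of elements of infinite or of prime power order (in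
particular not containing `0`, whose order is `1`). -/
def IsRankSystem (s : Set A) : Prop :=
  IndependentElems s ∧ ∀ a ∈ s, addOrderOf a = 0 ∨ IsPrimePow (addOrderOf a)

/-- The rank of an Abelian group: the cardinality of a maximal independent system of elements of
infinite and prime power orders. (All these systems have the same cardinality.) -/
def rank (A : Type*) [AddCommGroup A] : Cardinal :=
  sInf {κ | ∃ s : Set A, Maximal IsRankSystem s ∧ #s = κ}

/-- `B` is a `p`-basic subgroup of `A`: a direct sum of infinite cyclic groups and cyclic
`p`-groups, pure in `A`, with `p`-divisible quotient `A / B`. -/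
structure IsBasic (p : ℕ) (B : AddSubgroup A) : Prop where
  directSum : ∃ s : Set A, IndependentElems s ∧ AddSubgroup.closure s = B ∧
    ∀ a ∈ s, addOrderOf a = 0 ∨ ∃ k : ℕ, addOrderOf a = p ^ k
  pure : ∀ (n : ℤ), ∀ g ∈ B, (∃ x : A, n • x = g) → ∃ x ∈ B, n • x = g
  divisible : ∀ x : A ⧸ B, ∃ y : A ⧸ B, p • y = x

/-- The final rank of `B`: the infimum of the cardinals `r(pⁿ B)`. -/
def finalRank (p : ℕ) (B : AddSubgroup A) : Cardinal :=
  ⨅ n : ℕ, rank (B.map (nsmulAddMonoidHom (p ^ n)))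

/-- The basic subgroup of `A` (it exists, and any one may be taken) has rank `κ`. -/
def HasBasicRank (p : ℕ) (A : Type*) [AddCommGroup A] (κ : Cardinal) : Prop :=
  (∃ B : AddSubgroup A, IsBasic p B) ∧ ∀ B : AddSubgroup A, IsBasic p B → rank B = κ

/-- The basic subgroup of `A` (it exists, and any one may be taken) has final rank `κ`. -/
def HasFinalRank (p : ℕ) (A : Type*) [AddCommGroup A] (κ : Cardinal) : Prop :=
  (∃ B : AddSubgroup A, IsBasic p B) ∧ ∀ B : AddSubgroup A, IsBasic p B → finalRank p B = κ

/-- `A = A₁ ⊕ A₂`, where every indecomposable direct summand of `A₁` has smaller order than every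
indecomposable direct summand of `A₂`, and the rank of the basic subgroup of `A₂` is the final
rank of the basic subgroup of `A`. -/
structure IsLowFin (p : ℕ) (A₁ A₂ : AddSubgroup A) : Prop where
  compl : IsCompl A₁ A₂
  order_lt : ∀ X Y : AddSubgroup A, IsIndecSummand X A₁ → IsIndecSummand Y A₂ → #X < #Y
  rank_eq : ∃ κ : Cardinal, HasFinalRank p A κ ∧ HasBasicRank p A₂ κ

/-! ### Involutions -/

/-- `A_ε⁺ = {a | ε a = a}`. -/
def plusPart (ε : A ≃+ A) : AddSubgroup A where
  carrier := {a | ε a = a}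
  zero_mem' := map_zero ε
  add_mem' := by
    intro a b ha hb
    simp only [Set.mem_ofPred_eq] at ha hb ⊢
    rw [map_add, ha, hb]
  neg_mem' := by
    intro a ha
    simp only [Set.mem_ofPred_eq] at ha ⊢
    rw [map_neg, ha]

/-- `A_ε⁻ = {a | ε a = -a}`. -/
def minusPart (ε : A ≃+ A) : AddSubgroup A where
  carrier := {a | ε a = -a}
  zero_mem' := by simp
  add_mem' := by
    intro a b ha hb
    simp only [Set.mem_ofPred_eq] at ha hb ⊢
    rw [map_add, ha, hb, neg_add]
  neg_mem' := by
    intro a ha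
    simp only [Set.mem_ofPred_eq] at ha ⊢
    rw [map_neg, ha]

def Commutes (f g : A ≃+ A) : Prop := ∀ a, f (g a) = g (f a)

/-- `ε` is an extreme involution: an automorphism of order `2` such that one of `A_ε⁺`, `A_ε⁻` is
indecomposable. -/
def Extreme (ε : A ≃+ A) : Prop :=
  (∀ a, ε (ε a) = a) ∧ ε ≠ AddEquiv.refl A ∧
    (Indecomposable (plusPart ε) ∨ Indecomposable (minusPart ε))

open Classical in
/-- The indecomposable one `A_ε` of the two summands `A_ε⁺`, `A_ε⁻` of an extreme involution. -/
def core (ε : A ≃+ A) : AddSubgroup A :=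
  if Indecomposable (minusPart ε) then minusPart ε else plusPart ε

open Classical in
/-- The other summand `A_ε^⊥` of an extreme involution. -/
def perp (ε : A ≃+ A) : AddSubgroup A :=
  if Indecomposable (minusPart ε) then plusPart ε else minusPart ε

/-- The order of an extreme involution `ε`, i.e. the order of the summand `A_ε`. -/
def ord (ε : A ≃+ A) : Cardinal := #(core ε)

/-- `(ξ, ε)` is a pair: `ξ² = 1`, `ε` is an extreme involution, and `ξ ε = ε ξ`. -/
def Pair (ξ ε : A ≃+ A) : Prop :=
  (∀ a, ξ (ξ a) = a) ∧ Extreme ε ∧ Commutes ξ ε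

open Classical in
/-- `A_(ξ, ε)`: the one of `A_ξ⁺`, `A_ξ⁻` that contains `A_ε`. -/
def pairPart (ξ ε : A ≃+ A) : AddSubgroup A :=
  if core ε ≤ plusPart ξ then plusPart ξ else minusPart ξ

open Classical in
/-- The complement of `A_(ξ, ε)`: the other one of `A_ξ⁺`, `A_ξ⁻`. -/
def pairCompl (ξ ε : A ≃+ A) : AddSubgroup A :=
  if core ε ≤ plusPart ξ then minusPart ξ else plusPart ξ

/-- `f(ε)`, the involution `f ε f⁻¹`. -/
def conj (f ε : A ≃+ A) : A ≃+ A := (f.symm.trans ε).trans f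

/-- `ε ∈ ε₁ ⊕ ε₂`. -/
def InSum (ε ε₁ ε₂ : A ≃+ A) : Prop :=
  core ε₁ ⊓ core ε₂ = ⊥ ∧ core ε ≤ core ε₁ ⊔ core ε₂ ∧ perp ε₁ ⊓ perp ε₂ ≤ perp ε

/-- `f(ε₁) = ε₂` for extreme involutions: `f` maps `A_ε₁` onto `A_ε₂`. -/
def Sends (f ε₁ ε₂ : A ≃+ A) : Prop :=
  (core ε₁).map f.toAddMonoidHom = core ε₂

/-- `ε₁ ↦ ε₂` under `f`: `f(ε₁) ∈ ε₁ ⊕ ε₂`, `f(ε₁) ≠ ε₁` and `f(ε₁) ≠ ε₂`. -/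
def MapsOnto (f ε₁ ε₂ : A ≃+ A) : Prop :=
  Extreme ε₁ ∧ Extreme ε₂ ∧ InSum (conj f ε₁) ε₁ ε₂ ∧ ¬ Sends f ε₁ ε₁ ∧ ¬ Sends f ε₁ ε₂

/-- Among the extreme involutions compatible with the decomposition given by `ξ`, those lying in
`(ξ, ε)` are exactly those whose order is at least that of `ε`. -/
def ByOrd (ξ ε : A ≃+ A) : Prop :=
  ∀ ε' : A ≃+ A, Extreme ε' → Commutes ξ ε' → (core ε' ≤ pairPart ξ ε ↔ ord ε ≤ ord ε')

/-- The condition `Final(ξ₀, ε₀)`; all its quantifiers range over `Aut A`. -/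
def Final (ξ₀ ε₀ : A ≃+ A) : Prop :=
  ByOrd ξ₀ ε₀ ∧
    ∀ ξ₁ ε₁ : A ≃+ A, Pair ξ₁ ε₁ → pairPart ξ₁ ε₁ < pairPart ξ₀ ε₀ → ByOrd ξ₁ ε₁ →
      ∃ f : A ≃+ A,
        (∀ ε : A ≃+ A, Extreme ε → core ε ≤ pairCompl ξ₁ ε₁ → Sends f ε ε) ∧
        (∀ ε : A ≃+ A, Extreme ε → core ε ≤ pairPart ξ₀ ε₀ ⊓ pairCompl ξ₁ ε₁ →
          ∃ ε' : A ≃+ A, Extreme ε' ∧ core ε' ≤ pairPart ξ₁ ε₁ ∧ MapsOnto f ε' ε)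

end Groups

end AutFinal

end

/-!
Since `2` acts bijectively, an involution is up to sign determined by the projection onto one of
its two summands, and commutation becomes commutation of projections. Indecomposable summands of a
reduced `p`-group are cyclic, so an extreme involution is a projection onto a cyclic group of order
`p ^ (k + 1)`. The layer `p ^ n A / p ^ (n + 1) A` counts the cyclic summands of a basic subgroup
whose order is at least `p ^ (n + 1)`, so for large `n` its cardinality is `μ_fin`.

`ByOrd` says that the projection `w` of `ξ₀` splits `A` at some height `m`: its kernel is killed by
`p ^ m`, and the elements of order `p` of its range are divisible by `p ^ m`. If moreover the rank
of `p ^ m B` is already final, then a decomposition of `w` into `π` and a bounded complement `δ`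
leaves enough cyclic summands in `π` for a homomorphism `h` that takes their generators onto all of
the range of `δ`, and `f = 1 + h` witnesses `Final`. If the rank of `p ^ m B` is not final, choose
`π` with fewer summands than `δ`. By cardinality, for every `f`, the range of `δ` contains an
element `d` generating a cyclic summand that meets the image of `f π` only in `0` and that is, up
to `f` and modulo the complement of that summand, infinitely divisible; no extreme involution in
`π` is mapped onto this summand.

For definability, everything about extreme involutions is rewritten in terms of commutation in
`Aut A`. An involution is extreme if its double centralizer relative to any commuting involution
contains no new involutions. Two extreme involutions commuting with `ξ` lie on the same side of `ξ`
if conjugating one of them in the centralizer of `ξ` can destroy commutation with the other. For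
independent `ε` and `ε'`, the double centralizers of `ε` and `ε ε'` meet in the center of `Aut A`
exactly if `ord ε ≤ ord ε'`: their common elements act by a scalar off `A_ε`, by another one on
`A_ε`, and the two agree modulo `ord ε'`.
-/

namespace AutFinal

universe u

section PGroup

variable {p : ℕ} {M : Type*} [AddCommGroup M]

/-- The kernel of the map `M → p ^ n M / p ^ (n + 1) M` induced by multiplication by `p ^ n`. The
index of this subgroup measures the layer `p ^ n M / p ^ (n + 1) M` of the `p`-adic filtration. -/
def layerKer (p n : ℕ) (M : Type*) [AddCommGroup M] : AddSubgroup M :=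
  (nsmulAddMonoidHom (p ^ (n + 1)) : M →+ M).range.comap (nsmulAddMonoidHom (p ^ n))

/-- The element `y` has order `p ^ (k + 1)` and `p ^ k • y` has height exactly `k`. In a `p`-group
this says that the cyclic subgroup generated by `y` is pure and has order `p ^ (k + 1)`. -/
structure IsPureGenerator (p : ℕ) (y : M) (k : ℕ) : Prop where
  pow_succ_smul : p ^ (k + 1) • y = 0
  notMem_layerKer : y ∉ layerKer p k M

theorem mem_layerKer {n : ℕ} {x : M} :
    x ∈ layerKer p n M ↔ ∃ z : M, p ^ (n + 1) • z = p ^ n • x :=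
  Iff.rfl

theorem natCast_pow_zsmul (n : ℕ) (x : M) : ((p : ℤ) ^ n) • x = p ^ n • x := by
  rw [← Nat.cast_pow, natCast_zsmul]

theorem pow_smul_eq_zero_of_le {m n : ℕ} (h : m ≤ n) {x : M} (hx : p ^ m • x = 0) :
    p ^ n • x = 0 := by
  rw [← Nat.sub_add_cancel h, pow_add, mul_smul, hx, smul_zero]

theorem layerKer_mono : Monotone fun n => layerKer p n M := by
  refine monotone_nat_of_le_succ fun n x hx => ?_
  obtain ⟨z, hz⟩ := mem_layerKer.mp hx
  exact mem_layerKer.mpr ⟨z, by rw [pow_succ', mul_smul, hz, ← mul_smul, ← pow_succ']⟩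

theorem IsPureGenerator.pow_smul_ne_zero {y : M} {k : ℕ} (hy : IsPureGenerator p y k) :
    p ^ k • y ≠ 0 := fun h =>
  hy.notMem_layerKer (mem_layerKer.mpr ⟨0, by rw [smul_zero, h]⟩)

theorem exists_eq_pow_mul_not_dvd (hp : p.Prime) {c : ℤ} (hc : c ≠ 0) :
    ∃ (i : ℕ) (u : ℤ), c = (p : ℤ) ^ i * u ∧ ¬ (p : ℤ) ∣ u := by
  have hf : FiniteMultiplicity (p : ℤ) c :=
    Int.finiteMultiplicity_iff.mpr ⟨by simpa using hp.one_lt.ne', hc⟩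
  obtain ⟨u, hu, hd⟩ := hf.exists_eq_pow_mul_and_not_dvd
  exact ⟨_, u, hu, hd⟩

theorem pow_dvd_of_zsmul_eq_zero (hp : p.Prime) {x : M} {k : ℕ} (hne : p ^ k • x ≠ 0)
    (h0 : p ^ (k + 1) • x = 0) {c : ℤ} (hc : c • x = 0) : (p : ℤ) ^ (k + 1) ∣ c := by
  have := Fact.mk hp
  rw [← Nat.cast_pow, ← addOrderOf_eq_prime_pow hne h0]
  exact addOrderOf_dvd_iff_zsmul_eq_zero.mpr hc

namespace IsAbelianPGroup

theorem exists_mul_zsmul_eq (hp : p.Prime) (hM : IsAbelianPGroup p M) {u : ℤ}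
    (hu : ¬ (p : ℤ) ∣ u) (x : M) : ∃ v : ℤ, (v * u) • x = x := by
  obtain ⟨n, hn⟩ := hM x
  obtain ⟨a, b, hab⟩ : IsCoprime u ((p : ℤ) ^ n) :=
    ((Nat.prime_iff_prime_int.mp hp).coprime_iff_not_dvd.mpr hu).symm.pow_right
  refine ⟨a, ?_⟩
  calc (a * u) • x = (a * u + b * (p : ℤ) ^ n) • x := by
        rw [add_smul, mul_smul b, natCast_pow_zsmul, hn, smul_zero, add_zero]
    _ = x := by rw [hab, one_smul]

theorem eq_zero_of_zsmul (hp : p.Prime) (hM : IsAbelianPGroup p M) {u : ℤ}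
    (hu : ¬ (p : ℤ) ∣ u) {x : M} (h : u • x = 0) : x = 0 := by
  obtain ⟨v, hv⟩ := hM.exists_mul_zsmul_eq hp hu x
  rw [← hv, mul_smul, h, smul_zero]

theorem addSubgroup (hM : IsAbelianPGroup p M) (H : AddSubgroup M) : IsAbelianPGroup p H :=
  fun a => (hM a).imp fun _ hn => Subtype.ext hn

theorem quotient (hM : IsAbelianPGroup p M) (H : AddSubgroup M) : IsAbelianPGroup p (M ⧸ H) := by
  rintro ⟨a⟩
  exact (hM a).imp fun n hn => congrArg (QuotientAddGroup.mk (s := H)) hn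

theorem isAddTorsion (hp : p.Prime) (hM : IsAbelianPGroup p M) : IsAddTorsion M := fun x => by
  obtain ⟨n, hn⟩ := hM x
  exact isOfFinAddOrder_iff_nsmul_eq_zero.mpr ⟨p ^ n, pow_pos hp.pos n, hn⟩

theorem exists_pow_smul_ne_zero (hM : IsAbelianPGroup p M) {x : M} (hx : x ≠ 0) :
    ∃ k : ℕ, p ^ k • x ≠ 0 ∧ p ^ (k + 1) • x = 0 := by
  classical
  have h := hM x
  have hfind : Nat.find h ≠ 0 := fun h0 => hx (by simpa [h0] using Nat.find_spec h)
  obtain ⟨k, hk⟩ := Nat.exists_eq_succ_of_ne_zero hfind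
  exact ⟨k, Nat.find_min h (by omega), by simpa only [hk] using Nat.find_spec h⟩

theorem layerKer_eq_top_of_forall_socle {n : ℕ} (hM : IsAbelianPGroup p M)
    (h : ∀ k (x : M), p • p ^ n • x = 0 → ∃ z, p ^ n • x = p ^ (n + k) • z) :
    layerKer p n M = ⊤ := by
  have hall : ∀ r k (x : M), p ^ r • p ^ n • x = 0 → ∃ z, p ^ n • x = p ^ (n + k) • z := by
    intro r
    induction r with
    | zero => exact fun k x hx => ⟨0, by simpa using hx⟩
    | succ r ih =>
      intro k x hx
      obtain ⟨z, hz⟩ := ih (k + 1) (p • x) (by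
        rw [smul_comm (p ^ n) p x, ← mul_smul, ← pow_succ, hx])
      obtain ⟨w, hw⟩ := h k (x - p ^ k • z) (by
        rw [smul_sub, smul_sub, smul_comm p (p ^ n) x, hz, sub_eq_zero]
        simp only [← mul_smul]
        congr 1
        ring)
      refine ⟨w + z, ?_⟩
      rw [smul_add, ← hw, smul_sub, pow_add p n k, mul_smul, sub_add_cancel]
  refine eq_top_iff.mpr fun x _ => ?_
  obtain ⟨r, hr⟩ := hM (p ^ n • x)
  obtain ⟨z, hz⟩ := hall r 1 x hr
  exact mem_layerKer.mpr ⟨z, hz.symm⟩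

theorem exists_isPureGenerator (hM : IsAbelianPGroup p M) {n : ℕ} (h : layerKer p n M ≠ ⊤) :
    ∃ (k : ℕ) (y : M), n ≤ k ∧ IsPureGenerator p y k := by
  contrapose! h
  refine hM.layerKer_eq_top_of_forall_socle fun k x hx => ?_
  induction k with
  | zero => exact ⟨x, rfl⟩
  | succ k ih =>
    obtain ⟨z, hz⟩ := ih
    have hpz : p ^ (n + k + 1) • z = 0 := by rw [pow_succ', mul_smul, ← hz, hx]
    obtain ⟨w, hw⟩ : z ∈ layerKer p (n + k) M :=
      not_not.mp fun hmem => h (n + k) z (Nat.le_add_right n k) ⟨hpz, hmem⟩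
    exact ⟨w, hz.trans hw.symm⟩

end IsAbelianPGroup

theorem IsPureGenerator.exists_zsmul_eq (hp : p.Prime) (hM : IsAbelianPGroup p M) {y x : M}
    {j n : ℕ} {c : ℤ} (hy : IsPureGenerator p y j) (h : c • y = p ^ n • x) :
    ∃ t : ℤ, c • y = ((p : ℤ) ^ n * t) • y := by
  by_cases hc : c = 0
  · exact ⟨0, by simp [hc]⟩
  obtain ⟨i, u, rfl, hu⟩ := exists_eq_pow_mul_not_dvd hp hc
  rcases le_or_gt n i with hni | hin
  · exact ⟨(p : ℤ) ^ (i - n) * u, by rw [← mul_assoc, ← pow_add, Nat.add_sub_cancel' hni]⟩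
  rcases le_or_gt (j + 1) i with hji | hij
  · refine ⟨0, ?_⟩
    rw [mul_comm, mul_smul, natCast_pow_zsmul, pow_smul_eq_zero_of_le hji hy.pow_succ_smul]
    simp
  obtain ⟨v, hv⟩ := hM.exists_mul_zsmul_eq hp hu (p ^ j • y)
  obtain ⟨k, rfl⟩ := Nat.exists_eq_add_of_le (Nat.lt_succ_iff.mp hij)
  obtain ⟨l, rfl⟩ := Nat.exists_eq_add_of_le (Nat.succ_le_of_lt hin)
  refine absurd (mem_layerKer.mpr ⟨(p ^ l * v) • x, ?_⟩) hy.notMem_layerKer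
  calc p ^ (i + k + 1) • ((p : ℤ) ^ l * v) • x
      = ((p : ℤ) ^ k * v) • p ^ (i + 1 + l) • x := by
        simp only [← natCast_pow_zsmul, ← mul_smul]
        congr 1
        ring
    _ = (v * u) • p ^ (i + k) • y := by
        rw [← Nat.succ_eq_add_one, ← h]
        simp only [← natCast_pow_zsmul, ← mul_smul]
        congr 1
        ring
    _ = p ^ (i + k) • y := hv

theorem IsReducedGroup.layerKer_ne_top (hp : p.Prime) (hM : IsAbelianPGroup p M)
    (hR : IsReducedGroup M) {n : ℕ} (hn : ∃ x : M, p ^ n • x ≠ 0) : layerKer p n M ≠ ⊤ := by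
  intro htop
  obtain ⟨x, hx⟩ := hn
  have hpow : ∀ k (x : M), ∃ z, p ^ (n + k) • z = p ^ n • x := by
    intro k x
    induction k with
    | zero => exact ⟨x, rfl⟩
    | succ k ih =>
      obtain ⟨z, hz⟩ := ih
      obtain ⟨w, hw⟩ := mem_layerKer.mp (layerKer_mono (Nat.le_add_right n k) (htop.ge trivial) :
        z ∈ layerKer p (n + k) M)
      exact ⟨w, hw.trans hz⟩
  have hbot : (nsmulAddMonoidHom (p ^ n) : M →+ M).range = ⊥ := by
    refine hR _ ?_
    rintro N hN _ ⟨y, rfl⟩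
    obtain ⟨i, u, hiu, hu⟩ := exists_eq_pow_mul_not_dvd hp (Int.natCast_ne_zero.mpr hN)
    obtain ⟨z, hz⟩ := hpow i y
    obtain ⟨v, hv⟩ := hM.exists_mul_zsmul_eq hp hu (p ^ n • y)
    refine ⟨v • p ^ n • z, ⟨v • z, by rw [nsmulAddMonoidHom_apply, smul_comm]⟩, ?_⟩
    rw [← natCast_zsmul, hiu, nsmulAddMonoidHom_apply, ← hv, ← hz]
    simp only [← mul_smul, ← natCast_pow_zsmul]
    congr 1
    ring
  exact hx ((AddSubgroup.mem_bot).mp (hbot.le ⟨x, rfl⟩))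

end PGroup

section PureIndependence

open Finsupp (supported mem_supported mem_supported')

variable {p : ℕ} {M : Type*} [AddCommGroup M] {s : Set M}

/-- The map sending `c` to the element `∑ c a • a` of `M`; the linear combinations of the elements
of `s` are its values on `Finsupp.supported ℤ ℤ s`. -/
noncomputable abbrev comb : (M →₀ ℤ) →ₗ[ℤ] M := Finsupp.linearCombination ℤ id

/-- A set of elements is pure independent if, whenever a linear combination of its elements is
divisible by `p ^ n` in `M`, each term is divisible by `p ^ n` in the cyclic group of its element.
In a `p`-group this says that the elements are independent and generate a pure subgroup. -/
def PureIndep (p : ℕ) (s : Set M) : Prop :=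
  ∀ c ∈ supported ℤ ℤ s, ∀ (n : ℕ) (x : M), p ^ n • x = comb c →
    ∀ a, ∃ t : ℤ, c a • a = ((p : ℤ) ^ n * t) • a

/-- A `p`-basis of a `p`-group: a basis, as a direct sum of cyclic groups, of a basic subgroup. -/
structure IsPBasis (p : ℕ) (s : Set M) : Prop where
  pureIndep : PureIndep p s
  zero_notMem : (0 : M) ∉ s
  exists_comb_add_smul : ∀ x : M, ∃ c ∈ supported ℤ ℤ s, ∃ z : M, x = comb c + p • z

theorem mem_closure_iff_exists_comb {x : M} :
    x ∈ AddSubgroup.closure s ↔ ∃ c ∈ supported ℤ ℤ s, comb c = x := by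
  rw [← Finsupp.mem_span_image_iff_linearCombination ℤ, Set.image_id,
    ← Submodule.span_int_eq_addSubgroupClosure]
  rfl

theorem comb_mem_closure {c : M →₀ ℤ} (hc : c ∈ supported ℤ ℤ s) :
    comb c ∈ AddSubgroup.closure s :=
  mem_closure_iff_exists_comb.mpr ⟨c, hc, rfl⟩

theorem comb_single (a : M) (t : ℤ) : comb (Finsupp.single a t) = t • a :=
  Finsupp.linearCombination_single ℤ t a

theorem comb_eq_comb_erase_add (c : M →₀ ℤ) (a : M) : comb c = comb (c.erase a) + c a • a := by
  rw [← comb_single, ← map_add, Finsupp.erase_add_single]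

theorem erase_mem_supported {α : Type*} {s : Set α} {a : α} {c : α →₀ ℤ}
    (hc : c ∈ supported ℤ ℤ (insert a s)) :
    c.erase a ∈ supported ℤ ℤ s := by
  classical
  rw [mem_supported] at hc ⊢
  intro b hb
  rw [Finsupp.support_erase, Finset.coe_erase] at hb
  exact (hc hb.1).resolve_left hb.2

theorem iSup_ne_zmultiples (i : s) :
    ⨆ j, ⨆ (_ : j ≠ i), AddSubgroup.zmultiples ((j : s) : M) =
      AddSubgroup.closure (s \ {(i : M)}) := by
  refine le_antisymm (iSup₂_le fun j hj => ?_) ((AddSubgroup.closure_le _).mpr ?_)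
  · exact AddSubgroup.zmultiples_le.mpr
      (AddSubgroup.subset_closure ⟨j.2, fun h => hj (Subtype.ext h)⟩)
  · rintro x ⟨hx, hxi⟩
    exact (le_iSup₂_of_le (f := fun (j : s) (_ : j ≠ i) => AddSubgroup.zmultiples (j : M))
      ⟨x, hx⟩ (fun h => hxi (congrArg Subtype.val h)) le_rfl) (AddSubgroup.mem_zmultiples x)

theorem independentElems_iff_comb :
    IndependentElems s ↔ ∀ c ∈ supported ℤ ℤ s, comb c = 0 → ∀ a, c a • a = 0 := by
  constructor
  · intro h c hc hcomb a
    by_cases ha : a ∈ s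
    · have hdisj := h ⟨a, ha⟩
      rw [iSup_ne_zmultiples, AddSubgroup.disjoint_def] at hdisj
      refine hdisj (AddSubgroup.zsmul_mem_zmultiples a (c a)) ?_
      rw [comb_eq_comb_erase_add c a, add_comm, ← eq_neg_iff_add_eq_zero] at hcomb
      rw [hcomb]
      exact neg_mem (comb_mem_closure (erase_mem_supported (by
        rwa [Set.insert_sdiff_singleton, Set.insert_eq_of_mem ha])))
    · rw [(mem_supported' ℤ c).mp hc a ha, zero_smul]
  · intro h i
    rw [iSup_ne_zmultiples, AddSubgroup.disjoint_def]
    rintro _ ⟨t, rfl⟩ hx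
    obtain ⟨c, hc, hcx⟩ := mem_closure_iff_exists_comb.mp hx
    have hci : c (i : M) = 0 := (mem_supported' ℤ c).mp hc _ (by simp)
    have hzero := h (Finsupp.single (i : M) t - c)
      (sub_mem (Finsupp.single_mem_supported _ _ i.2)
        (Finsupp.supported_mono Set.sdiff_subset hc))
      (by rw [map_sub, hcx]; exact sub_eq_zero.mpr (comb_single _ _)) i
    simpa [hci] using hzero

theorem exists_comb_eq_pow_smul {c : M →₀ ℤ} (hc : c ∈ supported ℤ ℤ s) {n : ℕ}
    (h : ∀ a, ∃ t : ℤ, c a • a = ((p : ℤ) ^ n * t) • a) :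
    ∃ d ∈ supported ℤ ℤ s, comb c = p ^ n • comb d := by
  choose t ht using h
  refine ⟨∑ a ∈ c.support, Finsupp.single a (t a),
    sum_mem fun a ha => Finsupp.single_mem_supported _ _ ((mem_supported ℤ c).mp hc ha), ?_⟩
  rw [map_sum, Finset.smul_sum, Finsupp.linearCombination_apply]
  refine Finset.sum_congr rfl fun a _ => ?_
  rw [comb_single]
  change c a • a = _
  rw [ht a, mul_smul, natCast_pow_zsmul]

theorem exists_maximal_forall_supported {α : Type*} (P : (α →₀ ℤ) → Prop) {s₀ : Set α}
    (h₀ : ∀ c ∈ supported ℤ ℤ s₀, P c) :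
    ∃ s, s₀ ⊆ s ∧ Maximal (fun s : Set α => ∀ c ∈ supported ℤ ℤ s, P c) s := by
  refine zorn_subset_nonempty {s : Set α | ∀ c ∈ supported ℤ ℤ s, P c}
    (fun C hC hchain hne => ⟨⋃₀ C, fun c hc => ?_, fun s hs => Set.subset_sUnion_of_mem hs⟩) s₀ h₀
  obtain ⟨t, htC, ht⟩ := hchain.directedOn.exists_mem_subset_of_finite_of_subset_sUnion hne
    c.support.finite_toSet ((mem_supported ℤ c).mp hc)
  exact hC htC c ((mem_supported ℤ c).mpr ht)

namespace PureIndep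

theorem mono {t : Set M} (hs : PureIndep p s) (h : t ⊆ s) : PureIndep p t :=
  fun c hc => hs c (Finsupp.supported_mono h hc)

theorem empty : PureIndep p (∅ : Set M) := fun c hc _ _ _ a =>
  ⟨0, by rw [(mem_supported' ℤ c).mp hc a (Set.notMem_empty a)]; simp⟩

theorem zsmul_eq_zero (hM : IsAbelianPGroup p M) (hs : PureIndep p s) {c : M →₀ ℤ}
    (hc : c ∈ supported ℤ ℤ s) (hcomb : comb c = 0) (a : M) : c a • a = 0 := by
  obtain ⟨n, hn⟩ := hM a
  obtain ⟨t, ht⟩ := hs c hc n 0 (by rw [hcomb, smul_zero]) a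
  rw [ht, mul_comm, mul_smul, natCast_pow_zsmul, hn, smul_zero]

theorem insert (hp : p.Prime) (hM : IsAbelianPGroup p M) (hs : PureIndep p s) {y : M} {j : ℕ}
    (hy : p ^ (j + 1) • y = 0)
    (hgen : IsPureGenerator p (y : M ⧸ AddSubgroup.closure s) j) : PureIndep p (insert y s) := by
  intro c hc n x hx a
  have hc' : c.erase y ∈ supported ℤ ℤ s := erase_mem_supported hc
  have hcomb := comb_eq_comb_erase_add c y
  have hmk : c y • (y : M ⧸ AddSubgroup.closure s) = p ^ n • (x : M ⧸ AddSubgroup.closure s) := by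
    rw [← QuotientAddGroup.mk_nsmul, hx, hcomb, QuotientAddGroup.mk_add,
      (QuotientAddGroup.eq_zero_iff _).mpr (comb_mem_closure hc'), zero_add,
      QuotientAddGroup.mk_zsmul]
  obtain ⟨t, ht⟩ := hgen.exists_zsmul_eq hp (hM.quotient _) hmk
  -- `y` has the same order as its class, so relations between multiples of the class lift.
  have hty : c y • y = ((p : ℤ) ^ n * t) • y := by
    rw [← sub_eq_zero, ← sub_smul] at ht ⊢
    obtain ⟨d, hd⟩ := pow_dvd_of_zsmul_eq_zero hp hgen.pow_smul_ne_zero hgen.pow_succ_smul ht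
    rw [hd, mul_comm, mul_smul, natCast_pow_zsmul, hy, smul_zero]
  by_cases ha : a = y
  · exact ⟨t, ha ▸ hty⟩
  · obtain ⟨t', ht'⟩ := hs (c.erase y) hc' n (x - t • y) (by
      rw [smul_sub, hx, hcomb, hty, mul_smul, natCast_pow_zsmul, add_sub_cancel_right]) a
    exact ⟨t', by rwa [Finsupp.erase_ne ha] at ht'⟩

theorem exists_mk_eq_of_pow_smul_eq_zero (hs : PureIndep p s) {n : ℕ}
    {y : M ⧸ AddSubgroup.closure s} (hy : p ^ n • y = 0) :
    ∃ x : M, (x : M ⧸ AddSubgroup.closure s) = y ∧ p ^ n • x = 0 := by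
  obtain ⟨x, rfl⟩ := QuotientAddGroup.mk_surjective y
  rw [← QuotientAddGroup.mk_nsmul, QuotientAddGroup.eq_zero_iff] at hy
  obtain ⟨c, hc, hcx⟩ := mem_closure_iff_exists_comb.mp hy
  obtain ⟨d, hd, hcd⟩ := exists_comb_eq_pow_smul hc (hs c hc n x hcx.symm)
  refine ⟨x - comb d, ?_, by rw [smul_sub, ← hcd, hcx, sub_self]⟩
  rw [QuotientAddGroup.mk_sub, (QuotientAddGroup.eq_zero_iff _).mpr (comb_mem_closure hd), sub_zero]

theorem exists_comb_add_smul_of_maximal (hp : p.Prime) (hM : IsAbelianPGroup p M)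
    (hmax : Maximal (PureIndep p) s) (x : M) :
    ∃ c ∈ supported ℤ ℤ s, ∃ z : M, x = comb c + p • z := by
  have htop : layerKer p 0 (M ⧸ AddSubgroup.closure s) = ⊤ := by
    by_contra hne
    obtain ⟨j, y, -, hy⟩ := (hM.quotient _).exists_isPureGenerator hne
    obtain ⟨y, rfl, hy0⟩ := hmax.prop.exists_mk_eq_of_pow_smul_eq_zero hy.pow_succ_smul
    have hys : y ∈ s := hmax.le_of_ge (hmax.prop.insert hp hM hy0 hy) (Set.subset_insert y s)
      (Set.mem_insert y s)
    exact hy.pow_smul_ne_zero (by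
      rw [(QuotientAddGroup.eq_zero_iff y).mpr (AddSubgroup.subset_closure hys), smul_zero])
  obtain ⟨z, hz⟩ := mem_layerKer.mp (htop.ge trivial : (x : M ⧸ AddSubgroup.closure s) ∈ _)
  obtain ⟨z, rfl⟩ := QuotientAddGroup.mk_surjective z
  rw [zero_add, pow_one, pow_zero, one_smul, ← QuotientAddGroup.mk_nsmul, QuotientAddGroup.eq] at hz
  obtain ⟨c, hc, hcx⟩ := mem_closure_iff_exists_comb.mp hz
  exact ⟨c, hc, z, by rw [hcx, neg_add_eq_sub, sub_add_cancel]⟩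

theorem exists_isPBasis (hp : p.Prime) (hM : IsAbelianPGroup p M) {s₀ : Set M}
    (h₀ : PureIndep p s₀) (hz : (0 : M) ∉ s₀) : ∃ s, s₀ ⊆ s ∧ IsPBasis p s := by
  obtain ⟨s, hs₀, hmax⟩ := exists_maximal_forall_supported (fun c : M →₀ ℤ =>
    ∀ (n : ℕ) (x : M), p ^ n • x = comb c → ∀ a, ∃ t : ℤ, c a • a = ((p : ℤ) ^ n * t) • a) h₀
  refine ⟨s \ {0}, fun a ha => ⟨hs₀ ha, fun h => hz (h ▸ ha)⟩, mono hmax.prop Set.sdiff_subset,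
    by simp, fun x => ?_⟩
  obtain ⟨c, hc, z, hx⟩ := exists_comb_add_smul_of_maximal hp hM hmax x
  refine ⟨c.erase 0, erase_mem_supported ?_, z, ?_⟩
  · rw [Set.insert_sdiff_singleton]
    exact Finsupp.supported_mono (Set.subset_insert 0 s) hc
  · rw [hx, comb_eq_comb_erase_add c 0, smul_zero, add_zero]

end PureIndep

theorem IsPureGenerator.pureIndep (hp : p.Prime) (hM : IsAbelianPGroup p M) {y : M} {j : ℕ}
    (hy : IsPureGenerator p y j) : PureIndep p {y} := by
  intro c hc n x hx a
  by_cases ha : a = y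
  · subst ha
    have hzero : c.erase a ∈ supported ℤ ℤ (∅ : Set M) :=
      erase_mem_supported (by rwa [insert_empty_eq])
    rw [comb_eq_comb_erase_add c a, (by simpa using hzero : c.erase a = 0), map_zero,
      zero_add] at hx
    exact hy.exists_zsmul_eq hp hM hx.symm
  · exact ⟨0, by rw [(mem_supported' ℤ c).mp hc a ha]; simp⟩

namespace IsPBasis

theorem exists_comb_add_pow_smul (hs : IsPBasis p s) (k : ℕ) (x : M) :
    ∃ c ∈ supported ℤ ℤ s, ∃ z : M, x = comb c + p ^ k • z := by
  induction k with
  | zero => exact ⟨0, zero_mem _, x, by simp⟩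
  | succ k ih =>
    obtain ⟨c, hc, z, hx⟩ := ih
    obtain ⟨d, hd, w, hz⟩ := hs.exists_comb_add_smul z
    refine ⟨c + (p : ℤ) ^ k • d, add_mem hc (Submodule.smul_mem _ _ hd), w, ?_⟩
    rw [hx, hz, map_add, map_smul, natCast_pow_zsmul, smul_add, ← add_assoc, pow_succ, mul_smul]

theorem exists_hom_apply_eq (hs : IsPBasis p s) {D : Type*} [AddCommGroup D] {k : ℕ}
    (hD : ∀ d : D, p ^ k • d = 0) (v : M → D)
    (hv : ∀ a ∈ s, ∀ c : ℤ, c • a = 0 → c • v a = 0) : ∃ h : M →+ D, ∀ a ∈ s, h a = v a := by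
  -- The values of `h` are forced on `comb c + p ^ k • z`; these elements exhaust `M`.
  let L : supported ℤ ℤ s × M →+ M :=
    ((Finsupp.linearCombination ℤ (id : M → M)).toAddMonoidHom.comp
      (supported ℤ ℤ s).subtype.toAddMonoidHom).coprod (nsmulAddMonoidHom (p ^ k))
  let L' : supported ℤ ℤ s × M →+ D :=
    ((Finsupp.linearCombination ℤ v).toAddMonoidHom.comp
      (supported ℤ ℤ s).subtype.toAddMonoidHom).coprod 0
  have hL : Function.Surjective L := by
    intro x
    obtain ⟨c, hc, z, hx⟩ := hs.exists_comb_add_pow_smul k x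
    exact ⟨(⟨c, hc⟩, z), hx.symm⟩
  have hker : L.ker ≤ L'.ker := by
    rintro ⟨⟨c, hc⟩, z⟩ (h : comb c + p ^ k • z = 0)
    have hdiv := hs.pureIndep c hc k (-z) (by rw [smul_neg, ← eq_neg_of_add_eq_zero_left h])
    change Finsupp.linearCombination ℤ v c + 0 = 0
    rw [add_zero, Finsupp.linearCombination_apply]
    refine Finset.sum_eq_zero fun a ha => ?_
    obtain ⟨t, ht⟩ := hdiv a
    have hva := hv a ((mem_supported ℤ c).mp hc ha) (c a - (p : ℤ) ^ k * t) (by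
      rw [sub_smul, ht, sub_self])
    rw [sub_smul, sub_eq_zero] at hva
    change c a • v a = 0
    rw [hva, mul_comm, mul_smul, natCast_pow_zsmul, hD, smul_zero]
  refine ⟨L.liftOfSurjective hL ⟨L', hker⟩, fun a ha => ?_⟩
  have hlift := AddMonoidHom.liftOfRightInverse_comp_apply L _ (Function.rightInverse_surjInv hL)
    ⟨L', hker⟩ (⟨Finsupp.single a 1, Finsupp.single_mem_supported _ _ ha⟩, 0)
  simpa [L, L'] using hlift

end IsPBasis

theorem exists_isPBasis (hp : p.Prime) (hM : IsAbelianPGroup p M) : ∃ s : Set M, IsPBasis p s :=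
  let ⟨s, _, hs⟩ := PureIndep.empty.exists_isPBasis hp hM (Set.notMem_empty 0)
  ⟨s, hs⟩

end PureIndependence

section Ranks

open Finsupp (supported mem_supported)

variable {p n : ℕ} {M : Type u} [AddCommGroup M] {s : Set M} {κ : Cardinal.{u}}

/-- The cardinality of the layer `p ^ n M / p ^ (n + 1) M`. For infinite layers this is the rank of
`p ^ n B`, where `B` is a basic subgroup of `M`. -/
noncomputable def layerCard (p n : ℕ) (M : Type u) [AddCommGroup M] : Cardinal.{u} :=
  #(M ⧸ layerKer p n M)

/-- The elements of `s` of order greater than `p ^ n`. If `s` is a `p`-basis of `M`, they give a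
basis of the layer `p ^ n M / p ^ (n + 1) M` over the field with `p` elements. -/
def highPart (p n : ℕ) (s : Set M) : Set M := {a ∈ s | p ^ n • a ≠ 0}

theorem mk_closure_le (hκ : ℵ₀ ≤ κ) (hs : #s ≤ κ) : #(AddSubgroup.closure s) ≤ κ := by
  have himage : (AddSubgroup.closure s : Set M) ⊆ comb '' (supported ℤ ℤ s : Set (M →₀ ℤ)) :=
    fun _ hx => mem_closure_iff_exists_comb.mp hx
  refine (mk_le_mk_of_subset himage).trans (mk_image_le.trans ?_)
  refine (mk_congr (Finsupp.supportedEquivFinsupp (M := ℤ) (R := ℤ) s).toEquiv).trans_le ?_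
  rcases isEmpty_or_nonempty s with hempty | hne
  · exact (mk_eq_one _).trans_le (one_le_aleph0.trans hκ)
  · rw [mk_finsupp_lift_of_infinite']
    simpa using ⟨hs, hκ⟩

theorem finite_closure (hp : p.Prime) (hM : IsAbelianPGroup p M) (hs : s.Finite) :
    Finite (AddSubgroup.closure s) := by
  have : Finite s := hs
  exact AddCommGroup.finite_of_fg_isAddTorsion _ ((hM.addSubgroup _).isAddTorsion hp)

theorem mk_quotient_le_of_le {H K : AddSubgroup M} (h : H ≤ K) : #(M ⧸ K) ≤ #(M ⧸ H) := by
  refine mk_le_of_surjective (f := QuotientAddGroup.map H K (AddMonoidHom.id M) h) fun x => ?_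
  obtain ⟨y, rfl⟩ := QuotientAddGroup.mk_surjective x
  exact ⟨y, rfl⟩

theorem layerCard_antitone : Antitone fun n => layerCard p n M :=
  fun _ _ h => mk_quotient_le_of_le (layerKer_mono h)

theorem highPart_subset : highPart p n s ⊆ s := fun _ ha => ha.1

theorem map_closure_eq_closure_image_highPart :
    (AddSubgroup.closure s).map (nsmulAddMonoidHom (p ^ n)) =
      AddSubgroup.closure ((fun x => p ^ n • x) '' highPart p n s) := by
  rw [AddMonoidHom.map_closure]
  refine le_antisymm ((AddSubgroup.closure_le _).mpr ?_)
    (AddSubgroup.closure_mono (Set.image_mono highPart_subset))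
  rintro _ ⟨a, ha, rfl⟩
  by_cases h0 : p ^ n • a = 0
  · rw [nsmulAddMonoidHom_apply, h0]
    exact zero_mem _
  · exact AddSubgroup.subset_closure ⟨a, ⟨ha, h0⟩, rfl⟩

theorem mk_map_closure_le (hκ : ℵ₀ ≤ κ) (h : #(highPart p n s) ≤ κ) :
    #((AddSubgroup.closure s).map (nsmulAddMonoidHom (p ^ n))) ≤ κ := by
  rw [map_closure_eq_closure_image_highPart]
  exact mk_closure_le hκ (mk_image_le.trans h)

namespace PureIndep

theorem pow_smul_eq_zero_of_sub_mem_layerKer (hp : p.Prime) (hM : IsAbelianPGroup p M)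
    (hs : PureIndep p s) {a b : M} (ha : a ∈ s) (hb : b ∈ s) (hab : a ≠ b)
    (h : a - b ∈ layerKer p n M) : p ^ n • a = 0 := by
  obtain ⟨z, hz⟩ := mem_layerKer.mp h
  obtain ⟨t, ht⟩ := hs (Finsupp.single a ((p : ℤ) ^ n) - Finsupp.single b ((p : ℤ) ^ n))
    (sub_mem (Finsupp.single_mem_supported _ _ ha) (Finsupp.single_mem_supported _ _ hb)) (n + 1) z
    (by rw [hz, map_sub, comb_single, comb_single, ← smul_sub, natCast_pow_zsmul]) a
  rw [Finsupp.sub_apply, Finsupp.single_eq_same, Finsupp.single_eq_of_ne hab, sub_zero] at ht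
  refine hM.eq_zero_of_zsmul hp (u := 1 - p * t) (fun hd => ?_) ?_
  · have hone : (p : ℤ) ∣ 1 := by simpa using dvd_add hd (dvd_mul_right (p : ℤ) t)
    exact (Nat.prime_iff_prime_int.mp hp).not_isUnit (isUnit_of_dvd_one hone)
  · calc (1 - p * t) • p ^ n • a = (p : ℤ) ^ n • a - ((p : ℤ) ^ (n + 1) * t) • a := by
          rw [← natCast_pow_zsmul, ← mul_smul, ← sub_smul]
          congr 1
          ring
      _ = 0 := sub_eq_zero.mpr ht

theorem mk_highPart_le_layerCard (hp : p.Prime) (hM : IsAbelianPGroup p M) (hs : PureIndep p s) :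
    #(highPart p n s) ≤ layerCard p n M := by
  refine mk_le_of_injective (f := fun a : highPart p n s => ((a : M) : M ⧸ layerKer p n M))
    fun a b hab => Subtype.ext (by_contra fun hne => b.2.2 ?_)
  exact hs.pow_smul_eq_zero_of_sub_mem_layerKer hp hM b.2.1 a.2.1 (Ne.symm hne) (by
    simpa only [neg_add_eq_sub] using QuotientAddGroup.eq.mp hab)

theorem eq_of_zsmul_eq_zsmul (hM : IsAbelianPGroup p M) (hs : PureIndep p s) {a b : M} (ha : a ∈ s)
    (hb : b ∈ s) {k l : ℤ} (hk : k • a ≠ 0) (h : k • a = l • b) : a = b := by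
  by_contra hne
  have hzero := hs.zsmul_eq_zero hM (c := Finsupp.single a k - Finsupp.single b l)
    (sub_mem (Finsupp.single_mem_supported _ _ ha) (Finsupp.single_mem_supported _ _ hb))
    (by rw [map_sub, comb_single, comb_single, h, sub_self]) a
  rw [Finsupp.sub_apply, Finsupp.single_eq_same, Finsupp.single_eq_of_ne hne, sub_zero] at hzero
  exact hk hzero

theorem mk_highPart_le_of_socle_le (hM : IsAbelianPGroup p M) (hs : PureIndep p s)
    {H : AddSubgroup M}
    (hH : ∀ g ∈ (AddSubgroup.closure s).map (nsmulAddMonoidHom (p ^ n)), p • g = 0 → g ∈ H) :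
    #(highPart p n s) ≤ #H := by
  have hlast : ∀ a : highPart p n s, ∃ r : ℕ, p ^ r • p ^ n • (a : M) ≠ 0 ∧
      p ^ (r + 1) • p ^ n • (a : M) = 0 := fun a => hM.exists_pow_smul_ne_zero a.2.2
  choose r hr hr' using hlast
  have hmem : ∀ a : highPart p n s, p ^ r a • p ^ n • (a : M) ∈ H := fun a =>
    hH _ (AddSubgroup.nsmul_mem _ (AddSubgroup.mem_map_of_mem _
      (AddSubgroup.subset_closure a.2.1)) _) (by
      rw [← mul_smul, ← pow_succ', hr'])
  refine mk_le_of_injective (f := fun a => (⟨_, hmem a⟩ : H)) fun a b hab => Subtype.ext ?_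
  have hzsmul : ∀ a : highPart p n s,
      p ^ r a • p ^ n • (a : M) = (p : ℤ) ^ (r a + n) • (a : M) := fun a => by
    rw [← mul_smul, ← pow_add, natCast_pow_zsmul]
  have hab' := congrArg (Subtype.val (p := (· ∈ H))) hab
  simp only [hzsmul] at hab'
  exact hs.eq_of_zsmul_eq_zsmul hM a.2.1 b.2.1 (hzsmul a ▸ hr a) hab'

end PureIndep

namespace IsPBasis

theorem layerCard_le_mk_map_closure (hs : IsPBasis p s) :
    layerCard p n M ≤ #((AddSubgroup.closure s).map (nsmulAddMonoidHom (p ^ n))) := by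
  have hroot : ∀ g : (AddSubgroup.closure s).map (nsmulAddMonoidHom (p ^ n)),
      ∃ b : M, p ^ n • b = g := fun g => g.2.imp fun _ hb => hb.2
  choose f hf using hroot
  refine mk_le_of_surjective (f := fun g => ((f g : M) : M ⧸ layerKer p n M)) fun x => ?_
  obtain ⟨x, rfl⟩ := QuotientAddGroup.mk_surjective x
  obtain ⟨c, hc, z, hx⟩ := hs.exists_comb_add_smul x
  refine ⟨⟨p ^ n • comb c, _, comb_mem_closure hc, rfl⟩, ?_⟩
  rw [QuotientAddGroup.eq, mem_layerKer]
  exact ⟨z, by rw [smul_add, smul_neg, hf, hx, smul_add, neg_add_cancel_left, pow_succ, mul_smul]⟩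

theorem aleph0_le_mk_highPart (hp : p.Prime) (hM : IsAbelianPGroup p M) (hs : IsPBasis p s)
    (h : ℵ₀ ≤ layerCard p n M) : ℵ₀ ≤ #(highPart p n s) := by
  contrapose! h
  rw [lt_aleph0_iff_set_finite] at h
  have hfin := finite_closure hp hM (h.image (fun x => p ^ n • x))
  rw [← map_closure_eq_closure_image_highPart] at hfin
  exact hs.layerCard_le_mk_map_closure.trans_lt (lt_aleph0_iff_finite.mpr hfin)

theorem layerCard_eq_mk_highPart (hp : p.Prime) (hM : IsAbelianPGroup p M) (hs : IsPBasis p s)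
    (h : ℵ₀ ≤ layerCard p n M) : layerCard p n M = #(highPart p n s) :=
  le_antisymm
    (hs.layerCard_le_mk_map_closure.trans
      (mk_map_closure_le (hs.aleph0_le_mk_highPart hp hM h) le_rfl))
    (hs.pureIndep.mk_highPart_le_layerCard hp hM)

theorem layerCard_le_of_mk_le (hs : IsPBasis p s) (hκ : ℵ₀ ≤ κ) (h : #s ≤ κ) :
    layerCard p n M ≤ κ :=
  hs.layerCard_le_mk_map_closure.trans
    (mk_map_closure_le hκ ((mk_le_mk_of_subset highPart_subset).trans h))

theorem mk_le_layerCard_zero (hp : p.Prime) (hM : IsAbelianPGroup p M) (hs : IsPBasis p s) :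
    #s ≤ layerCard p 0 M := by
  refine (mk_le_mk_of_subset fun a ha => ?_).trans (hs.pureIndep.mk_highPart_le_layerCard hp hM)
  refine ⟨ha, ?_⟩
  rw [pow_zero, one_smul]
  rintro rfl
  exact hs.zero_notMem ha

end IsPBasis

theorem mk_quotient_range_pow_le (hp : p.Prime) (hM : IsAbelianPGroup p M) (hκ : ℵ₀ ≤ κ)
    (h : layerCard p 0 M ≤ κ) (k : ℕ) :
    #(M ⧸ (nsmulAddMonoidHom (p ^ k) : M →+ M).range) ≤ κ := by
  obtain ⟨s, hs⟩ := exists_isPBasis hp hM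
  refine le_trans ?_ (mk_closure_le hκ ((hs.mk_le_layerCard_zero hp hM).trans h))
  refine mk_le_of_surjective (f := fun g : AddSubgroup.closure s =>
    ((g : M) : M ⧸ (nsmulAddMonoidHom (p ^ k) : M →+ M).range)) fun x => ?_
  obtain ⟨x, rfl⟩ := QuotientAddGroup.mk_surjective x
  obtain ⟨c, hc, z, rfl⟩ := hs.exists_comb_add_pow_smul k x
  refine ⟨⟨comb c, comb_mem_closure hc⟩, QuotientAddGroup.eq.mpr ⟨z, ?_⟩⟩
  rw [neg_add_cancel_left, nsmulAddMonoidHom_apply]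

theorem mk_le_of_pow_smul_eq_zero (hp : p.Prime) (hM : IsAbelianPGroup p M) (hκ : ℵ₀ ≤ κ)
    (h : layerCard p 0 M ≤ κ) {k : ℕ} (hk : ∀ x : M, p ^ k • x = 0) : #M ≤ κ := by
  refine le_trans ?_ (mk_quotient_range_pow_le hp hM hκ h k)
  refine mk_le_of_injective
    (f := fun x : M => (x : M ⧸ (nsmulAddMonoidHom (p ^ k) : M →+ M).range)) fun x y hxy => ?_
  obtain ⟨z, hz⟩ := QuotientAddGroup.eq.mp hxy
  rw [nsmulAddMonoidHom_apply, hk] at hz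
  exact neg_add_eq_zero.mp hz.symm

theorem exists_maximal_isRankSystem (G : Type u) [AddCommGroup G] :
    ∃ s : Set G, Maximal IsRankSystem s := by
  obtain ⟨s, -, hs⟩ := exists_maximal_forall_supported (s₀ := (∅ : Set G)) (fun c : G →₀ ℤ =>
    (comb c = 0 → ∀ a, c a • a = 0) ∧
      ∀ a ∈ c.support, addOrderOf a = 0 ∨ IsPrimePow (addOrderOf a)) (by simp)
  refine ⟨s, ?_⟩
  convert hs using 1
  ext t
  rw [IsRankSystem, independentElems_iff_comb]
  refine ⟨fun ht c hc => ⟨ht.1 c hc, fun a ha => ht.2 a (hc ha)⟩,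
    fun ht => ⟨fun c hc => (ht c hc).1, fun a ha => ?_⟩⟩
  exact (ht _ (Finsupp.single_mem_supported ℤ 1 ha)).2 a (by simp)

theorem rank_eq_of_forall_maximal (h : ∀ σ : Set M, Maximal IsRankSystem σ → #σ = κ) :
    rank M = κ := by
  obtain ⟨σ, hσ⟩ := exists_maximal_isRankSystem M
  have hset : {μ | ∃ σ : Set M, Maximal IsRankSystem σ ∧ #σ = μ} = {κ} :=
    Set.eq_singleton_iff_unique_mem.mpr ⟨⟨σ, hσ, h σ hσ⟩, fun _ ⟨τ, hτ, hμ⟩ => hμ ▸ h τ hτ⟩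
  rw [rank, hset, csInf_singleton]

theorem rank_le_mk (G : Type u) [AddCommGroup G] : rank G ≤ #G := by
  obtain ⟨s, hs⟩ := exists_maximal_isRankSystem G
  refine (csInf_le' ?_).trans (mk_set_le s)
  exact ⟨s, hs, rfl⟩

theorem IndependentElems.insert_of_socle (hp : p.Prime) (hM : IsAbelianPGroup p M)
    (hs : IndependentElems s) {g : M} (hg : p • g = 0) (hgs : g ∉ AddSubgroup.closure s) :
    IndependentElems (insert g s) := by
  refine independentElems_iff_comb.mpr fun c hc h0 a => ?_
  have hce : c.erase g ∈ supported ℤ ℤ s := erase_mem_supported hc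
  have hsum := comb_eq_comb_erase_add c g
  have hcg : c g • g = 0 := by
    by_cases hd : (p : ℤ) ∣ c g
    · obtain ⟨t, ht⟩ := hd
      rw [ht, mul_comm, mul_smul, natCast_zsmul, hg, smul_zero]
    · refine absurd ?_ hgs
      obtain ⟨v, hv⟩ := hM.exists_mul_zsmul_eq hp hd g
      rw [h0, add_comm, eq_comm, ← eq_neg_iff_add_eq_zero] at hsum
      rw [← hv, mul_smul, hsum]
      exact AddSubgroup.zsmul_mem _ (neg_mem (comb_mem_closure hce)) v
  rw [h0, hcg, add_zero] at hsum
  by_cases ha : a = g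
  · rw [ha, hcg]
  · simpa only [Finsupp.erase_ne ha] using independentElems_iff_comb.mp hs _ hce hsum.symm a

theorem mem_closure_of_maximal_isRankSystem (hp : p.Prime) (hM : IsAbelianPGroup p M)
    (hs : Maximal IsRankSystem s) {g : M} (hg : p • g = 0) : g ∈ AddSubgroup.closure s := by
  by_contra hgs
  have hg0 : g ≠ 0 := fun h => hgs (h ▸ zero_mem _)
  have hsystem : IsRankSystem (insert g s) := by
    refine ⟨hs.prop.1.insert_of_socle hp hM hg hgs,
      Set.forall_mem_insert.mpr ⟨Or.inr ?_, hs.prop.2⟩⟩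
    have := Fact.mk hp
    rw [addOrderOf_eq_prime_iff.mpr ⟨hg, hg0⟩]
    exact hp.isPrimePow
  exact hgs (AddSubgroup.subset_closure
    (hs.le_of_ge hsystem (Set.subset_insert g s) (Set.mem_insert g s)))

theorem IsPBasis.rank_map_closure (hp : p.Prime) (hM : IsAbelianPGroup p M) (hs : IsPBasis p s)
    (h : ℵ₀ ≤ layerCard p n M) :
    rank ((AddSubgroup.closure s).map (nsmulAddMonoidHom (p ^ n))) = layerCard p n M := by
  rw [hs.layerCard_eq_mk_highPart hp hM h]
  set G := (AddSubgroup.closure s).map (nsmulAddMonoidHom (p ^ n))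
  have hinf := hs.aleph0_le_mk_highPart hp hM h
  refine rank_eq_of_forall_maximal fun σ hσ => ?_
  have hle : #(highPart p n s) ≤ #(AddSubgroup.closure σ) := by
    refine (hs.pureIndep.mk_highPart_le_of_socle_le hM (n := n)
      (H := (AddSubgroup.closure σ).map G.subtype) fun g hg hpg => ?_).trans mk_image_le
    exact ⟨⟨g, hg⟩, mem_closure_of_maximal_isRankSystem hp (hM.addSubgroup G) hσ
      (Subtype.ext hpg), rfl⟩
  have hσinf : ℵ₀ ≤ #σ := by
    by_contra! hlt
    have := finite_closure hp (hM.addSubgroup G) (lt_aleph0_iff_set_finite.mp hlt)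
    exact (hinf.trans hle).not_gt (lt_aleph0_iff_finite.mpr this)
  exact le_antisymm ((mk_set_le σ).trans (mk_map_closure_le hinf le_rfl))
    (hle.trans (mk_closure_le hσinf le_rfl))

theorem IsPBasis.isBasic (hp : p.Prime) (hM : IsAbelianPGroup p M) (hs : IsPBasis p s) :
    IsBasic p (AddSubgroup.closure s) where
  directSum := by
    refine ⟨s, independentElems_iff_comb.mpr fun c hc h0 => hs.pureIndep.zsmul_eq_zero hM hc h0,
      rfl, fun a _ => Or.inr ?_⟩
    obtain ⟨n, hn⟩ := hM a
    obtain ⟨k, -, hk⟩ := (Nat.dvd_prime_pow hp).mp (addOrderOf_dvd_of_nsmul_eq_zero hn)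
    exact ⟨k, hk⟩
  pure := by
    rintro n g hg ⟨x, hx⟩
    by_cases hn : n = 0
    · exact ⟨0, zero_mem _, by rw [← hx, hn, smul_zero, zero_smul]⟩
    obtain ⟨i, u, rfl, hu⟩ := exists_eq_pow_mul_not_dvd hp hn
    obtain ⟨c, hc, rfl⟩ := mem_closure_iff_exists_comb.mp hg
    obtain ⟨d, hd, hcd⟩ := exists_comb_eq_pow_smul hc (hs.pureIndep c hc i (u • x) (by
      rw [← hx, mul_smul, natCast_pow_zsmul]))
    obtain ⟨v, hv⟩ := hM.exists_mul_zsmul_eq hp hu (comb d)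
    refine ⟨v • comb d, AddSubgroup.zsmul_mem _ (comb_mem_closure hd) _, ?_⟩
    rw [hcd, mul_smul, ← mul_smul u, mul_comm u, hv, natCast_pow_zsmul]
  divisible := by
    intro x
    obtain ⟨x, rfl⟩ := QuotientAddGroup.mk_surjective x
    obtain ⟨c, hc, z, hx⟩ := hs.exists_comb_add_smul x
    refine ⟨(z : M ⧸ AddSubgroup.closure s), ?_⟩
    rw [hx, QuotientAddGroup.mk_add, (QuotientAddGroup.eq_zero_iff _).mpr (comb_mem_closure hc),
      zero_add, QuotientAddGroup.mk_nsmul]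

theorem closure_sdiff_singleton_zero : AddSubgroup.closure (s \ {0}) = AddSubgroup.closure s := by
  refine le_antisymm (AddSubgroup.closure_mono Set.sdiff_subset)
    ((AddSubgroup.closure_le _).mpr fun a ha => ?_)
  by_cases h0 : a = 0
  · rw [h0]
    exact zero_mem _
  · exact AddSubgroup.subset_closure ⟨ha, h0⟩

theorem IsBasic.exists_isPBasis {B : AddSubgroup M} (hB : IsBasic p B) :
    ∃ s : Set M, IsPBasis p s ∧ AddSubgroup.closure s = B := by
  obtain ⟨s, hind, hcl, -⟩ := hB.directSum
  rw [independentElems_iff_comb] at hind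
  rw [← closure_sdiff_singleton_zero] at hcl
  refine ⟨s \ {0}, ⟨fun c hc n x hx a => ?_, by simp, fun x => ?_⟩, hcl⟩
  · obtain ⟨b, hb, hbx⟩ := hB.pure ((p : ℤ) ^ n) (comb c) (hcl ▸ comb_mem_closure hc)
      ⟨x, by rw [← hx, natCast_pow_zsmul]⟩
    obtain ⟨d, hd, rfl⟩ := mem_closure_iff_exists_comb.mp (hcl ▸ hb)
    have hzero := hind (c - (p : ℤ) ^ n • d) (Finsupp.supported_mono Set.sdiff_subset
      (sub_mem hc (Submodule.smul_mem _ _ hd))) (by rw [map_sub, map_smul, hbx, sub_self]) a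
    rw [Finsupp.sub_apply, Finsupp.smul_apply, smul_eq_mul, sub_smul, sub_eq_zero] at hzero
    exact ⟨d a, hzero⟩
  · obtain ⟨y, hy⟩ := hB.divisible (x : M ⧸ B)
    obtain ⟨z, rfl⟩ := QuotientAddGroup.mk_surjective y
    rw [← QuotientAddGroup.mk_nsmul, eq_comm, ← sub_eq_zero, ← QuotientAddGroup.mk_sub,
      QuotientAddGroup.eq_zero_iff, ← hcl] at hy
    obtain ⟨c, hc, hcx⟩ := mem_closure_iff_exists_comb.mp hy
    exact ⟨c, hc, z, by rw [hcx, sub_add_cancel]⟩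

theorem exists_isBasic (hp : p.Prime) (hM : IsAbelianPGroup p M) :
    ∃ B : AddSubgroup M, IsBasic p B :=
  let ⟨_, hs⟩ := exists_isPBasis hp hM
  ⟨_, hs.isBasic hp hM⟩

theorem IsBasic.rank_map (hp : p.Prime) (hM : IsAbelianPGroup p M) {B : AddSubgroup M}
    (hB : IsBasic p B) (h : ℵ₀ ≤ layerCard p n M) :
    rank (B.map (nsmulAddMonoidHom (p ^ n))) = layerCard p n M := by
  obtain ⟨s, hs, rfl⟩ := hB.exists_isPBasis
  exact hs.rank_map_closure hp hM h

theorem hasBasicRank_layerCard (hp : p.Prime) (hM : IsAbelianPGroup p M)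
    (h : ℵ₀ ≤ layerCard p 0 M) : HasBasicRank p M (layerCard p 0 M) := by
  refine ⟨exists_isBasic hp hM, fun B hB => ?_⟩
  have hmap : B.map (nsmulAddMonoidHom (p ^ 0)) = B := by ext; simp [AddSubgroup.mem_map]
  rw [← hB.rank_map hp hM h, hmap]

theorem hasFinalRank_iInf_layerCard (hp : p.Prime) (hM : IsAbelianPGroup p M)
    (h : ∀ n, ℵ₀ ≤ layerCard p n M) : HasFinalRank p M (⨅ n, layerCard p n M) :=
  ⟨exists_isBasic hp hM, fun _ hB => iInf_congr fun n => hB.rank_map hp hM (h n)⟩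

theorem HasBasicRank.unique {κ' : Cardinal.{u}} (h : HasBasicRank p M κ)
    (h' : HasBasicRank p M κ') : κ = κ' := by
  obtain ⟨B, hB⟩ := h.1
  rw [← h.2 B hB, h'.2 B hB]

theorem HasFinalRank.unique {κ' : Cardinal.{u}} (h : HasFinalRank p M κ)
    (h' : HasFinalRank p M κ') : κ = κ' := by
  obtain ⟨B, hB⟩ := h.1
  rw [← h.2 B hB, h'.2 B hB]

theorem IsAbelianPGroup.exists_forall_pow_smul_eq_zero_of_finite (hM : IsAbelianPGroup p M)
    (hs : s.Finite) : ∃ N : ℕ, ∀ a ∈ s, p ^ N • a = 0 := by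
  choose f hf using hM
  exact ⟨hs.toFinset.sup f, fun a ha =>
    pow_smul_eq_zero_of_le (Finset.le_sup (hs.mem_toFinset.mpr ha)) (hf a)⟩

theorem IsPBasis.layerKer_eq_top (hs : IsPBasis p s) (h : ∀ a ∈ s, p ^ n • a = 0) :
    layerKer p n M = ⊤ := by
  refine eq_top_iff.mpr fun x _ => ?_
  obtain ⟨c, hc, z, rfl⟩ := hs.exists_comb_add_smul x
  have hclosure : AddSubgroup.closure s ≤ (nsmulAddMonoidHom (p ^ n) : M →+ M).ker :=
    (AddSubgroup.closure_le _).mpr h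
  have hcomb : p ^ n • comb c = 0 := hclosure (comb_mem_closure hc)
  exact mem_layerKer.mpr ⟨z, by rw [smul_add, hcomb, zero_add, pow_succ, mul_smul]⟩

theorem aleph0_le_layerCard (hp : p.Prime) (hM : IsAbelianPGroup p M) (hR : IsReducedGroup M)
    (hU : IsUnboundedGroup M) (n : ℕ) : ℵ₀ ≤ layerCard p n M := by
  obtain ⟨s, hs⟩ := exists_isPBasis hp hM
  by_contra! hlt
  have hfin : (highPart p n s).Finite :=
    lt_aleph0_iff_set_finite.mp ((hs.pureIndep.mk_highPart_le_layerCard hp hM).trans_lt hlt)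
  obtain ⟨N, hN⟩ := hM.exists_forall_pow_smul_eq_zero_of_finite hfin
  have hbounded : ∀ a ∈ s, p ^ max n N • a = 0 := fun a ha => by
    by_cases h0 : p ^ n • a = 0
    · exact pow_smul_eq_zero_of_le (le_max_left n N) h0
    · exact pow_smul_eq_zero_of_le (le_max_right n N) (hN a ⟨ha, h0⟩)
  exact hR.layerKer_ne_top hp hM (hU _ (pow_pos hp.pos _).ne') (hs.layerKer_eq_top hbounded)

end Ranks

section Projections

open Finsupp (supported)

variable {p n : ℕ} {A : Type u} [AddCommGroup A]

/-- An idempotent endomorphism, i.e. the projection onto a direct summand of `A`. -/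
def IsProjection (e : A →+ A) : Prop := ∀ a, e (e a) = e a

/-- The order `w e = e w = e` on projections: the range of `e` is contained in the range of `w`
and the kernel of `w` is contained in the kernel of `e`. -/
def IsSubprojection (e w : A →+ A) : Prop := (∀ a, w (e a) = e a) ∧ ∀ a, e (w a) = e a

/-- The relation `e e' = e' e = 0` on projections: the range of each is contained in the kernel of
the other. -/
def IsOrthogonal (e e' : A →+ A) : Prop := (∀ a, e (e' a) = 0) ∧ ∀ a, e' (e a) = 0

/-- `e` is a projection onto the cyclic group of order `p ^ (k + 1)` generated by `a`. -/
structure IsCyclicProjection (p : ℕ) (e : A →+ A) (a : A) (k : ℕ) : Prop where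
  apply_self : e a = a
  pow_smul_ne_zero : p ^ k • a ≠ 0
  pow_succ_smul : p ^ (k + 1) • a = 0
  exists_eq_zsmul : ∀ x, ∃ c : ℤ, e x = c • a

/-- Every element of order `p` in the range of the projection `w` is divisible by `p ^ m`, i.e. the
cyclic direct summands of this range have order greater than `p ^ m`. -/
def SocleDivisible (p : ℕ) (w : A →+ A) (m : ℕ) : Prop :=
  ∀ a, w a = a → p • a = 0 → ∃ b, p ^ m • b = a

/-- The extension of an endomorphism of the range of the projection `w` by zero on the kernel. -/
def extendRange (w : A →+ A) (e : w.range →+ w.range) : A →+ A :=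
  w.range.subtype.comp (e.comp w.rangeRestrict)

variable {e w : A →+ A} {a : A} {k m : ℕ}

theorem IsProjection.compl (he : IsProjection e) : IsProjection (AddMonoidHom.id A - e) :=
  fun a => by simp [he a]

theorem IsProjection.mem_range (he : IsProjection e) : a ∈ e.range ↔ e a = a :=
  ⟨by rintro ⟨x, rfl⟩; exact he x, fun h => ⟨a, h⟩⟩

theorem IsProjection.rangeRestrict_coe (hw : IsProjection w) (x : w.range) :
    w.rangeRestrict (x : A) = x :=
  Subtype.ext (hw.mem_range.mp x.2)

theorem IsProjection.extendRange_coe (hw : IsProjection w) (e : w.range →+ w.range) (x : w.range) :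
    extendRange w e x = e x := by
  simp [extendRange, hw.rangeRestrict_coe]

theorem IsProjection.isSubprojection_extendRange (hw : IsProjection w) (e : w.range →+ w.range) :
    IsSubprojection (extendRange w e) w := by
  refine ⟨fun x => hw.mem_range.mp (e (w.rangeRestrict x)).2, fun x => ?_⟩
  have hww : w.rangeRestrict (w x) = w.rangeRestrict x := Subtype.ext (hw x)
  simp [extendRange, hww]

theorem IsSubprojection.isProjection_sub (h : IsSubprojection e w) (he : IsProjection e)
    (hw : IsProjection w) : IsProjection (w - e) :=
  fun a => by simp [hw a, h.1 a, h.2 a, he a]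

theorem IsSubprojection.sub (h : IsSubprojection e w) (hw : IsProjection w) :
    IsSubprojection (w - e) w :=
  ⟨fun a => by simp [hw a, h.1 a], fun a => by simp [hw a, h.2 a]⟩

theorem IsSubprojection.trans {v : A →+ A} (h : IsSubprojection e w) (h' : IsSubprojection w v) :
    IsSubprojection e v :=
  ⟨fun a => by rw [← h.1, h'.1], fun a => by rw [← h.2 (v a), h'.2, h.2]⟩

theorem IsOrthogonal.symm {e' : A →+ A} (h : IsOrthogonal e e') : IsOrthogonal e' e :=
  ⟨h.2, h.1⟩

theorem IsOrthogonal.mono {e' w' : A →+ A} (h : IsOrthogonal w w') (he : IsSubprojection e w)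
    (he' : IsSubprojection e' w') : IsOrthogonal e e' :=
  ⟨fun a => by rw [← he'.1, ← he.2, h.1, map_zero], fun a => by rw [← he.1, ← he'.2, h.2, map_zero]⟩

theorem IsSubprojection.isOrthogonal_sub (h : IsSubprojection e w) (he : IsProjection e) :
    IsOrthogonal e (w - e) :=
  ⟨fun a => by simp [h.2 a, he a], fun a => by simp [h.1 a, he a]⟩

theorem isSubprojection_compl_iff :
    IsSubprojection e (AddMonoidHom.id A - w) ↔ IsOrthogonal e w := by
  simp [IsSubprojection, IsOrthogonal, and_comm]

theorem mk_zmultiples (hp : p.Prime) (hne : p ^ k • a ≠ 0) (h0 : p ^ (k + 1) • a = 0) :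
    #(AddSubgroup.zmultiples a) = ((p ^ (k + 1) : ℕ) : Cardinal) := by
  have := Fact.mk hp
  have hord : addOrderOf a = p ^ (k + 1) := addOrderOf_eq_prime_pow hne h0
  have hfin : Finite (AddSubgroup.zmultiples a) := Nat.finite_of_card_ne_zero (by
    rw [Nat.card_zmultiples, hord]
    exact (pow_pos hp.pos _).ne')
  rw [← Nat.cast_card, Nat.card_zmultiples, hord]

theorem natCast_pow_succ_le_iff (hp : p.Prime) {l : ℕ} :
    ((p ^ (k + 1) : ℕ) : Cardinal.{u}) ≤ ((p ^ (l + 1) : ℕ) : Cardinal.{u}) ↔ k ≤ l := by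
  rw [Nat.cast_le, Nat.pow_le_pow_iff_right hp.one_lt]
  omega

theorem zsmul_eq_zsmul_of_pow_smul_eq_zero (hp : p.Prime) (hne : p ^ k • a ≠ 0)
    (h0 : p ^ (k + 1) • a = 0) {y : A} (hy : p ^ (k + 1) • y = 0) {c d : ℤ} (h : c • a = d • a) :
    c • y = d • y := by
  obtain ⟨t, ht⟩ := pow_dvd_of_zsmul_eq_zero hp hne h0 (c := c - d) (by rw [sub_smul, h, sub_self])
  rw [← sub_eq_zero, ← sub_smul, ht, mul_comm, mul_smul, natCast_pow_zsmul, hy, smul_zero]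

namespace IsCyclicProjection

theorem isProjection (h : IsCyclicProjection p e a k) : IsProjection e := fun x => by
  obtain ⟨c, hc⟩ := h.exists_eq_zsmul x
  rw [hc, map_zsmul, h.apply_self]

theorem ne_zero (h : IsCyclicProjection p e a k) : a ≠ 0 :=
  fun h0 => h.pow_smul_ne_zero (by rw [h0, smul_zero])

theorem range_eq (h : IsCyclicProjection p e a k) : e.range = AddSubgroup.zmultiples a := by
  ext x
  constructor
  · rintro ⟨y, rfl⟩
    obtain ⟨c, hc⟩ := h.exists_eq_zsmul y
    exact ⟨c, hc.symm⟩
  · rintro ⟨c, rfl⟩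
    exact ⟨c • a, by simp [h.apply_self]⟩

theorem mk_range (hp : p.Prime) (h : IsCyclicProjection p e a k) :
    #e.range = ((p ^ (k + 1) : ℕ) : Cardinal) := by
  rw [h.range_eq, mk_zmultiples hp h.pow_smul_ne_zero h.pow_succ_smul]

theorem comp (h : IsCyclicProjection p e a k) (ha : w a = a) :
    IsCyclicProjection p (e.comp w) a k :=
  ⟨by simp [ha, h.apply_self], h.pow_smul_ne_zero, h.pow_succ_smul,
    fun x => h.exists_eq_zsmul (w x)⟩

theorem isSubprojection_comp (h : IsCyclicProjection p e a k) (hw : IsProjection w)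
    (ha : w a = a) : IsSubprojection (e.comp w) w := by
  refine ⟨fun x => ?_, fun x => by simp [hw x]⟩
  obtain ⟨c, hc⟩ := h.exists_eq_zsmul (w x)
  simp [hc, ha]

theorem le_of_socleDivisible (h : IsCyclicProjection p e a k) (hew : IsSubprojection e w)
    (hm : SocleDivisible p w m) : m ≤ k := by
  by_contra hlt
  obtain ⟨b, hb⟩ := hm (p ^ k • a) (by rw [map_nsmul, ← h.apply_self, hew.1])
    (by rw [← mul_smul, ← pow_succ', h.pow_succ_smul])
  obtain ⟨c, hc⟩ := h.exists_eq_zsmul b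
  apply h.pow_smul_ne_zero
  calc p ^ k • a = e (p ^ m • b) := by rw [hb, map_nsmul, h.apply_self]
    _ = c • p ^ m • a := by rw [map_nsmul, hc, smul_comm]
    _ = 0 := by rw [pow_smul_eq_zero_of_le (by omega) h.pow_succ_smul, smul_zero]

theorem lt_of_forall_pow_smul_eq_zero (h : IsCyclicProjection p e a k) (hew : IsSubprojection e w)
    (hm : ∀ x, p ^ m • w x = 0) : k < m := by
  by_contra hle
  refine h.pow_smul_ne_zero (pow_smul_eq_zero_of_le (not_lt.mp hle) ?_)
  rw [← h.apply_self, ← hew.1, hm]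

theorem socleDivisible (hp : p.Prime) (h : IsCyclicProjection p e a k) : SocleDivisible p e k := by
  intro x hx hpx
  obtain ⟨c, hc⟩ := h.exists_eq_zsmul x
  rw [hx] at hc
  rw [hc, ← natCast_zsmul, ← mul_smul] at hpx
  obtain ⟨t, ht⟩ := pow_dvd_of_zsmul_eq_zero hp h.pow_smul_ne_zero h.pow_succ_smul hpx
  have hct : c = (p : ℤ) ^ k * t :=
    mul_left_cancel₀ (Nat.cast_ne_zero.mpr hp.ne_zero) (by rw [ht]; ring)
  exact ⟨t • a, by rw [hc, hct, mul_smul, natCast_pow_zsmul]⟩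

theorem exists_hom (hp : p.Prime) (h : IsCyclicProjection p e a k) {y : A}
    (hy : p ^ (k + 1) • y = 0) :
    ∃ f : A →+ A, f a = y ∧ (∀ x, f (e x) = f x) ∧ ∀ x, ∃ c : ℤ, f x = c • y := by
  choose c hc using h.exists_eq_zsmul
  have hwd {m n : ℤ} : m • a = n • a → m • y = n • y :=
    zsmul_eq_zsmul_of_pow_smul_eq_zero hp h.pow_smul_ne_zero h.pow_succ_smul hy
  refine ⟨AddMonoidHom.mk' (fun x => c x • y) fun x x' => ?_, ?_, fun x => ?_, fun x => ⟨c x, rfl⟩⟩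
  · rw [← add_smul]
    exact hwd (by rw [add_smul, ← hc, ← hc, ← hc, map_add])
  · rw [AddMonoidHom.mk'_apply, ← one_smul ℤ y, smul_smul, mul_one]
    exact hwd (by rw [← hc, h.apply_self, one_smul])
  · exact hwd (by rw [← hc, ← hc, h.isProjection])

theorem isSubprojection_or_isOrthogonal (hp : p.Prime) (h : IsCyclicProjection p e a k)
    {x : A →+ A} (hx : IsProjection x) (hcomm : ∀ b, x (e b) = e (x b)) :
    IsSubprojection e x ∨ IsOrthogonal e x := by
  obtain ⟨c, hc⟩ := h.exists_eq_zsmul (x a)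
  rw [← hcomm, h.apply_self] at hc
  have hzero (t : ℤ) : (p : ℤ) ^ (k + 1) ∣ t → t • a = 0 := by
    rintro ⟨r, rfl⟩
    rw [mul_comm, mul_smul, natCast_pow_zsmul, h.pow_succ_smul, smul_zero]
  have hdvd : (p : ℤ) ^ (k + 1) ∣ c * (c - 1) := by
    refine pow_dvd_of_zsmul_eq_zero hp h.pow_smul_ne_zero h.pow_succ_smul ?_
    have hxx := hx a
    rw [hc, map_zsmul, hc, ← mul_smul] at hxx
    rw [mul_sub, sub_smul, hxx, mul_one, sub_self]
  have hprime := Nat.prime_iff_prime_int.mp hp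
  by_cases hpc : (p : ℤ) ∣ c
  · right
    have hcop : ¬ (p : ℤ) ∣ c - 1 := fun h' =>
      hprime.not_isUnit (isUnit_of_dvd_one (by simpa using dvd_sub hpc h'))
    have hxe (b : A) : x (e b) = 0 := by
      obtain ⟨t, ht⟩ := h.exists_eq_zsmul b
      rw [ht, map_zsmul, hc, hzero c (hprime.pow_dvd_of_dvd_mul_right _ hcop hdvd), smul_zero]
    exact ⟨fun b => by rw [← hcomm, hxe], hxe⟩
  · left
    have hxa : x a = a := by
      rw [hc, ← sub_eq_zero, ← one_smul ℤ a, smul_smul, mul_one, ← sub_smul]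
      exact hzero _ (hprime.pow_dvd_of_dvd_mul_left _ hpc hdvd)
    have hxe (b : A) : x (e b) = e b := by
      obtain ⟨t, ht⟩ := h.exists_eq_zsmul b
      rw [ht, map_zsmul, hxa]
    exact ⟨hxe, fun b => by rw [← hcomm, hxe]⟩

end IsCyclicProjection

theorem IsPBasis.exists_isCyclicProjection {s : Set A} (hs : IsPBasis p s) (ha : a ∈ s)
    (hne : p ^ k • a ≠ 0) (h0 : p ^ (k + 1) • a = 0) :
    ∃ e : A →+ A, IsCyclicProjection p e a k ∧ ∀ b ∈ s, b ≠ a → e b = 0 := by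
  classical
  obtain ⟨h, hh⟩ := hs.exists_hom_apply_eq (D := AddSubgroup.zmultiples a) (k := k + 1)
    (by rintro ⟨_, c, rfl⟩; exact Subtype.ext (by simp [smul_comm _ c, h0]))
    (fun b => if b = a then ⟨a, AddSubgroup.mem_zmultiples a⟩ else 0)
    (fun b _ c hc => by
      split_ifs with hb
      · exact Subtype.ext (by simpa [hb] using hc)
      · simp)
  refine ⟨(AddSubgroup.subtype _).comp h, ⟨by simp [hh a ha], hne, h0, fun x => ?_⟩,
    fun b hb hba => by simp [hh b hb, hba]⟩
  obtain ⟨c, hc⟩ := (h x).2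
  exact ⟨c, hc.symm⟩

theorem IsPureGenerator.exists_isCyclicProjection (hp : p.Prime) (hA : IsAbelianPGroup p A)
    (ha : IsPureGenerator p a k) (hw : IsProjection w) (hwa : w a = a) :
    ∃ e : A →+ A, IsCyclicProjection p e a k ∧ IsSubprojection e w := by
  have ha0 : a ≠ 0 := fun h => ha.pow_smul_ne_zero (by rw [h, smul_zero])
  obtain ⟨s, has, hs⟩ := (ha.pureIndep hp hA).exists_isPBasis hp hA ha0.symm
  obtain ⟨e, he, -⟩ := hs.exists_isCyclicProjection (has rfl) ha.pow_smul_ne_zero ha.pow_succ_smul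
  exact ⟨_, he.comp hwa, he.isSubprojection_comp hw hwa⟩

theorem IsReducedGroup.addSubgroup (hR : IsReducedGroup A) (H : AddSubgroup A) :
    IsReducedGroup H := by
  intro D hD
  refine (AddSubgroup.map_eq_bot_iff_of_injective D H.subtype_injective).mp (hR _ ?_)
  rintro n hn _ ⟨x, hx, rfl⟩
  obtain ⟨y, hy, hxy⟩ := hD n hn x hx
  exact ⟨y, ⟨y, hy, rfl⟩, by rw [← hxy]; simp⟩

theorem IsProjection.isPureGenerator_coe (hw : IsProjection w) {y : w.range}
    (hy : IsPureGenerator p y k) : IsPureGenerator p (y : A) k := by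
  refine ⟨by simpa using congrArg Subtype.val hy.pow_succ_smul, fun h => hy.notMem_layerKer ?_⟩
  obtain ⟨z, hz⟩ := mem_layerKer.mp h
  refine mem_layerKer.mpr ⟨⟨w z, z, rfl⟩, Subtype.ext ?_⟩
  simpa [hw.mem_range.mp y.2] using congrArg w hz

theorem exists_isCyclicProjection_of_pow_smul_ne_zero (hp : p.Prime) (hA : IsAbelianPGroup p A)
    (hR : IsReducedGroup A) (hw : IsProjection w) (hn : ∃ x, p ^ n • w x ≠ 0) :
    ∃ (k : ℕ) (e : A →+ A) (a : A), n ≤ k ∧ IsCyclicProjection p e a k ∧ IsSubprojection e w := by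
  obtain ⟨x, hx⟩ := hn
  have hrange := hA.addSubgroup w.range
  obtain ⟨k, y, hnk, hy⟩ := hrange.exists_isPureGenerator
    ((hR.addSubgroup w.range).layerKer_ne_top hp hrange
      ⟨⟨w x, x, rfl⟩, fun h => hx (by simpa using congrArg Subtype.val h)⟩)
  obtain ⟨e, he, hew⟩ := (hw.isPureGenerator_coe hy).exists_isCyclicProjection hp hA hw
    (hw.mem_range.mp y.2)
  exact ⟨k, e, y, hnk, he, hew⟩

theorem exists_isCyclicProjection_of_ne_zero (hp : p.Prime) (hA : IsAbelianPGroup p A)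
    (hR : IsReducedGroup A) (hw : IsProjection w) (hn : ∃ x, w x ≠ 0) :
    ∃ (k : ℕ) (e : A →+ A) (a : A), IsCyclicProjection p e a k ∧ IsSubprojection e w := by
  obtain ⟨k, e, a, -, h⟩ := exists_isCyclicProjection_of_pow_smul_ne_zero hp hA hR hw
    (n := 0) (by simpa using hn)
  exact ⟨k, e, a, h⟩

theorem exists_isCyclicProjection_of_not_socleDivisible (hp : p.Prime) (hA : IsAbelianPGroup p A)
    (hw : IsProjection w) (hm : ¬ SocleDivisible p w m) :
    ∃ (k : ℕ) (e : A →+ A) (a : A), k < m ∧ IsCyclicProjection p e a k ∧ IsSubprojection e w := by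
  simp only [SocleDivisible, not_forall] at hm
  obtain ⟨x, hwx, hpx, hx⟩ := hm
  obtain ⟨k, hkm, ⟨b, hb⟩, hheight⟩ :
      ∃ k < m, (∃ b, p ^ k • b = x) ∧ ¬ ∃ b, p ^ (k + 1) • b = x := by
    by_contra! hall
    have hdiv (k : ℕ) : k ≤ m → ∃ b, p ^ k • b = x := by
      induction k with
      | zero => exact fun _ => ⟨x, by simp⟩
      | succ k ih => exact fun hk => hall k hk (ih (by omega))
    exact hx (hdiv m le_rfl)
  have hwb : p ^ k • w b = x := by rw [← map_nsmul, hb, hwx]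
  have hgen : IsPureGenerator p (w b) k :=
    ⟨by rw [pow_succ', mul_smul, hwb, hpx], by rwa [mem_layerKer, hwb]⟩
  obtain ⟨e, he, hew⟩ := hgen.exists_isCyclicProjection hp hA hw (hw b)
  exact ⟨k, e, w b, hkm, he, hew⟩

theorem exists_isCyclicProjection_socleDivisible (hp : p.Prime) (hA : IsAbelianPGroup p A)
    (hR : IsReducedGroup A) (hw : IsProjection w) (hn : ∃ x, w x ≠ 0) :
    ∃ (k : ℕ) (e : A →+ A) (a : A),
      IsCyclicProjection p e a k ∧ IsSubprojection e w ∧ SocleDivisible p w k := by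
  classical
  have hex := exists_isCyclicProjection_of_ne_zero hp hA hR hw hn
  obtain ⟨e, a, he, hew⟩ := Nat.find_spec hex
  refine ⟨_, e, a, he, hew, ?_⟩
  by_contra hdiv
  obtain ⟨k, e', a', hk, he'⟩ := exists_isCyclicProjection_of_not_socleDivisible hp hA hw hdiv
  exact Nat.find_min hex hk ⟨e', a', he'⟩

theorem PureIndep.exists_comb_eq_pow_smul_of_smul_eq (hp : p.Prime) (hA : IsAbelianPGroup p A)
    {s : Set A} (hs : PureIndep p s) {c : A →₀ ℤ} (hc : c ∈ supported ℤ ℤ (highPart p n s)) {z : A}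
    (hz : p ^ (n + 1) • z = p • comb c) : ∃ d ∈ supported ℤ ℤ s, comb c = p ^ n • comb d := by
  have hcs := Finsupp.supported_mono (R := ℤ) (M := ℤ) highPart_subset hc
  refine exists_comb_eq_pow_smul hcs fun b => ?_
  by_cases hb : b ∈ highPart p n s
  · obtain ⟨t, ht⟩ := hs ((p : ℤ) • c) (Submodule.smul_mem _ _ hcs) (n + 1) z
      (by rw [map_smul, natCast_zsmul, hz]) b
    obtain ⟨j, hj, hj'⟩ := hA.exists_pow_smul_ne_zero hb.2
    rw [← mul_smul, ← pow_add] at hj hj'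
    obtain ⟨r, hr⟩ := pow_dvd_of_zsmul_eq_zero hp (k := j + n) hj (by rwa [add_right_comm])
      (c := (p : ℤ) * c b - (p : ℤ) ^ (n + 1) * t) (by
        rw [sub_smul, ← ht, Finsupp.smul_apply, smul_eq_mul, sub_self])
    refine ⟨t + (p : ℤ) ^ j * r, ?_⟩
    congr 1
    refine mul_left_cancel₀ (Nat.cast_ne_zero.mpr hp.ne_zero : (p : ℤ) ≠ 0) ?_
    linear_combination hr
  · exact ⟨0, by simp [(Finsupp.mem_supported' ℤ c).mp hc b hb]⟩

namespace IsPBasis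

variable {s : Set A}

theorem hom_ext (hs : IsPBasis p s) {D : Type*} [AddCommGroup D] {f g : A →+ D}
    (hf : ∀ x, p ^ n • f x = 0) (hg : ∀ x, p ^ n • g x = 0) (h : Set.EqOn f g s) : f = g := by
  ext x
  obtain ⟨c, hc, z, rfl⟩ := hs.exists_comb_add_pow_smul n x
  rw [map_add, map_add, map_nsmul, map_nsmul, hf, hg,
    AddMonoidHom.eqOn_closure h (comb_mem_closure hc)]

theorem exists_truncation (hs : IsPBasis p s) (n : ℕ) :
    ∃ h : A →+ A, (∀ x, p ^ n • h x = 0) ∧ (∀ a ∈ s, p ^ n • a = 0 → h a = a) ∧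
      ∀ a ∈ highPart p n s, h a = 0 := by
  classical
  obtain ⟨h, hh⟩ := hs.exists_hom_apply_eq (D := (nsmulAddMonoidHom (p ^ n) : A →+ A).ker) (k := n)
    (by rintro ⟨x, hx⟩; exact Subtype.ext (by simpa using hx))
    (fun b => if hb : p ^ n • b = 0 then ⟨b, hb⟩ else 0)
    (fun b _ c hc => by
      split_ifs with hb
      · exact Subtype.ext (by simpa using hc)
      · simp)
  exact ⟨(AddSubgroup.subtype _).comp h, fun x => (h x).2, fun a ha h0 => by simp [hh a ha, h0],
    fun a ha => by simp [hh a ha.1, ha.2]⟩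

end IsPBasis

theorem exists_bounded_projection (hp : p.Prime) (hA : IsAbelianPGroup p A) (n : ℕ) :
    ∃ e : A →+ A, IsProjection e ∧ (∀ x, p ^ n • e x = 0) ∧
      ∀ x, e x = 0 → p • x = 0 → ∃ z, p ^ n • z = x := by
  obtain ⟨s, hs⟩ := exists_isPBasis hp hA
  obtain ⟨h, hbdd, hlow, hhigh⟩ := hs.exists_truncation n
  have hidem : h.comp h = h := by
    refine hs.hom_ext (fun x => hbdd (h x)) hbdd fun a ha => ?_
    by_cases h0 : p ^ n • a = 0
    · simp [hlow a ha h0]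
    · simp [hhigh a ⟨ha, h0⟩]
  refine ⟨h, DFunLike.congr_fun hidem, hbdd, fun x hx hpx => ?_⟩
  obtain ⟨c, hc, z, rfl⟩ := hs.exists_comb_add_pow_smul n x
  have hsplit : s = s \ highPart p n s ∪ highPart p n s :=
    (Set.sdiff_union_of_subset highPart_subset).symm
  rw [hsplit, Finsupp.supported_union] at hc
  obtain ⟨c₁, hc₁, c₂, hc₂, rfl⟩ := Submodule.mem_sup.mp hc
  have hc₁0 : comb c₁ = 0 := by
    have heq₁ : h (comb c₁) = comb c₁ :=
      AddMonoidHom.eqOn_closure (g := AddMonoidHom.id A)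
        (fun a ha => hlow a ha.1 (by_contra fun h0 => ha.2 ⟨ha.1, h0⟩)) (comb_mem_closure hc₁)
    have heq₂ : h (comb c₂) = 0 :=
      AddMonoidHom.eqOn_closure (g := (0 : A →+ A)) hhigh (comb_mem_closure hc₂)
    rwa [map_add, map_add, map_add, map_nsmul, hbdd, heq₁, heq₂, add_zero, add_zero] at hx
  rw [map_add, hc₁0, zero_add] at hpx ⊢
  obtain ⟨d, -, hd⟩ := hs.pureIndep.exists_comb_eq_pow_smul_of_smul_eq hp hA hc₂ (z := -z) (by
    rw [smul_neg, neg_eq_iff_add_eq_zero, ← hpx, smul_add, ← mul_smul, ← pow_succ', add_comm])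
  exact ⟨comb d + z, by rw [smul_add, hd]⟩

theorem exists_bounded_decomposition (hp : p.Prime) (hA : IsAbelianPGroup p A)
    (hw : IsProjection w) (n : ℕ) :
    ∃ δ : A →+ A, IsProjection δ ∧ IsSubprojection δ w ∧ (∀ x, p ^ n • δ x = 0) ∧
      SocleDivisible p (w - δ) n := by
  obtain ⟨e, he, hbdd, hsocle⟩ := exists_bounded_projection hp (hA.addSubgroup w.range) n
  have hle := hw.isSubprojection_extendRange e
  refine ⟨extendRange w e, fun x => ?_, hle, fun x => ?_, fun x hx hpx => ?_⟩
  · simp [extendRange, hw.rangeRestrict_coe, he (w.rangeRestrict x)]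
  · simpa [extendRange] using congrArg Subtype.val (hbdd (w.rangeRestrict x))
  · replace hx : w x - extendRange w e x = x := hx
    have hwx : w x = x := by
      rw [← hx, map_sub, hw, hle.1, hx]
    rw [hwx, sub_eq_self] at hx
    obtain ⟨z, hz⟩ := hsocle (w.rangeRestrict x) (Subtype.ext hx)
      (Subtype.ext (by simp [hwx, hpx]))
    exact ⟨z, by simpa [hwx] using congrArg Subtype.val hz⟩

theorem exists_hom_ne_zero (hp : p.Prime) (hA : IsAbelianPGroup p A) (hR : IsReducedGroup A)
    {e e' : A →+ A} (he : IsProjection e) (hn : ∃ x, e x ≠ 0) (he' : IsProjection e')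
    (hn' : ∃ x, e' x ≠ 0) :
    ∃ f : A →+ A, (∀ x, e' (f x) = f x) ∧ (∀ x, f (e x) = f x) ∧ ∃ x, f x ≠ 0 := by
  obtain ⟨k, c, a, hc, hce⟩ := exists_isCyclicProjection_of_ne_zero hp hA hR he hn
  obtain ⟨x, hx⟩ := hn'
  obtain ⟨l, hl, hl'⟩ := hA.exists_pow_smul_ne_zero hx
  obtain ⟨f, hfa, hfc, hfs⟩ := hc.exists_hom hp (y := p ^ l • e' x) (by
    rw [pow_succ, mul_smul, ← mul_smul p, ← pow_succ', hl', smul_zero])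
  refine ⟨f, fun z => ?_, fun z => ?_, a, by rwa [hfa]⟩
  · obtain ⟨t, ht⟩ := hfs z
    rw [ht, map_zsmul, map_nsmul, he']
  · rw [← hfc, hce.2, hfc]

end Projections

section Involutions

variable {p : ℕ} {A : Type u} [AddCommGroup A]

/-- The class of groups considered in the theorem: unbounded reduced Abelian `p`-groups for an odd
prime `p`. -/
structure IsAdmissible (p : ℕ) (A : Type*) [AddCommGroup A] : Prop where
  prime : p.Prime
  ne_two : p ≠ 2
  isPGroup : IsAbelianPGroup p A
  reduced : IsReducedGroup A
  unbounded : IsUnboundedGroup A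

/-- The involution `ξ` is `1 - 2 e` or `2 e - 1` for the projection `e`, i.e. the range and the
kernel of `e` are the two summands `A_ξ⁺` and `A_ξ⁻`, in some order. -/
def IsReflection (ξ : A ≃+ A) (e : A →+ A) : Prop :=
  IsProjection e ∧ ((∀ a, ξ a = a - 2 • e a) ∨ ∀ a, ξ a = 2 • e a - a)

/-- The involution `1 - 2 e` of a projection `e`. -/
def reflection (e : A →+ A) (he : IsProjection e) : A ≃+ A where
  toFun a := a - 2 • e a
  invFun a := a - 2 • e a
  left_inv a := by simp only [map_sub, map_nsmul, he a]; abel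
  right_inv a := by simp only [map_sub, map_nsmul, he a]; abel
  map_add' a b := by simp only [map_add, smul_add]; abel

/-- The automorphism `1 + h` for an endomorphism `h` with `h ^ 2 = 0`. -/
def unipotent (h : A →+ A) (hh : ∀ a, h (h a) = 0) : A ≃+ A where
  toFun a := a + h a
  invFun a := a - h a
  left_inv a := by simp [hh a]
  right_inv a := by simp [hh a]
  map_add' a b := by simp only [map_add]; abel

/-- The conjugate `f e f⁻¹` of an endomorphism `e` by an automorphism `f`; the conjugate of an
automorphism is `conj`. -/
def conjHom (f : A ≃+ A) (e : A →+ A) : A →+ A :=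
  f.toAddMonoidHom.comp (e.comp f.symm.toAddMonoidHom)

variable {ξ : A ≃+ A} {e w : A →+ A} {a : A} {k : ℕ}

theorem isReflection_reflection (he : IsProjection e) : IsReflection (reflection e he) e :=
  ⟨he, Or.inl fun _ => rfl⟩

theorem unipotent_apply (h : A →+ A) (hh : ∀ a, h (h a) = 0) (a : A) :
    unipotent h hh a = a + h a := rfl

theorem unipotent_symm_apply (h : A →+ A) (hh : ∀ a, h (h a) = 0) (a : A) :
    (unipotent h hh).symm a = a - h a := rfl

@[simp] theorem conjHom_apply (f : A ≃+ A) (e : A →+ A) (x : A) :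
    conjHom f e x = f (e (f.symm x)) := rfl

theorem conj_apply (f ε : A ≃+ A) (x : A) : conj f ε x = f (ε (f.symm x)) := rfl

theorem Commutes.symm {f g : A ≃+ A} (h : Commutes f g) : Commutes g f := fun a => (h a).symm

theorem IsAdmissible.bijective_two_nsmul (hA : IsAdmissible p A) :
    Function.Bijective fun x : A => 2 • x := by
  have hndvd : ¬ (p : ℤ) ∣ (2 : ℕ) := fun h => hA.ne_two
    ((Nat.prime_dvd_prime_iff_eq hA.prime Nat.prime_two).mp (Int.natCast_dvd_natCast.mp h))
  refine ⟨(injective_iff_map_eq_zero (nsmulAddMonoidHom 2 : A →+ A)).mpr fun x hx => ?_,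
    fun a => ?_⟩
  · exact hA.isPGroup.eq_zero_of_zsmul hA.prime hndvd (by rwa [natCast_zsmul])
  · obtain ⟨v, hv⟩ := hA.isPGroup.exists_mul_zsmul_eq hA.prime hndvd a
    exact ⟨v • a, by rwa [mul_comm, mul_smul, natCast_zsmul] at hv⟩

theorem exists_eq_sub_two_nsmul_projection (h2 : Function.Bijective fun x : A => 2 • x)
    (h : ∀ a, ξ (ξ a) = a) : ∃ e : A →+ A, IsProjection e ∧ ∀ a, ξ a = a - 2 • e a := by
  let double : A ≃+ A := AddEquiv.ofBijective (nsmulAddMonoidHom 2 : A →+ A) h2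
  have htwo (a : A) : 2 • double.symm (a - ξ a) = a - ξ a := double.apply_symm_apply _
  refine ⟨double.symm.toAddMonoidHom.comp (AddMonoidHom.id A - ξ.toAddMonoidHom), fun a => ?_,
    fun a => ?_⟩
  · change double.symm (double.symm (a - ξ a) - ξ (double.symm (a - ξ a))) = double.symm (a - ξ a)
    apply h2.injective
    apply h2.injective
    change 2 • 2 • double.symm _ = 2 • 2 • double.symm _
    rw [htwo, htwo, smul_sub, ← map_nsmul ξ, htwo, map_sub, h]
    abel
  · change ξ a = a - 2 • double.symm (a - ξ a)
    rw [htwo, sub_sub_cancel]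

namespace IsReflection

theorem apply_apply (h : IsReflection ξ e) (a : A) : ξ (ξ a) = a := by
  obtain ⟨he, h | h⟩ := h
  · rw [h, h, map_sub, map_nsmul, he]; abel
  · rw [h, h, map_sub, map_nsmul, he]; abel

theorem compl (h : IsReflection ξ e) : IsReflection ξ (AddMonoidHom.id A - e) := by
  refine ⟨h.1.compl, ?_⟩
  obtain ⟨-, h | h⟩ := h
  · right; intro a; rw [h]; simp [smul_sub]; abel
  · left; intro a; rw [h]; simp [smul_sub]; abel

theorem conj (h : IsReflection ξ e) (f : A ≃+ A) :
    IsReflection (AutFinal.conj f ξ) (conjHom f e) := by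
  obtain ⟨he, h⟩ := h
  refine ⟨fun a => by simp [he (f.symm a)], h.imp (fun h a => ?_) fun h a => ?_⟩
  · rw [conj_apply, h]; simp
  · rw [conj_apply, h]; simp

theorem forall_map_eq_iff (h2 : Function.Injective fun x : A => 2 • x) (h : IsReflection ξ e)
    {g : A →+ A} : (∀ a, g (ξ a) = ξ (g a)) ↔ ∀ a, g (e a) = e (g a) := by
  refine forall_congr' fun a => ?_
  obtain ⟨-, h | h⟩ := h
  · rw [h, h, map_sub, map_nsmul, sub_right_inj]
    exact h2.eq_iff
  · rw [h, h, map_sub, map_nsmul, sub_left_inj]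
    exact h2.eq_iff

theorem commutes_iff (h2 : Function.Injective fun x : A => 2 • x) (h : IsReflection ξ e)
    {g : A ≃+ A} : Commutes g ξ ↔ ∀ a, g (e a) = e (g a) :=
  h.forall_map_eq_iff h2 (g := g.toAddMonoidHom)

theorem commutes_iff_comm (h2 : Function.Injective fun x : A => 2 • x) {η : A ≃+ A} {f : A →+ A}
    (h : IsReflection ξ e) (h' : IsReflection η f) :
    Commutes ξ η ↔ ∀ a, e (f a) = f (e a) := by
  rw [h'.commutes_iff h2, ← forall_congr' fun a => eq_comm (a := f (e a)),
    ← h.forall_map_eq_iff h2, forall_congr' fun a => eq_comm (a := ξ (f a))]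

end IsReflection

theorem IsProjection.range_compl (he : IsProjection e) :
    (AddMonoidHom.id A - e).range = e.ker := by
  ext x
  rw [he.compl.mem_range]
  change x - e x = x ↔ e x = 0
  exact sub_eq_self

theorem IsProjection.ker_compl (he : IsProjection e) :
    (AddMonoidHom.id A - e).ker = e.range := by
  ext x
  rw [he.mem_range, AddMonoidHom.mem_ker, AddMonoidHom.sub_apply, sub_eq_zero]
  exact eq_comm

theorem plusPart_eq_ker (h2 : Function.Injective fun x : A => 2 • x)
    (h : ∀ a, ξ a = a - 2 • e a) : plusPart ξ = e.ker := by
  ext x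
  change ξ x = x ↔ e x = 0
  rw [h, sub_eq_self]
  exact h2.eq_iff' (smul_zero 2)

theorem minusPart_eq_range (h2 : Function.Injective fun x : A => 2 • x) (he : IsProjection e)
    (h : ∀ a, ξ a = a - 2 • e a) : minusPart ξ = e.range := by
  ext x
  rw [he.mem_range, ← h2.eq_iff]
  change ξ x = -x ↔ 2 • e x = 2 • x
  rw [h, sub_eq_iff_eq_add, eq_neg_add_iff_add_eq, ← two_nsmul, eq_comm]

theorem IsReflection.plusPart_minusPart_eq (h2 : Function.Injective fun x : A => 2 • x)
    (h : IsReflection ξ e) : plusPart ξ = e.ker ∧ minusPart ξ = e.range ∨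
      plusPart ξ = e.range ∧ minusPart ξ = e.ker := by
  obtain ⟨he, hξ | hξ⟩ := h
  · exact Or.inl ⟨plusPart_eq_ker h2 hξ, minusPart_eq_range h2 he hξ⟩
  · have hξ' (a : A) : ξ a = a - 2 • (AddMonoidHom.id A - e) a := by
      rw [hξ]; simp [smul_sub]; abel
    right
    rw [← he.range_compl, ← he.ker_compl]
    exact ⟨plusPart_eq_ker h2 hξ', minusPart_eq_range h2 he.compl hξ'⟩

namespace IsCyclicProjection

theorem conj (h : IsCyclicProjection p e a k) (f : A ≃+ A) :
    IsCyclicProjection p (conjHom f e) (f a) k where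
  apply_self := by simp [h.apply_self]
  pow_smul_ne_zero := by
    rw [← map_nsmul]
    exact fun h0 => h.pow_smul_ne_zero ((map_eq_zero_iff f f.injective).mp h0)
  pow_succ_smul := by rw [← map_nsmul, h.pow_succ_smul, map_zero]
  exists_eq_zsmul x := by
    obtain ⟨c, hc⟩ := h.exists_eq_zsmul (f.symm x)
    exact ⟨c, by simp [hc]⟩

theorem pow_succ_smul_apply (h : IsCyclicProjection p e a k) (x : A) : p ^ (k + 1) • e x = 0 := by
  obtain ⟨c, hc⟩ := h.exists_eq_zsmul x
  rw [hc, smul_comm, h.pow_succ_smul, smul_zero]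

theorem pow_smul_mem_of_ne_bot (hp : p.Prime) (hA : IsAbelianPGroup p A)
    (h : IsCyclicProjection p e a k) {X : AddSubgroup A} (hX : X ≤ e.range) (hne : X ≠ ⊥) :
    p ^ k • a ∈ X := by
  obtain ⟨⟨x, hx⟩, hx0⟩ := AddSubgroup.ne_bot_iff_exists_ne_zero.mp hne
  replace hx0 : x ≠ 0 := fun h0 => hx0 (Subtype.ext h0)
  obtain ⟨c, rfl⟩ : ∃ c : ℤ, c • a = x := h.range_eq.le (hX hx)
  obtain ⟨i, u, rfl, hu⟩ :=
    exists_eq_pow_mul_not_dvd hp (fun hc0 : c = 0 => hx0 (by rw [hc0, zero_smul]))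
  have hik : i ≤ k := by
    by_contra hlt
    apply hx0
    rw [mul_comm, mul_smul, natCast_pow_zsmul,
      pow_smul_eq_zero_of_le (by omega) h.pow_succ_smul, smul_zero]
  obtain ⟨l, rfl⟩ := Nat.exists_eq_add_of_le hik
  obtain ⟨v, hv⟩ := hA.exists_mul_zsmul_eq hp hu (p ^ (i + l) • a)
  have hmul : p ^ (i + l) • a = (v * (p : ℤ) ^ l) • ((p : ℤ) ^ i * u) • a := by
    rw [← hv, ← natCast_pow_zsmul, ← mul_smul, ← mul_smul]
    congr 1
    ring
  rw [hmul]
  exact X.zsmul_mem hx _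

theorem indecomposable (hp : p.Prime) (hA : IsAbelianPGroup p A)
    (h : IsCyclicProjection p e a k) : Indecomposable e.range := by
  refine ⟨fun h0 => h.ne_zero ?_, fun X Y hXY hsup => ?_⟩
  · rwa [h.range_eq, AddSubgroup.zmultiples_eq_bot] at h0
  · by_contra! hne
    have hmem : p ^ k • a ∈ X ⊓ Y :=
      ⟨h.pow_smul_mem_of_ne_bot hp hA (hsup ▸ le_sup_left) hne.1,
        h.pow_smul_mem_of_ne_bot hp hA (hsup ▸ le_sup_right) hne.2⟩
    rw [hXY, AddSubgroup.mem_bot] at hmem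
    exact h.pow_smul_ne_zero hmem

end IsCyclicProjection

namespace IsSubprojection

theorem range_le (h : IsSubprojection e w) : e.range ≤ w.range := by
  rintro _ ⟨x, rfl⟩
  exact ⟨e x, h.1 x⟩

theorem range_inf_range_sub (h : IsSubprojection e w) (he : IsProjection e) :
    e.range ⊓ (w - e).range = ⊥ := by
  rw [eq_bot_iff]
  rintro x ⟨hx, y, hy⟩
  rw [AddSubgroup.mem_bot, ← he.mem_range.mp hx, ← hy, AddMonoidHom.sub_apply, map_sub, h.2, he,
    sub_self]

theorem range_sup_range_sub (h : IsSubprojection e w) (hw : IsProjection w) :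
    e.range ⊔ (w - e).range = w.range := by
  refine le_antisymm (sup_le h.range_le (h.sub hw).range_le) ?_
  rintro _ ⟨x, rfl⟩
  exact AddSubgroup.mem_sup.mpr ⟨e x, ⟨x, rfl⟩, (w - e) x, ⟨x, rfl⟩, by simp⟩

end IsSubprojection

theorem exists_isCyclicProjection_of_indecomposable (hp : p.Prime) (hA : IsAbelianPGroup p A)
    (hR : IsReducedGroup A) (he : IsProjection e) (h : Indecomposable e.range) :
    ∃ (a : A) (k : ℕ), IsCyclicProjection p e a k := by
  have hne : ∃ x, e x ≠ 0 := by
    by_contra! hzero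
    refine h.1 (eq_bot_iff.mpr ?_)
    rintro _ ⟨x, rfl⟩
    exact hzero x
  obtain ⟨k, c, a, hc, hce⟩ := exists_isCyclicProjection_of_ne_zero hp hA hR he hne
  rcases h.2 _ _ (hce.range_inf_range_sub hc.isProjection) (hce.range_sup_range_sub he)
    with h0 | h0
  · exact absurd (AddSubgroup.mem_bot.mp (h0 ▸ ⟨a, hc.apply_self⟩)) hc.ne_zero
  · have hec : e = c := sub_eq_zero.mp (AddMonoidHom.range_eq_bot_iff.mp h0)
    exact ⟨a, k, hec ▸ hc⟩

namespace IsAdmissible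

theorem exists_pow_smul_compl_ne_zero (hA : IsAdmissible p A) {n : ℕ}
    (h : ∀ x, p ^ n • e x = 0) (m : ℕ) : ∃ x, p ^ m • (AddMonoidHom.id A - e) x ≠ 0 := by
  by_contra! hzero
  obtain ⟨a, ha⟩ := hA.unbounded (p ^ (m + n)) (pow_pos hA.prime.pos _).ne'
  have hae : p ^ m • a = p ^ m • e a := by
    simpa [smul_sub, sub_eq_zero] using hzero a
  exact ha (by rw [pow_add, mul_comm, mul_smul, hae, smul_comm, h, smul_zero])

theorem extreme (hA : IsAdmissible p A) (h : IsCyclicProjection p e a k)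
    (hξ : IsReflection ξ e) : Extreme ξ := by
  have h2 := hA.bijective_two_nsmul.injective
  have hindec := h.indecomposable hA.prime hA.isPGroup
  have hparts := hξ.plusPart_minusPart_eq h2
  refine ⟨hξ.apply_apply, fun hrefl => ?_, ?_⟩
  · have hplus : plusPart ξ = ⊤ := by
      rw [hrefl]
      exact eq_top_iff.mpr fun _ _ => rfl
    rw [hplus] at hparts
    rcases hparts with ⟨hker, -⟩ | ⟨hrange, -⟩
    · exact hindec.1 (by rw [AddMonoidHom.range_eq_bot_iff, ← AddMonoidHom.ker_eq_top_iff, hker])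
    · obtain ⟨x, hx⟩ := hA.exists_pow_smul_compl_ne_zero h.pow_succ_smul_apply 0
      have hex : e x = x := hξ.1.mem_range.mp (hrange ▸ trivial)
      exact hx (by simp [hex])
  · rcases hparts with ⟨-, hrange⟩ | ⟨hrange, -⟩
    · exact Or.inr (hrange ▸ hindec)
    · exact Or.inl (hrange ▸ hindec)

theorem exists_isCyclicProjection_of_extreme (hA : IsAdmissible p A) (h : Extreme ξ) :
    ∃ (e : A →+ A) (a : A) (k : ℕ), IsCyclicProjection p e a k ∧ IsReflection ξ e := by
  have h2 := hA.bijective_two_nsmul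
  obtain ⟨e, he, hξ⟩ := exists_eq_sub_two_nsmul_projection h2 h.1
  rcases h.2.2 with h | h
  · rw [plusPart_eq_ker h2.injective hξ, ← he.range_compl] at h
    obtain ⟨a, k, hc⟩ := exists_isCyclicProjection_of_indecomposable hA.prime hA.isPGroup
      hA.reduced he.compl h
    exact ⟨_, a, k, hc, IsReflection.compl ⟨he, Or.inl hξ⟩⟩
  · rw [minusPart_eq_range h2.injective he hξ] at h
    obtain ⟨a, k, hc⟩ := exists_isCyclicProjection_of_indecomposable hA.prime hA.isPGroup
      hA.reduced he h
    exact ⟨_, a, k, hc, he, Or.inl hξ⟩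

theorem not_indecomposable_ker (hA : IsAdmissible p A) (h : IsCyclicProjection p e a k) :
    ¬ Indecomposable e.ker := by
  intro hker
  rw [← h.isProjection.range_compl] at hker
  obtain ⟨b, l, hc⟩ := exists_isCyclicProjection_of_indecomposable hA.prime hA.isPGroup hA.reduced
    h.isProjection.compl hker
  obtain ⟨x, hx⟩ := hA.exists_pow_smul_compl_ne_zero h.pow_succ_smul_apply (l + 1)
  exact hx (hc.pow_succ_smul_apply x)

theorem core_perp_eq (hA : IsAdmissible p A) (h : IsCyclicProjection p e a k)
    (hξ : IsReflection ξ e) : core ξ = e.range ∧ perp ξ = e.ker := by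
  rcases hξ.plusPart_minusPart_eq hA.bijective_two_nsmul.injective with ⟨hp, hm⟩ | ⟨hp, hm⟩
  · have hindec := h.indecomposable hA.prime hA.isPGroup
    rw [core, perp, hp, hm, if_pos hindec, if_pos hindec]
    exact ⟨rfl, rfl⟩
  · have hdec := hA.not_indecomposable_ker h
    rw [core, perp, hp, hm, if_neg hdec, if_neg hdec]
    exact ⟨rfl, rfl⟩

theorem ord_eq (hA : IsAdmissible p A) (h : IsCyclicProjection p e a k)
    (hξ : IsReflection ξ e) : ord ξ = ((p ^ (k + 1) : ℕ) : Cardinal) := by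
  rw [ord, (hA.core_perp_eq h hξ).1, h.mk_range hA.prime]

theorem pairPart_pairCompl_eq (hA : IsAdmissible p A) {ε : A ≃+ A}
    (h : IsCyclicProjection p e a k) (hε : IsReflection ε e) (hξ : IsReflection ξ w)
    (hew : IsSubprojection e w) : pairPart ξ ε = w.range ∧ pairCompl ξ ε = w.ker := by
  have hcore := (hA.core_perp_eq h hε).1
  rcases hξ.plusPart_minusPart_eq hA.bijective_two_nsmul.injective with ⟨hp, hm⟩ | ⟨hp, hm⟩
  · have hnot : ¬ core ε ≤ plusPart ξ := by
      rw [hcore, hp]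
      intro hle
      have hwa : w a = 0 := hle ⟨a, h.apply_self⟩
      rw [← h.apply_self, hew.1, h.apply_self] at hwa
      exact h.ne_zero hwa
    rw [pairPart, pairCompl, if_neg hnot, if_neg hnot]
    exact ⟨hm, hp⟩
  · have hle : core ε ≤ plusPart ξ := by
      rw [hcore, hp]
      exact hew.range_le
    rw [pairPart, pairCompl, if_pos hle, if_pos hle]
    exact ⟨hp, hm⟩

theorem exists_isReflection_isSubprojection (hA : IsAdmissible p A) {ε : A ≃+ A}
    (h : IsCyclicProjection p e a k) (hε : IsReflection ε e) (hξ : ∀ a, ξ (ξ a) = a)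
    (hcomm : Commutes ξ ε) : ∃ w : A →+ A, IsReflection ξ w ∧ IsSubprojection e w := by
  have h2 := hA.bijective_two_nsmul
  obtain ⟨w, hw, hξw⟩ := exists_eq_sub_two_nsmul_projection h2 hξ
  have hrefl : IsReflection ξ w := ⟨hw, Or.inl hξw⟩
  rcases h.isSubprojection_or_isOrthogonal hA.prime hw
    ((hrefl.commutes_iff_comm h2.injective hε).mp hcomm) with hle | hort
  · exact ⟨w, hrefl, hle⟩
  · exact ⟨_, hrefl.compl, isSubprojection_compl_iff.mpr hort⟩

end IsAdmissible

end Involutions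

section LayerMaps

variable {p n k : ℕ} {κ : Cardinal.{u}} {M N : Type u} [AddCommGroup M] [AddCommGroup N]

theorem map_mem_layerKer (f : M →+ N) {x : M} (h : x ∈ layerKer p n M) : f x ∈ layerKer p n N := by
  obtain ⟨z, hz⟩ := mem_layerKer.mp h
  exact mem_layerKer.mpr ⟨f z, by rw [← map_nsmul, hz, map_nsmul]⟩

theorem layerCard_le_of_forall_exists (f : M →+ N) (h : ∀ y, ∃ x, y - f x ∈ layerKer p n N) :
    layerCard p n N ≤ layerCard p n M := by
  refine mk_le_of_surjective
    (f := QuotientAddGroup.map (layerKer p n M) (layerKer p n N) f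
      fun _ hx => map_mem_layerKer f hx) fun y => ?_
  obtain ⟨y, rfl⟩ := QuotientAddGroup.mk_surjective y
  obtain ⟨x, hx⟩ := h y
  exact ⟨x, QuotientAddGroup.eq.mpr (by rwa [neg_add_eq_sub])⟩

theorem layerCard_le_of_surjective (f : M →+ N) (hf : Function.Surjective f) :
    layerCard p n N ≤ layerCard p n M :=
  layerCard_le_of_forall_exists f fun y => (hf y).imp fun x hx => by
    rw [hx, sub_self]
    exact zero_mem _

theorem layerCard_prod_le : layerCard p n (M × N) ≤ layerCard p n M * layerCard p n N := by
  let φ : M × N →+ (M ⧸ layerKer p n M) × (N ⧸ layerKer p n N) :=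
    (QuotientAddGroup.mk' _).prodMap (QuotientAddGroup.mk' _)
  have hker : φ.ker ≤ layerKer p n (M × N) := fun x hx => by
    obtain ⟨h₁, h₂⟩ := Prod.mk.inj hx
    obtain ⟨z₁, hz₁⟩ := mem_layerKer.mp ((QuotientAddGroup.eq_zero_iff _).mp h₁)
    obtain ⟨z₂, hz₂⟩ := mem_layerKer.mp ((QuotientAddGroup.eq_zero_iff _).mp h₂)
    exact mem_layerKer.mpr ⟨(z₁, z₂), Prod.ext hz₁ hz₂⟩
  refine (mk_quotient_le_of_le hker).trans
    ((mk_le_of_injective (QuotientAddGroup.kerLift_injective φ)).trans_eq ?_)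
  rw [mk_prod, lift_id, lift_id]
  rfl

theorem exists_smul_eq_of_pow_smul_eq_zero (h : ∀ x : M, p • x = 0 → ∃ z, p ^ n • z = x) {j : ℕ}
    (hj : j ≤ n) {x : M} (hx : p ^ j • x = 0) : ∃ z, p • z = x := by
  induction j generalizing x with
  | zero => exact ⟨0, by simpa using hx.symm⟩
  | succ j ih =>
    obtain ⟨z, hz⟩ := h (p ^ j • x) (by rw [← mul_smul, ← pow_succ', hx])
    obtain ⟨l, rfl⟩ := Nat.exists_eq_add_of_le hj
    obtain ⟨y, hy⟩ := ih (by omega) (x := x - p • p ^ l • z) (by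
      rw [smul_sub, ← hz, ← mul_smul, ← mul_smul, sub_eq_zero]
      congr 1
      ring)
    exact ⟨y + p ^ l • z, by rw [smul_add, hy, sub_add_cancel]⟩

theorem layerCard_zero_eq (h : ∀ x : M, p • x = 0 → ∃ z, p ^ n • z = x) :
    layerCard p 0 M = layerCard p n M := by
  have hle : layerKer p n M ≤ layerKer p 0 M := fun x hx => by
    obtain ⟨z, hz⟩ := mem_layerKer.mp hx
    obtain ⟨y, hy⟩ := exists_smul_eq_of_pow_smul_eq_zero h le_rfl (x := x - p • z) (by
      rw [smul_sub, ← hz, ← mul_smul, ← pow_succ, sub_self])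
    exact mem_layerKer.mpr ⟨y + z, by simp [hy]⟩
  rw [layerCard, layerCard, le_antisymm hle (layerKer_mono (Nat.zero_le n))]

theorem mk_range_le (hp : p.Prime) (hκ : ℵ₀ ≤ κ) (h : layerCard p 0 M ≤ κ) {φ : M →+ N}
    (hφ : ∀ x, p ^ k • φ x = 0) : #φ.range ≤ κ := by
  have hrange : ∀ y : φ.range, p ^ k • y = 0 := by
    rintro ⟨_, x, rfl⟩
    exact Subtype.ext (hφ x)
  exact mk_le_of_pow_smul_eq_zero hp (fun y => ⟨k, hrange y⟩) hκ
    ((layerCard_le_of_surjective _ φ.rangeRestrict_surjective).trans h) hrange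

theorem IsPBasis.exists_hom_surjOn (hp : p.Prime) (hM : IsAbelianPGroup p M) {s : Set M}
    (hs : IsPBasis p s) (hN : ∀ y : N, p ^ n • y = 0) (hcard : #N ≤ #(highPart p n s)) :
    ∃ h : M →+ N, Set.SurjOn h (highPart p n s) Set.univ := by
  classical
  obtain ⟨ι⟩ := hcard
  let v : M → N := fun a => if ha : a ∈ highPart p n s then Function.invFun ι ⟨a, ha⟩ else 0
  obtain ⟨h, hh⟩ := hs.exists_hom_apply_eq hN v fun a _ c hc => by
    by_cases ha : a ∈ highPart p n s
    · obtain ⟨l, hl, hl'⟩ := hM.exists_pow_smul_ne_zero (x := a) fun h0 => ha.2 (by simp [h0])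
      have hnl : n ≤ l + 1 := (lt_of_not_ge fun hle => ha.2 (pow_smul_eq_zero_of_le hle hl')).le
      obtain ⟨t, rfl⟩ := pow_dvd_of_zsmul_eq_zero hp hl hl' hc
      rw [mul_comm, mul_smul, natCast_pow_zsmul, pow_smul_eq_zero_of_le hnl (hN _), smul_zero]
    · simp [v, ha]
  refine ⟨h, fun d _ => ⟨ι d, (ι d).2, ?_⟩⟩
  rw [hh _ (ι d).2.1]
  simp only [v, Subtype.coe_prop, dif_pos, Subtype.coe_eta,
    Function.leftInverse_invFun ι.injective d]

theorem PureIndep.mk_zsmul_mem_le (hM : IsAbelianPGroup p M) {s : Set M} (hs : PureIndep p s)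
    {T : Set M} (hT : #T ≤ κ) : #{d ∈ s | ∃ c : ℤ, c • d ∈ T ∧ c • d ≠ 0} ≤ κ := by
  refine le_trans ?_ hT
  choose c hc hc0 using fun d : {d ∈ s | ∃ c : ℤ, c • d ∈ T ∧ c • d ≠ 0} => d.2.2
  refine mk_le_of_injective (f := fun d => (⟨c d • (d : M), hc d⟩ : T)) fun d d' h => ?_
  exact Subtype.ext (hs.eq_of_zsmul_eq_zsmul hM d.2.1 d'.2.1 (hc0 d) (congrArg Subtype.val h))

theorem mk_isolated_le (hp : p.Prime) (hN : IsAbelianPGroup p N) (hκ : ℵ₀ ≤ κ)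
    (h : layerCard p 0 N ≤ κ) (g : M →+ N) (s : Set M) (j : ℕ) :
    #{d ∈ s | ∀ y ∈ s, y ≠ d → ∀ z, g (d - y) ≠ p ^ j • z} ≤ κ := by
  refine le_trans ?_ (mk_quotient_range_pow_le hp hN hκ h j)
  refine mk_le_of_injective
    (f := fun d => (g d : N ⧸ (nsmulAddMonoidHom (p ^ j) : N →+ N).range)) fun d y hdy => ?_
  by_contra hne
  obtain ⟨z, hz⟩ := QuotientAddGroup.eq.mp hdy.symm
  refine d.2.2 y y.2.1 (fun heq => hne (Subtype.ext heq.symm)) z ?_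
  rw [map_sub, ← neg_add_eq_sub, ← hz, nsmulAddMonoidHom_apply]

theorem IsPBasis.exists_detached (hp : p.Prime) (hM : IsAbelianPGroup p M)
    (hN : IsAbelianPGroup p N) {s : Set M} (hs : IsPBasis p s) (hκ : ℵ₀ ≤ κ) (hcard : κ < #s)
    (h : layerCard p 0 N ≤ κ) (g : M →+ N) {T : Set M} (hT : #T ≤ κ) :
    ∃ d ∈ s, (∀ c : ℤ, c • d ∈ T → c • d = 0) ∧
      ∀ j, ∃ y ∈ s, y ≠ d ∧ ∃ z, g (d - y) = p ^ j • z := by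
  let isolated (j : ℕ) : Set M := {d ∈ s | ∀ y ∈ s, y ≠ d → ∀ z, g (d - y) ≠ p ^ j • z}
  let bad : Set M := {d ∈ s | ∃ c : ℤ, c • d ∈ T ∧ c • d ≠ 0} ∪ ⋃ j, isolated j
  have hisolated : #(⋃ j, isolated j) ≤ κ := by
    have hsum := mk_iUnion_le_lift.{u, 0} isolated
    simp only [lift_uzero, mk_nat, lift_aleph0] at hsum
    refine hsum.trans ((mul_le_mul_right (ciSup_le' fun j => ?_) _).trans_eq (aleph0_mul_eq hκ))
    exact mk_isolated_le hp hN hκ h g s j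
  have hbad : #bad ≤ κ := (mk_union_le _ _).trans
    ((add_le_add (hs.1.mk_zsmul_mem_le hM hT) hisolated).trans_eq (add_eq_self hκ))
  obtain ⟨d, hd, hgood⟩ : ∃ d ∈ s, d ∉ bad := by
    by_contra! hcon
    exact ((mk_le_mk_of_subset hcon).trans hbad).not_gt hcard
  refine ⟨d, hd, fun c hc => ?_, fun j => ?_⟩
  · by_contra hne
    exact hgood (Or.inl ⟨hd, c, hc, hne⟩)
  · by_contra! hcon
    exact hgood (Or.inr (Set.mem_iUnion.mpr ⟨j, hd, hcon⟩))

end LayerMaps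

section FinalProjections

variable {p m n k : ℕ} {κ : Cardinal.{u}} {A : Type u} [AddCommGroup A] {e w δ π : A →+ A} {a : A}

theorem layerCard_range_eq (h : ∀ x, p ^ n • (x - w x) = 0) :
    layerCard p n w.range = layerCard p n A := by
  refine le_antisymm (layerCard_le_of_surjective _ w.rangeRestrict_surjective) ?_
  refine layerCard_le_of_forall_exists w.range.subtype fun y => ⟨w.rangeRestrict y, ?_⟩
  exact mem_layerKer.mpr ⟨0, by simpa using (h y).symm⟩

theorem SocleDivisible.layerCard_range_zero_eq (hm : SocleDivisible p w m) (hw : IsProjection w) :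
    layerCard p 0 w.range = layerCard p m w.range := by
  refine layerCard_zero_eq fun x hx => ?_
  obtain ⟨b, hb⟩ := hm x (hw.mem_range.mp x.2) (by simpa using congrArg Subtype.val hx)
  refine ⟨w.rangeRestrict b, Subtype.ext ?_⟩
  simp [← map_nsmul, hb, hw.mem_range.mp x.2]

theorem IsSubprojection.layerCard_range_le (h : IsSubprojection e w) (he : IsProjection e) :
    layerCard p n e.range ≤ layerCard p n w.range := by
  refine layerCard_le_of_surjective (e.rangeRestrict.comp w.range.subtype) fun y => ?_
  exact ⟨⟨y, h.range_le y.2⟩, he.rangeRestrict_coe y⟩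

theorem IsSubprojection.layerCard_range_le_of_le (h : IsSubprojection e w) (hw : IsProjection w)
    (hκ : ℵ₀ ≤ κ) (he : layerCard p n e.range ≤ κ) (hwe : layerCard p n (w - e).range ≤ κ) :
    layerCard p n w.range ≤ κ := by
  let sum : e.range × (w - e).range →+ w.range :=
    (AddSubgroup.inclusion h.range_le).coprod (AddSubgroup.inclusion (h.sub hw).range_le)
  have hsum : Function.Surjective sum := fun y =>
    ⟨(e.rangeRestrict y, (w - e).rangeRestrict y),
      Subtype.ext (by simp [sum, hw.mem_range.mp y.2])⟩
  exact (layerCard_le_of_surjective sum hsum).trans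
    (layerCard_prod_le.trans ((mul_le_mul' he hwe).trans_eq (mul_eq_self hκ)))

theorem IsProjection.isCyclicProjection_extendRange (hw : IsProjection w)
    {e : w.range →+ w.range} {a : w.range} (h : IsCyclicProjection p e a k) :
    IsCyclicProjection p (extendRange w e) (a : A) k where
  apply_self := by rw [hw.extendRange_coe, h.apply_self]
  pow_smul_ne_zero h0 := h.pow_smul_ne_zero (Subtype.ext (by simpa using h0))
  pow_succ_smul := by simpa using congrArg Subtype.val h.pow_succ_smul
  exists_eq_zsmul x := (h.exists_eq_zsmul (w.rangeRestrict x)).imp fun c hc => by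
    simpa [extendRange] using congrArg Subtype.val hc

/-- The projection `w` splits `A` at `p ^ m`: the cyclic summands of its kernel have order at most
`p ^ m`, those of its range have a larger order. -/
structure SplitsAt (p : ℕ) (w : A →+ A) (m : ℕ) : Prop where
  pow_smul_sub_eq_zero : ∀ x, p ^ m • (x - w x) = 0
  socleDivisible : SocleDivisible p w m

/-- The projections `w` whose range is the summand `A_fin` of a decomposition of `A`: they split
`A` at some `p ^ m` from which on the layers of `A` are as small as possible. -/
structure IsFinalProjection (p : ℕ) (w : A →+ A) (m : ℕ) : Prop extends SplitsAt p w m where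
  isProjection : IsProjection w
  layerCard_le : ∀ n, layerCard p m A ≤ layerCard p n A

theorem IsFinalProjection.mk_range_le (hA : IsAdmissible p A) (hw : IsFinalProjection p w m)
    (hδ : IsProjection δ) (hδw : IsSubprojection δ w) (hk : ∀ x, p ^ k • δ x = 0) :
    #δ.range ≤ layerCard p m A := by
  refine mk_le_of_pow_smul_eq_zero hA.prime (hA.isPGroup.addSubgroup _)
    (aleph0_le_layerCard hA.prime hA.isPGroup hA.reduced hA.unbounded m) ?_ (k := k) ?_
  · rw [← layerCard_range_eq hw.pow_smul_sub_eq_zero,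
      ← hw.socleDivisible.layerCard_range_zero_eq hw.isProjection]
    exact hδw.layerCard_range_le hδ
  · rintro ⟨_, x, rfl⟩
    exact Subtype.ext (by simpa using hk x)

theorem IsFinalProjection.exists_hom_surjective (hA : IsAdmissible p A)
    (hw : IsFinalProjection p w m) (hπ : IsProjection π) (hπw : IsSubprojection π w)
    (hk : ∀ x, p ^ k • (w - π) x = 0) :
    ∃ h : A →+ A, (∀ x, (w - π) (h x) = h x) ∧ (∀ x, h (π x) = h x) ∧
      ∀ d, (w - π) d = d → ∃ (x : A) (e : A →+ A) (j : ℕ),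
        IsCyclicProjection p e x j ∧ IsSubprojection e π ∧ h x = d := by
  have hδ : IsProjection (w - π) := hπw.isProjection_sub hπ hw.isProjection
  let K := max k m
  have hKδ (x : A) : p ^ K • (w - π) x = 0 := pow_smul_eq_zero_of_le (le_max_left k m) (hk x)
  have hKπ (x : A) : p ^ K • (x - π x) = 0 := by
    rw [← sub_add_sub_cancel x (w x), smul_add, ← AddMonoidHom.sub_apply, hKδ,
      pow_smul_eq_zero_of_le (le_max_right k m) (hw.pow_smul_sub_eq_zero x), add_zero]
  have hP := hA.isPGroup.addSubgroup π.range
  obtain ⟨s, hs⟩ := exists_isPBasis hA.prime hP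
  have hcard : #(w - π).range ≤ #(highPart p K s) := by
    have hinf := aleph0_le_layerCard hA.prime hA.isPGroup hA.reduced hA.unbounded K
    have hlayer := layerCard_range_eq hKπ
    rw [← hlayer] at hinf
    rw [← hs.layerCard_eq_mk_highPart hA.prime hP hinf, hlayer]
    exact (hw.mk_range_le hA hδ (hπw.sub hw.isProjection) hk).trans (hw.layerCard_le K)
  obtain ⟨h, hh⟩ := hs.exists_hom_surjOn hA.prime hP (N := (w - π).range) (n := K)
    (by rintro ⟨_, x, rfl⟩; exact Subtype.ext (by simpa using hKδ x)) hcard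
  refine ⟨(w - π).range.subtype.comp (h.comp π.rangeRestrict),
    fun x => hδ.mem_range.mp (h (π.rangeRestrict x)).2, fun x => ?_, fun d hd => ?_⟩
  · simp [show π.rangeRestrict (π x) = π.rangeRestrict x from Subtype.ext (hπ x)]
  · obtain ⟨b, hb, hbd⟩ := hh (Set.mem_univ ⟨d, hδ.mem_range.mpr hd⟩)
    obtain ⟨j, hj, hj'⟩ := hP.exists_pow_smul_ne_zero (x := b) fun h0 => hb.2 (by simp [h0])
    obtain ⟨e, he, -⟩ := hs.exists_isCyclicProjection hb.1 hj hj'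
    refine ⟨b, _, j, hπ.isCyclicProjection_extendRange he, hπ.isSubprojection_extendRange e, ?_⟩
    simp [hπ.rangeRestrict_coe, hbd]

theorem IsAdmissible.exists_small_summand (hA : IsAdmissible p A) (hw : IsProjection w)
    (hs : SplitsAt p w m) (hn : layerCard p n A < layerCard p m A) :
    ∃ (π : A →+ A) (k : ℕ), IsProjection π ∧ IsSubprojection π w ∧ SplitsAt p π k ∧
      (∃ (e : A →+ A) (a : A), IsCyclicProjection p e a k ∧ IsSubprojection e π) ∧
      layerCard p 0 π.range ≤ layerCard p k A ∧ layerCard p k A < layerCard p 0 (w - π).range := by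
  have hmn : m ≤ n := by
    by_contra hlt
    exact (layerCard_antitone (p := p) (M := A) (not_le.mp hlt).le).not_gt hn
  obtain ⟨δ, hδ, hδw, hδn, hsoc⟩ := exists_bounded_decomposition hA.prime hA.isPGroup hw n
  have hπ : IsProjection (w - δ) := hδw.isProjection_sub hδ hw
  have hπn (x : A) : p ^ n • (x - (w - δ) x) = 0 := by
    rw [AddMonoidHom.sub_apply, sub_sub_eq_add_sub, add_sub_right_comm, smul_add, hδn,
      pow_smul_eq_zero_of_le hmn (hs.pow_smul_sub_eq_zero x), add_zero]
  have hne : ∃ x, (w - δ) x ≠ 0 := by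
    have := hA.exists_pow_smul_compl_ne_zero (e := AddMonoidHom.id A - (w - δ)) hπn 0
    simpa [sub_sub_cancel] using this
  obtain ⟨k, e, a, he, heπ, hsk⟩ :=
    exists_isCyclicProjection_socleDivisible hA.prime hA.isPGroup hA.reduced hπ hne
  have hnk : n ≤ k := he.le_of_socleDivisible heπ hsoc
  have hπk (x : A) : p ^ k • (x - (w - δ) x) = 0 := pow_smul_eq_zero_of_le hnk (hπn x)
  have hlayer : layerCard p 0 (w - δ).range ≤ layerCard p k A := by
    rw [hsk.layerCard_range_zero_eq hπ, layerCard_range_eq hπk]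
  refine ⟨w - δ, k, hπ, hδw.sub hw, ⟨hπk, hsk⟩, ⟨e, a, he, heπ⟩, hlayer, ?_⟩
  rw [sub_sub_cancel]
  by_contra! hle
  have hinf := aleph0_le_layerCard hA.prime hA.isPGroup hA.reduced hA.unbounded k
  have hwk := hδw.layerCard_range_le_of_le hw hinf hle hlayer
  rw [hs.socleDivisible.layerCard_range_zero_eq hw,
    layerCard_range_eq hs.pow_smul_sub_eq_zero] at hwk
  exact (hwk.trans (layerCard_antitone hnk)).not_gt hn

/-- The cyclic summand with generator `d` and projection `b`, lying in the range of `δ`, cannot be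
reached by `f` from the range of `π`: no nonzero multiple of `d` is the `δ`-component of the image
of an element of that range, and `d` is the `b`-component of elements whose preimages under `f` have
`π`-components divisible by arbitrarily high powers of `p`. -/
structure IsDetached (p : ℕ) (f : A ≃+ A) (π δ b : A →+ A) (d : A) : Prop where
  zsmul_eq_zero : ∀ (c : ℤ) (y : A), c • d = δ (f (π y)) → c • d = 0
  exists_lift : ∀ j : ℕ, ∃ v, δ v = v ∧ b v = d ∧ ∃ z, π (f.symm v) = p ^ j • z

theorem exists_isDetached (hp : p.Prime) (hA : IsAbelianPGroup p A) (hδ : IsProjection δ)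
    (hk : ∀ x, p ^ k • δ x = 0) (hκ : ℵ₀ ≤ κ) (hπκ : layerCard p 0 π.range ≤ κ)
    (hκδ : κ < layerCard p 0 δ.range) (f : A ≃+ A) :
    ∃ (b : A →+ A) (d : A) (l : ℕ),
      IsCyclicProjection p b d l ∧ IsSubprojection b δ ∧ IsDetached p f π δ b d := by
  have hD := hA.addSubgroup δ.range
  obtain ⟨s, hs⟩ := exists_isPBasis hp hD
  have hcard : κ < #s := lt_of_not_ge fun hle => (hs.layerCard_le_of_mk_le hκ hle).not_gt hκδ
  let φ : π.range →+ δ.range := δ.rangeRestrict.comp (f.toAddMonoidHom.comp π.range.subtype)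
  let g : δ.range →+ π.range := π.rangeRestrict.comp (f.symm.toAddMonoidHom.comp δ.range.subtype)
  obtain ⟨d, hds, hdT, hdg⟩ := hs.exists_detached hp hD (hA.addSubgroup π.range) hκ hcard hπκ g
    (mk_range_le hp hκ hπκ (φ := φ) (k := k) fun x => Subtype.ext (hk (f x)))
  obtain ⟨l, hl, hl'⟩ := hD.exists_pow_smul_ne_zero (x := d) fun h => hs.zero_notMem (h ▸ hds)
  obtain ⟨b, hb, hb0⟩ := hs.exists_isCyclicProjection hds hl hl'
  refine ⟨_, d, l, hδ.isCyclicProjection_extendRange hb, hδ.isSubprojection_extendRange b,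
    fun c y hcy => ?_, fun j => ?_⟩
  · exact congrArg Subtype.val (hdT c ⟨π.rangeRestrict y, Subtype.ext hcy.symm⟩)
  · obtain ⟨y, hys, hyd, z, hz⟩ := hdg j
    refine ⟨(d - y : δ.range), hδ.mem_range.mp (Subtype.prop _), ?_, z, congrArg Subtype.val hz⟩
    rw [hδ.extendRange_coe, map_sub, hb0 y hys hyd, sub_zero, hb.apply_self]

end FinalProjections

section Final

variable {p m n k l j : ℕ} {A : Type u} [AddCommGroup A] {ξ ε ε' f : A ≃+ A}
  {w e b π δ : A →+ A} {a d x : A}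

theorem SplitsAt.isSubprojection_iff (hp : p.Prime) (hs : SplitsAt p w m) (hw : IsProjection w)
    (he : IsCyclicProjection p e a k) (hcomm : ∀ y, w (e y) = e (w y)) :
    IsSubprojection e w ↔ m ≤ k := by
  refine ⟨fun hew => he.le_of_socleDivisible hew hs.socleDivisible, fun hmk => ?_⟩
  refine (he.isSubprojection_or_isOrthogonal hp hw hcomm).resolve_right fun hort => ?_
  exact (he.lt_of_forall_pow_smul_eq_zero (isSubprojection_compl_iff.mpr hort)
    hs.pow_smul_sub_eq_zero).not_ge hmk

theorem SocleDivisible.of_sub (hew : IsSubprojection e w) (he : IsProjection e)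
    (hw : IsProjection w) (hm : SocleDivisible p e m) (hm' : SocleDivisible p (w - e) m) :
    SocleDivisible p w m := by
  intro x hx hpx
  obtain ⟨y, hy⟩ := hm (e x) (he x) (by rw [← map_nsmul, hpx, map_zero])
  obtain ⟨z, hz⟩ := hm' ((w - e) x) (hew.isProjection_sub he hw x)
    (by rw [← map_nsmul, hpx, map_zero])
  exact ⟨y + z, by rw [smul_add, hy, hz, AddMonoidHom.sub_apply, hx, add_sub_cancel]⟩

theorem splitsAt_of_forall (hp : p.Prime) (hA : IsAbelianPGroup p A) (hR : IsReducedGroup A)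
    (hw : IsProjection w) (he : IsCyclicProjection p e a m) (hew : IsSubprojection e w)
    (H : ∀ {e' : A →+ A} {a' : A} {k : ℕ}, IsCyclicProjection p e' a' k → IsOrthogonal e e' →
      (∀ y, w (e' y) = e' (w y)) → (IsSubprojection e' w ↔ m ≤ k)) : SplitsAt p w m where
  pow_smul_sub_eq_zero := by
    by_contra! hne
    obtain ⟨k, e', a', hmk, he', hle⟩ :=
      exists_isCyclicProjection_of_pow_smul_ne_zero hp hA hR hw.compl hne
    have hort : IsOrthogonal e' w := isSubprojection_compl_iff.mp hle
    have he'w := (H he' (hort.symm.mono hew ⟨he'.isProjection, he'.isProjection⟩)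
      fun y => by rw [hort.1, hort.2]).mpr hmk
    exact he'.ne_zero (by rw [← he'.apply_self, ← he'w.1, hort.2])
  socleDivisible := by
    refine (he.socleDivisible hp).of_sub hew he.isProjection hw ?_
    by_contra hsoc
    obtain ⟨k, e', a', hkm, he', hle⟩ := exists_isCyclicProjection_of_not_socleDivisible hp hA
      (hew.isProjection_sub he.isProjection hw) hsoc
    have he'w := hle.trans (hew.sub hw)
    have hort := (hew.isOrthogonal_sub he.isProjection).mono
      ⟨he.isProjection, he.isProjection⟩ hle
    exact hkm.not_ge ((H he' hort fun y => by rw [he'w.1, he'w.2]).mp he'w)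

theorem isSubprojection_iff_range_le (hw : IsProjection w) (hcomm : ∀ y, w (e y) = e (w y)) :
    IsSubprojection e w ↔ e.range ≤ w.range := by
  refine ⟨IsSubprojection.range_le, fun hle => ?_⟩
  have hwe (y : A) : w (e y) = e y := hw.mem_range.mp (hle ⟨y, rfl⟩)
  exact ⟨hwe, fun y => by rw [← hcomm, hwe]⟩

theorem IsAdmissible.byOrd_iff (hA : IsAdmissible p A) (h : IsCyclicProjection p e a m)
    (hε : IsReflection ε e) (hξ : IsReflection ξ w) (hew : IsSubprojection e w) :
    ByOrd ξ ε ↔ SplitsAt p w m := by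
  have h2 := hA.bijective_two_nsmul.injective
  have htest {ε' : A ≃+ A} {e' : A →+ A} {a' : A} {k : ℕ} (he' : IsCyclicProjection p e' a' k)
      (hε' : IsReflection ε' e') (hcomm : ∀ y, w (e' y) = e' (w y)) :
      (core ε' ≤ pairPart ξ ε ↔ ord ε ≤ ord ε') ↔ (IsSubprojection e' w ↔ m ≤ k) := by
    rw [(hA.core_perp_eq he' hε').1, (hA.pairPart_pairCompl_eq h hε hξ hew).1,
      ← isSubprojection_iff_range_le hξ.1 hcomm, hA.ord_eq h hε, hA.ord_eq he' hε',
      natCast_pow_succ_le_iff hA.prime]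
  refine ⟨fun hB => ?_, fun hs ε' hext hcomm => ?_⟩
  · refine splitsAt_of_forall hA.prime hA.isPGroup hA.reduced hξ.1 h hew fun he' _ hcomm => ?_
    have hε' := isReflection_reflection he'.isProjection
    exact (htest he' hε' hcomm).mp
      (hB _ (hA.extreme he' hε') ((hξ.commutes_iff_comm h2 hε').mpr hcomm))
  · obtain ⟨e', a', k, he', hε'⟩ := hA.exists_isCyclicProjection_of_extreme hext
    have hcomm := (hξ.commutes_iff_comm h2 hε').mp hcomm
    exact (htest he' hε' hcomm).mpr (hs.isSubprojection_iff hA.prime hξ.1 he' hcomm)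

theorem IsAdmissible.sends_iff (hA : IsAdmissible p A) (hc : IsCyclicProjection p e x j)
    (hε : IsReflection ε e) (hb : IsCyclicProjection p b d l) (hε' : IsReflection ε' b) :
    Sends f ε ε' ↔ AddSubgroup.zmultiples (f x) = AddSubgroup.zmultiples d := by
  rw [Sends, (hA.core_perp_eq hc hε).1, (hA.core_perp_eq hb hε').1, hc.range_eq, hb.range_eq,
    AddMonoidHom.map_zmultiples]
  rfl

section Unipotent

variable {h : A →+ A} (hh : ∀ y, h (h y) = 0)

theorem IsAdmissible.inSum_conj_unipotent (hA : IsAdmissible p A)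
    (hc : IsCyclicProjection p e x j) (hε : IsReflection ε e) (hb : IsCyclicProjection p b d l)
    (hε' : IsReflection ε' b) (heb : ∀ y, e (b y) = 0) (hhx : h x = d) (heh : ∀ y, e (h y) = 0) :
    InSum (conj (unipotent h hh) ε) ε ε' := by
  have hcore := hA.core_perp_eq hc hε
  have hcore' := hA.core_perp_eq hb hε'
  have hcoref := hA.core_perp_eq (hc.conj (unipotent h hh)) (hε.conj _)
  refine ⟨?_, ?_, ?_⟩
  · rw [hcore.1, hcore'.1, eq_bot_iff]
    rintro _ ⟨hy, y, rfl⟩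
    rw [AddSubgroup.mem_bot, ← hc.isProjection.mem_range.mp hy, heb]
  · rw [hcoref.1, hcore.1, hcore'.1, (hc.conj _).range_eq, hc.range_eq, hb.range_eq,
      AddSubgroup.zmultiples_le, unipotent_apply, hhx]
    exact AddSubgroup.add_mem_sup (AddSubgroup.mem_zmultiples x) (AddSubgroup.mem_zmultiples d)
  · rw [hcoref.2, hcore.2]
    rintro y ⟨hy : e y = 0, -⟩
    rw [AddMonoidHom.mem_ker, conjHom_apply, unipotent_symm_apply, map_sub, hy, heh, sub_zero,
      map_zero]

theorem IsAdmissible.mapsOnto_unipotent (hA : IsAdmissible p A)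
    (hc : IsCyclicProjection p e x j) (hε : IsReflection ε e) (hb : IsCyclicProjection p b d l)
    (hε' : IsReflection ε' b) (heb : ∀ y, e (b y) = 0) (hhx : h x = d) (heh : ∀ y, e (h y) = 0) :
    MapsOnto (unipotent h hh) ε ε' := by
  have hfx : unipotent h hh x = x + d := by rw [unipotent_apply, hhx]
  have hed : e d = 0 := by rw [← hb.apply_self, heb]
  have hefx : e (x + d) = x := by rw [map_add, hc.apply_self, hed, add_zero]
  refine ⟨hA.extreme hc hε, hA.extreme hb hε',
    hA.inSum_conj_unipotent hh hc hε hb hε' heb hhx heh, ?_, ?_⟩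
  · rw [hA.sends_iff hc hε hc hε, hfx]
    intro heq
    obtain ⟨t, ht : t • x = x + d⟩ : x + d ∈ AddSubgroup.zmultiples x :=
      heq ▸ AddSubgroup.mem_zmultiples _
    rw [← ht, map_zsmul, hc.apply_self, ht] at hefx
    exact hb.ne_zero (add_eq_left.mp hefx)
  · rw [hA.sends_iff hc hε hb hε', hfx]
    intro heq
    obtain ⟨t, ht : t • d = x + d⟩ : x + d ∈ AddSubgroup.zmultiples d :=
      heq ▸ AddSubgroup.mem_zmultiples _
    rw [← ht, map_zsmul, hed, smul_zero] at hefx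
    exact hc.ne_zero hefx.symm

end Unipotent

theorem IsAdmissible.pair (hA : IsAdmissible p A) (h : IsCyclicProjection p e a m)
    (hε : IsReflection ε e) (hξ : IsReflection ξ w) (hew : IsSubprojection e w) : Pair ξ ε :=
  ⟨hξ.apply_apply, hA.extreme h hε,
    (hξ.commutes_iff_comm hA.bijective_two_nsmul.injective hε).mpr fun y => by rw [hew.1, hew.2]⟩

theorem sends_self_of_forall (h : ∀ y ∈ core ε, f y = y) : Sends f ε ε := by
  ext x
  constructor
  · rintro ⟨y, hy, rfl⟩
    rwa [← h y hy] at hy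
  · exact fun hx => ⟨x, hx, h x hx⟩

theorem IsFinalProjection.final (hA : IsAdmissible p A) (h : IsCyclicProjection p e a m)
    (hε : IsReflection ε e) (hξ : IsReflection ξ w) (hew : IsSubprojection e w)
    (hw : IsFinalProjection p w m) : Final ξ ε := by
  refine ⟨(hA.byOrd_iff h hε hξ hew).mpr hw.toSplitsAt, fun ξ₁ ε₁ hP hlt hB => ?_⟩
  obtain ⟨e₁, a₁, k, he₁, hε₁⟩ := hA.exists_isCyclicProjection_of_extreme hP.2.1
  obtain ⟨v, hξ₁, hev⟩ := hA.exists_isReflection_isSubprojection he₁ hε₁ hP.1 hP.2.2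
  have hvk := ((hA.byOrd_iff he₁ hε₁ hξ₁ hev).mp hB).pow_smul_sub_eq_zero
  have hpart := hA.pairPart_pairCompl_eq he₁ hε₁ hξ₁ hev
  rw [(hA.pairPart_pairCompl_eq h hε hξ hew).1, hpart.1] at hlt
  rw [(hA.pairPart_pairCompl_eq h hε hξ hew).1, hpart.1, hpart.2]
  have hwv (y : A) : w (v y) = v y := hw.isProjection.mem_range.mp (hlt.le ⟨y, rfl⟩)
  have hπ : IsProjection (v.comp w) := fun y => by simp [hwv, hξ₁.1 (w y)]
  have hπw : IsSubprojection (v.comp w) w :=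
    ⟨fun y => by simp [hwv], fun y => by simp [hw.isProjection y]⟩
  obtain ⟨φ, hφδ, -, hφ⟩ := hw.exists_hom_surjective hA hπ hπw (k := k) fun y => by
    simpa using hvk (w y)
  have hvφ (y : A) : v (φ y) = 0 := by
    rw [← hφδ y]
    simp [hξ₁.1 (w (φ y))]
  -- Precomposing `φ` with `v` makes the automorphism `1 + φ v` the identity on the kernel of `v`.
  refine ⟨unipotent (φ.comp v) fun y => by simp [hvφ], fun ε' _ hle => ?_, fun ε' hε' hle => ?_⟩
  · refine sends_self_of_forall fun y hy => ?_
    rw [unipotent_apply, AddMonoidHom.comp_apply, show v y = 0 from hle hy, map_zero, add_zero]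
  · obtain ⟨b, d, l, hb, hε'⟩ := hA.exists_isCyclicProjection_of_extreme hε'
    rw [(hA.core_perp_eq hb hε').1] at hle
    have hwb (y : A) : w (b y) = b y := hw.isProjection.mem_range.mp (hle ⟨y, rfl⟩).1
    have hvb (y : A) : v (b y) = 0 := (hle ⟨y, rfl⟩).2
    obtain ⟨x, c, j, hc, hcπ, hx⟩ := hφ d (by rw [← hb.apply_self]; simp [hwb, hvb])
    have hvx : v x = x := by
      rw [← hc.apply_self, ← hcπ.1, AddMonoidHom.comp_apply, hξ₁.1]
    have hcv := hc.comp hvx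
    have hη := isReflection_reflection hcv.isProjection
    refine ⟨_, hA.extreme hcv hη, ?_, hA.mapsOnto_unipotent _ hcv hη hb hε' ?_ ?_ ?_⟩
    · rw [(hA.core_perp_eq hcv hη).1]
      exact (hc.isSubprojection_comp hξ₁.1 hvx).range_le
    · simp [hvb]
    · rw [AddMonoidHom.comp_apply, hvx, hx]
    · simp [hvφ]

theorem IsAdmissible.exists_forall_isDetached (hA : IsAdmissible p A) (hw : IsProjection w)
    (hs : SplitsAt p w m) (hn : layerCard p n A < layerCard p m A) :
    ∃ (π e : A →+ A) (a : A) (k : ℕ), IsProjection π ∧ IsSubprojection π w ∧ SplitsAt p π k ∧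
      IsCyclicProjection p e a k ∧ IsSubprojection e π ∧
      ∀ f : A ≃+ A, ∃ (b : A →+ A) (d : A) (l : ℕ),
        IsCyclicProjection p b d l ∧ IsSubprojection b (w - π) ∧ IsDetached p f π (w - π) b d := by
  obtain ⟨π, k, hπ, hπw, hsk, ⟨e, a, he, heπ⟩, hle, hlt⟩ := hA.exists_small_summand hw hs hn
  have hk (x : A) : p ^ k • (w - π) x = 0 := by
    simpa [hπw.2] using hsk.pow_smul_sub_eq_zero (w x)
  exact ⟨π, e, a, k, hπ, hπw, hsk, he, heπ,
    exists_isDetached hA.prime hA.isPGroup (hπw.isProjection_sub hπ hw) hk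
      (aleph0_le_layerCard hA.prime hA.isPGroup hA.reduced hA.unbounded k) hle hlt⟩

theorem IsDetached.not_mapsOnto (hd : IsDetached p f π δ b d) (hA : IsAdmissible p A)
    (hc : IsCyclicProjection p e x j) (hε : IsReflection ε e) (hb : IsCyclicProjection p b d l)
    (hε' : IsReflection ε' b) (hπx : π x = x) (hδd : δ d = d) (hδπ : ∀ y, δ (π y) = 0) :
    ¬ MapsOnto f ε ε' := by
  rintro ⟨-, -, ⟨-, hle, -⟩, hne, -⟩
  rw [(hA.core_perp_eq (hc.conj f) (hε.conj f)).1, (hA.core_perp_eq hc hε).1,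
    (hA.core_perp_eq hb hε').1, (hc.conj f).range_eq, hc.range_eq, hb.range_eq,
    AddSubgroup.zmultiples_le, AddSubgroup.mem_sup] at hle
  obtain ⟨_, ⟨α, rfl⟩, _, ⟨β, rfl⟩, hfx : α • x + β • d = f x⟩ := hle
  have hβ : β • d = 0 := hd.zsmul_eq_zero β x <| by
    rw [hπx, ← hfx, map_add, map_zsmul, map_zsmul, hδd, ← hπx, hδπ, smul_zero, zero_add]
  rw [hβ, add_zero] at hfx
  have hfin : IsOfFinAddOrder x := isOfFinAddOrder_iff_nsmul_eq_zero.mpr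
    ⟨p ^ (j + 1), pow_pos hA.prime.pos _, hc.pow_succ_smul⟩
  have : Finite (AddSubgroup.zmultiples x) := hfin.finite_zmultiples
  refine hne ((hA.sends_iff hc hε hc hε).mpr (AddSubgroup.eq_of_le_of_card_ge ?_ ?_))
  · exact AddSubgroup.zmultiples_le.mpr ⟨α, hfx⟩
  · rw [Nat.card_zmultiples, Nat.card_zmultiples, f.addOrderOf_eq]

theorem IsAdmissible.isFinalProjection_of_final (hA : IsAdmissible p A)
    (h : IsCyclicProjection p e a m) (hε : IsReflection ε e) (hξ : IsReflection ξ w)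
    (hew : IsSubprojection e w) (hF : Final ξ ε) : IsFinalProjection p w m := by
  have hs := (hA.byOrd_iff h hε hξ hew).mp hF.1
  refine ⟨hs, hξ.1, fun n => ?_⟩
  by_contra hlt
  obtain ⟨π, e₁, a₁, k, hπ, hπw, hsk, he₁, heπ, hdet⟩ :=
    hA.exists_forall_isDetached hξ.1 hs (not_le.mp hlt)
  have hξ₁ := isReflection_reflection hπ
  have hε₁ := isReflection_reflection he₁.isProjection
  have hpart₁ := hA.pairPart_pairCompl_eq he₁ hε₁ hξ₁ heπ
  have hpart := hA.pairPart_pairCompl_eq h hε hξ hew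
  have hproper : π.range < w.range := by
    refine lt_of_le_of_ne hπw.range_le fun heq => ?_
    obtain ⟨b, d, l, hb, hbδ, -⟩ := hdet (AddEquiv.refl A)
    have hd : d ∈ (w - π).range := hbδ.range_le ⟨d, hb.apply_self⟩
    have hd' : d ∈ π.range := heq ▸ (hπw.sub hξ.1).range_le hd
    exact hb.ne_zero (AddSubgroup.mem_bot.mp (hπw.range_inf_range_sub hπ ▸ ⟨hd', hd⟩))
  obtain ⟨f, -, hf⟩ := hF.2 _ _ (hA.pair he₁ hε₁ hξ₁ heπ) (by rwa [hpart₁.1, hpart.1])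
    ((hA.byOrd_iff he₁ hε₁ hξ₁ heπ).mpr hsk)
  rw [hpart₁.1, hpart₁.2, hpart.1] at hf
  obtain ⟨b, d, l, hb, hbδ, hd⟩ := hdet f
  have hη := isReflection_reflection hb.isProjection
  obtain ⟨ε', hε', hcore, hmaps⟩ := hf _ (hA.extreme hb hη) (by
    rw [(hA.core_perp_eq hb hη).1]
    refine le_inf (hbδ.trans (hπw.sub hξ.1)).range_le ?_
    rintro _ ⟨x, rfl⟩
    rw [AddMonoidHom.mem_ker, ← hbδ.1, (hπw.isOrthogonal_sub hπ).1])
  obtain ⟨c, x, j, hc, hεc⟩ := hA.exists_isCyclicProjection_of_extreme hε'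
  rw [(hA.core_perp_eq hc hεc).1] at hcore
  exact hd.not_mapsOnto hA hc hεc hb hη (hπ.mem_range.mp (hcore ⟨x, hc.apply_self⟩))
    (by rw [← hb.apply_self, hbδ.1]) (hπw.isOrthogonal_sub hπ).2 hmaps

end Final

section Decomposition

variable {p m n k : ℕ} {A : Type u} [AddCommGroup A] {w e : A →+ A} {a : A} {κ : Cardinal.{u}}

theorem exists_isProjection_of_isCompl {X Y : AddSubgroup A} (h : IsCompl X Y) :
    ∃ v : A →+ A, IsProjection v ∧ v.range = X ∧ v.ker = Y := by
  have h' : IsCompl (AddSubgroup.toIntSubmodule X) (AddSubgroup.toIntSubmodule Y) :=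
    OrderIso.isCompl AddSubgroup.toIntSubmodule h
  refine ⟨(Submodule.projection _ _ h').toAddMonoidHom, fun x => by simp, ?_, ?_⟩
  · ext x
    exact SetLike.ext_iff.mp (Submodule.range_projection h') x
  · ext x
    exact SetLike.ext_iff.mp (Submodule.ker_projection h') x

theorem IsProjection.isCompl (hw : IsProjection w) : IsCompl w.ker w.range := by
  refine ⟨AddSubgroup.disjoint_def.mpr fun {x} hker hrange => ?_, codisjoint_iff.mpr ?_⟩
  · rw [← hw.mem_range.mp hrange]
    exact hker
  · refine eq_top_iff.mpr fun x _ => AddSubgroup.mem_sup.mpr ⟨x - w x, ?_, w x, ⟨x, rfl⟩, by simp⟩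
    rw [AddMonoidHom.mem_ker, map_sub, hw, sub_self]

theorem IsProjection.isCompl_sup_ker (hw : IsProjection w) {X Y : AddSubgroup A}
    (hinf : X ⊓ Y = ⊥) (hsup : X ⊔ Y = w.range) : IsCompl X (Y ⊔ w.ker) := by
  refine ⟨AddSubgroup.disjoint_def.mpr fun {x} hx hx' => ?_, codisjoint_iff.mpr ?_⟩
  · obtain ⟨y, hy, z, hz, rfl⟩ := AddSubgroup.mem_sup.mp hx'
    have hwy : w y = y := hw.mem_range.mp (hsup ▸ le_sup_right (a := X) hy)
    have hwyz : w (y + z) = y + z := hw.mem_range.mp (hsup ▸ le_sup_left (b := Y) hx)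
    rw [map_add, hwy, AddMonoidHom.mem_ker.mp hz, add_zero, left_eq_add] at hwyz
    rw [hwyz, add_zero] at hx ⊢
    exact AddSubgroup.mem_bot.mp (hinf ▸ ⟨hx, hy⟩)
  · rw [← sup_assoc, hsup, sup_comm, hw.isCompl.sup_eq_top]

theorem IsIndecSummand.exists_isCyclicProjection (hp : p.Prime) (hA : IsAbelianPGroup p A)
    (hR : IsReducedGroup A) {X : AddSubgroup A} (hw : IsProjection w)
    (h : IsIndecSummand X w.range) :
    ∃ (e : A →+ A) (a : A) (k : ℕ),
      IsCyclicProjection p e a k ∧ IsSubprojection e w ∧ e.range = X := by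
  obtain ⟨hX, Y, hinf, hsup⟩ := h
  obtain ⟨e, he, rfl, hker⟩ := exists_isProjection_of_isCompl (hw.isCompl_sup_ker hinf hsup)
  obtain ⟨a, k, hcyc⟩ := exists_isCyclicProjection_of_indecomposable hp hA hR he hX
  have hrange : e.range ≤ w.range := hsup ▸ le_sup_left
  have hkerle : w.ker ≤ e.ker := hker ▸ le_sup_right
  refine ⟨e, a, k, hcyc, ⟨fun x => hw.mem_range.mp (hrange ⟨x, rfl⟩), fun x => ?_⟩, rfl⟩
  have hmem : x - w x ∈ w.ker := by rw [AddMonoidHom.mem_ker, map_sub, hw, sub_self]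
  exact (sub_eq_zero.mp (by rw [← map_sub]; exact hkerle hmem)).symm

theorem IsCyclicProjection.isIndecSummand (hp : p.Prime) (hA : IsAbelianPGroup p A)
    (hw : IsProjection w) (h : IsCyclicProjection p e a m) (hew : IsSubprojection e w) :
    IsIndecSummand e.range w.range :=
  ⟨h.indecomposable hp hA, (w - e).range, hew.range_inf_range_sub h.isProjection,
    hew.range_sup_range_sub hw⟩

theorem IsAdmissible.hasFinalRank (hA : IsAdmissible p A)
    (hmin : ∀ n, layerCard p m A ≤ layerCard p n A) : HasFinalRank p A (layerCard p m A) := by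
  have heq : ⨅ n, layerCard p n A = layerCard p m A :=
    le_antisymm (ciInf_le' _ m) (le_ciInf hmin)
  exact heq ▸ hasFinalRank_iInf_layerCard hA.prime hA.isPGroup
    (aleph0_le_layerCard hA.prime hA.isPGroup hA.reduced hA.unbounded)

theorem SplitsAt.hasBasicRank (hs : SplitsAt p w m) (hA : IsAdmissible p A)
    (hw : IsProjection w) : HasBasicRank p w.range (layerCard p m A) := by
  have heq : layerCard p 0 w.range = layerCard p m A := by
    rw [hs.socleDivisible.layerCard_range_zero_eq hw, layerCard_range_eq hs.pow_smul_sub_eq_zero]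
  rw [← heq]
  refine hasBasicRank_layerCard hA.prime (hA.isPGroup.addSubgroup w.range) ?_
  rw [heq]
  exact aleph0_le_layerCard hA.prime hA.isPGroup hA.reduced hA.unbounded m

theorem HasBasicRank.nontrivial (h : HasBasicRank p A κ) (hκ : 1 < κ) : Nontrivial A := by
  obtain ⟨B, hB⟩ := h.1
  rw [← h.2 B hB] at hκ
  have : Nontrivial B := one_lt_iff_nontrivial.mp (hκ.trans_le (rank_le_mk B))
  exact B.subtype_injective.nontrivial

theorem IsFinalProjection.isLowFin (hA : IsAdmissible p A) (hw : IsFinalProjection p w m) :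
    IsLowFin p w.ker w.range where
  compl := hw.isProjection.isCompl
  order_lt X Y hX hY := by
    rw [← hw.isProjection.range_compl] at hX
    obtain ⟨e, a, k, he, hew, rfl⟩ :=
      hX.exists_isCyclicProjection hA.prime hA.isPGroup hA.reduced hw.isProjection.compl
    obtain ⟨e', a', k', he', hew', rfl⟩ :=
      hY.exists_isCyclicProjection hA.prime hA.isPGroup hA.reduced hw.isProjection
    have hkm : k < m := he.lt_of_forall_pow_smul_eq_zero hew hw.pow_smul_sub_eq_zero
    have hmk' : m ≤ k' := he'.le_of_socleDivisible hew' hw.socleDivisible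
    rw [he.mk_range hA.prime, he'.mk_range hA.prime, ← not_le, natCast_pow_succ_le_iff hA.prime]
    exact (hkm.trans_le hmk').not_ge
  rank_eq := ⟨_, hA.hasFinalRank hw.layerCard_le, hw.hasBasicRank hA hw.isProjection⟩

theorem exists_forall_layerCard_le (p : ℕ) (A : Type u) [AddCommGroup A] :
    ∃ m, ∀ n, layerCard p m A ≤ layerCard p n A :=
  ⟨Function.argmin fun n => layerCard p n A,
    fun n => Function.argmin_le (fun n => layerCard p n A) n⟩

theorem IsAdmissible.exists_isFinalProjection (hA : IsAdmissible p A) :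
    ∃ (w : A →+ A) (m : ℕ), IsFinalProjection p w m := by
  obtain ⟨m, hm⟩ := exists_forall_layerCard_le p A
  obtain ⟨e, he, hk, hsoc⟩ := exists_bounded_projection hA.prime hA.isPGroup m
  refine ⟨AddMonoidHom.id A - e, m, ⟨fun x => by simpa using hk x, fun x hx hpx => hsoc x ?_ hpx⟩,
    he.compl, hm⟩
  simpa using hx

theorem IsLowFin.splitsAt (h : IsLowFin p w.ker w.range) (hp : p.Prime)
    (hA : IsAbelianPGroup p A) (hR : IsReducedGroup A) (hw : IsProjection w)
    (he : IsCyclicProjection p e a m) (hew : IsSubprojection e w) (hsoc : SocleDivisible p w m) :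
    SplitsAt p w m where
  pow_smul_sub_eq_zero := by
    by_contra! hne
    obtain ⟨k, e', a', hmk, he', hle⟩ :=
      exists_isCyclicProjection_of_pow_smul_ne_zero hp hA hR hw.compl hne
    have hlt := h.order_lt _ _ (hw.range_compl ▸ he'.isIndecSummand hp hA hw.compl hle)
      (he.isIndecSummand hp hA hw hew)
    rw [he.mk_range hp, he'.mk_range hp, ← not_le, natCast_pow_succ_le_iff hp] at hlt
    exact hlt hmk
  socleDivisible := hsoc

theorem IsAdmissible.exists_isFinalProjection_of_isLowFin (hA : IsAdmissible p A)
    (hw : IsProjection w) (h : IsLowFin p w.ker w.range) :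
    ∃ (e : A →+ A) (a : A) (m : ℕ),
      IsFinalProjection p w m ∧ IsCyclicProjection p e a m ∧ IsSubprojection e w := by
  obtain ⟨κ, hκ, hκ'⟩ := h.rank_eq
  obtain ⟨n₀, hn₀⟩ := exists_forall_layerCard_le p A
  obtain rfl := hκ.unique (hA.hasFinalRank hn₀)
  have hinf := aleph0_le_layerCard hA.prime hA.isPGroup hA.reduced hA.unbounded n₀
  have := hκ'.nontrivial (one_lt_aleph0.trans_le hinf)
  obtain ⟨⟨_, x, rfl⟩, hx⟩ := exists_ne (0 : w.range)
  obtain ⟨m, e, a, he, hew, hsoc⟩ := exists_isCyclicProjection_socleDivisible hA.prime hA.isPGroup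
    hA.reduced hw ⟨x, fun h0 => hx (Subtype.ext h0)⟩
  have hs := h.splitsAt hA.prime hA.isPGroup hA.reduced hw he hew hsoc
  refine ⟨e, a, m, ⟨hs, hw, fun n => ?_⟩, he, hew⟩
  rw [(hs.hasBasicRank hA hw).unique hκ']
  exact hn₀ n

theorem IsAdmissible.exists_pair_iff (hA : IsAdmissible p A) {A₁ A₂ : AddSubgroup A} :
    (∃ ξ₀ ε₀ : A ≃+ A, Pair ξ₀ ε₀ ∧ Final ξ₀ ε₀ ∧ pairCompl ξ₀ ε₀ = A₁ ∧ pairPart ξ₀ ε₀ = A₂) ↔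
      IsLowFin p A₁ A₂ := by
  constructor
  · rintro ⟨ξ, ε, hP, hF, rfl, rfl⟩
    obtain ⟨e, a, m, he, hε⟩ := hA.exists_isCyclicProjection_of_extreme hP.2.1
    obtain ⟨w, hξ, hew⟩ := hA.exists_isReflection_isSubprojection he hε hP.1 hP.2.2
    obtain ⟨hpart, hcompl⟩ := hA.pairPart_pairCompl_eq he hε hξ hew
    rw [hpart, hcompl]
    exact (hA.isFinalProjection_of_final he hε hξ hew hF).isLowFin hA
  · intro h
    obtain ⟨w, hw, rfl, rfl⟩ := exists_isProjection_of_isCompl h.compl.symm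
    obtain ⟨e, a, m, hwm, he, hew⟩ := hA.exists_isFinalProjection_of_isLowFin hw h
    have hε := isReflection_reflection he.isProjection
    have hξ := isReflection_reflection hw
    obtain ⟨hpart, hcompl⟩ := hA.pairPart_pairCompl_eq he hε hξ hew
    exact ⟨_, _, hA.pair he hε hξ hew, hwm.final hA he hε hξ hew, hcompl, hpart⟩

end Decomposition

section GroupTheory

variable {A : Type u} [AddCommGroup A]

/-- `x` lies in the center of `Aut A`. -/
def Central (x : A ≃+ A) : Prop := ∀ g : A ≃+ A, Commutes g x

/-- The group-theoretic description of extreme involutions: if `e` and `ξ` are commuting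
involutions, then modulo the center the only involutions in the double centralizer of `e` and `ξ`
are `1`, `e`, `ξ` and `e ξ`. -/
def GroupExtreme (e : A ≃+ A) : Prop :=
  (∀ a, e (e a) = a) ∧ ¬ Central e ∧
    ∀ ξ : A ≃+ A, (∀ a, ξ (ξ a) = a) → Commutes ξ e →
      ∀ x : A ≃+ A, (∀ a, x (x a) = a) →
        (∀ g : A ≃+ A, Commutes g e → Commutes g ξ → Commutes g x) →
        Central x ∨ Central (e.trans x) ∨ Central (ξ.trans x) ∨ Central ((e.trans ξ).trans x)

/-- For extreme involutions `a`, `b` commuting with `ξ`: the same one of the two summands of `ξ`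
contains `A_a` and `A_b`. -/
def SameSide (ξ a b : A ≃+ A) : Prop :=
  ∃ g : A ≃+ A, Commutes g ξ ∧ ¬ Commutes (conj g a) b

/-- For extreme involutions `a`, `b` which are equal or have independent cores:
`ord a ≤ ord b`. -/
def OrdLe (a b : A ≃+ A) : Prop :=
  ∀ u : A ≃+ A, (∀ g, Commutes g a → Commutes g u) →
    (∀ g, Commutes g (b.trans a) → Commutes g u) → Central u

/-- The group-theoretic description of `ByOrd`. -/
def GroupByOrd (ξ a : A ≃+ A) : Prop :=
  ∀ b : A ≃+ A, GroupExtreme b → Commutes b ξ → Commutes b a → (SameSide ξ a b ↔ OrdLe a b)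

/-- `b` is an extreme involution lying in both `(ξ₀, ε₀)` and `(ξ₁, ε₁)`, and compatible with the
decompositions given by `ξ₀` and `ξ₁`. -/
def LiesUpper (ξ₀ ε₀ ξ₁ ε₁ b : A ≃+ A) : Prop :=
  GroupExtreme b ∧ Commutes b ξ₀ ∧ Commutes b ξ₁ ∧ SameSide ξ₀ ε₀ b ∧ SameSide ξ₁ ε₁ b

/-- `b` is an extreme involution lying in `(ξ₀, ε₀)` and in the complement of `(ξ₁, ε₁)`, and
compatible with the decompositions given by `ξ₀` and `ξ₁`. -/
def LiesLower (ξ₀ ε₀ ξ₁ ε₁ b : A ≃+ A) : Prop :=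
  GroupExtreme b ∧ Commutes b ξ₀ ∧ Commutes b ξ₁ ∧ SameSide ξ₀ ε₀ b ∧ ¬ SameSide ξ₁ ε₁ b

/-- The group-theoretic substitute for `a ↦ b` under `f`: the conjugate of `a` by `f` lies in the
sum of `A_a` and `A_b` and is not independent of `b`. -/
def Couples (f a b : A ≃+ A) : Prop :=
  Commutes (conj f a) (b.trans a) ∧ ¬ Commutes (conj f a) b

/-- The group-theoretic description of the pairs with the property `Final`. -/
def GroupFinal (ξ₀ ε₀ : A ≃+ A) : Prop :=
  (∀ a, ξ₀ (ξ₀ a) = a) ∧ GroupExtreme ε₀ ∧ Commutes ξ₀ ε₀ ∧ GroupByOrd ξ₀ ε₀ ∧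
    ∀ ξ₁ ε₁ : A ≃+ A, (∀ a, ξ₁ (ξ₁ a) = a) → Commutes ξ₁ ξ₀ → LiesUpper ξ₀ ε₀ ξ₁ ε₁ ε₁ →
      (∀ b, LiesLower ξ₀ ε₀ ξ₁ ε₁ b → OrdLe b ε₁) →
      ∃ f : A ≃+ A, ∀ b, LiesLower ξ₀ ε₀ ξ₁ ε₁ b →
        ∃ a, LiesUpper ξ₀ ε₀ ξ₁ ε₁ a ∧ Couples f a b

end GroupTheory

section Center

variable {p : ℕ} {A : Type u} [AddCommGroup A] {ξ ε ε' : A ≃+ A} {w e e' f q y : A →+ A}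

theorem central_of_forall_eq_zsmul {t : ℤ} (h : ∀ b, ε b = t • b) : Central ε :=
  fun g b => by rw [h, h, map_zsmul]

theorem IsSubprojection.map_eq_of_corner (h : IsSubprojection q w) (hqf : ∀ b, q (f b) = f b)
    (hfq : ∀ b, f (q b) = f b) (b : A) : f (w b) = w (f b) := by
  rw [← hfq, h.2, hfq, ← hqf, h.1]

theorem IsOrthogonal.map_eq_of_corner (h : IsOrthogonal q w) (hqf : ∀ b, q (f b) = f b)
    (hfq : ∀ b, f (q b) = f b) (b : A) : f (w b) = w (f b) := by
  rw [← hfq, h.1, map_zero, ← hqf, h.2]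

namespace IsReflection

theorem commutes_unipotent_iff (h2 : Function.Injective fun x : A => 2 • x)
    (h : IsReflection ε e) (hff : ∀ a, f (f a) = 0) :
    Commutes (unipotent f hff) ε ↔ ∀ b, f (e b) = e (f b) := by
  simp only [h.commutes_iff h2, unipotent_apply, map_add, add_right_inj]

theorem trans_of_isOrthogonal (h : IsReflection ε e) (h' : IsReflection ε' e')
    (ho : IsOrthogonal e e') : IsReflection (ε'.trans ε) (e + e') := by
  have hproj : IsProjection (e + e') := fun b => by simp [h.1 b, h'.1 b, ho.1, ho.2]
  obtain ⟨-, h | h⟩ := h <;> obtain ⟨-, h' | h'⟩ := h'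
  · refine ⟨hproj, Or.inl fun b => ?_⟩
    rw [AddEquiv.trans_apply, h', h, map_sub, map_nsmul, ho.1, AddMonoidHom.add_apply]; abel
  · refine ⟨hproj, Or.inr fun b => ?_⟩
    rw [AddEquiv.trans_apply, h', h, map_sub, map_nsmul, ho.1, AddMonoidHom.add_apply]; abel
  · refine ⟨hproj, Or.inr fun b => ?_⟩
    rw [AddEquiv.trans_apply, h', h, map_sub, map_nsmul, ho.1, AddMonoidHom.add_apply]; abel
  · refine ⟨hproj, Or.inl fun b => ?_⟩
    rw [AddEquiv.trans_apply, h', h, map_sub, map_nsmul, ho.1, AddMonoidHom.add_apply]; abel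

theorem trans_of_isSubprojection (h : IsReflection ε e) (h' : IsReflection ξ w)
    (hew : IsSubprojection e w) : IsReflection (ξ.trans ε) (w - e) := by
  have hsum := (h.trans_of_isOrthogonal h'.compl
    (isSubprojection_compl_iff.mp (by rwa [sub_sub_cancel]))).compl
  rwa [sub_add_eq_sub_sub_swap, sub_sub_cancel] at hsum

theorem central_trans (h : IsReflection ε e) (h' : IsReflection ε' e) :
    Central (ε.trans ε') := by
  obtain ⟨-, h | h⟩ := (h'.trans_of_isSubprojection h ⟨h.1, h.1⟩)
  · exact central_of_forall_eq_zsmul (t := 1) fun b => by simp [h]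
  · exact central_of_forall_eq_zsmul (t := -1) fun b => by simp [h]

theorem central_or_central_trans {X : A ≃+ A} (h : IsReflection ε e) (h' : IsReflection ξ w)
    (hX : IsReflection X y) (hew : IsSubprojection e w) (hey : IsOrthogonal e y)
    (hinner : IsSubprojection (w - e) y ∨ IsOrthogonal (w - e) y)
    (houter : IsSubprojection (AddMonoidHom.id A - w) y ∨ IsOrthogonal (AddMonoidHom.id A - w) y) :
    Central X ∨ Central (ε.trans X) ∨ Central (ξ.trans X) ∨ Central ((ε.trans ξ).trans X) := by
  have hsum (b : A) : y b = y ((w - e) b) + y ((AddMonoidHom.id A - w) b) := by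
    simp [hey.2]
  rcases hinner with hin | hin <;> rcases houter with hout | hout
  · obtain rfl : y = AddMonoidHom.id A - e := AddMonoidHom.ext fun b => by
      rw [hsum, hin.1, hout.1]; simp
    exact Or.inr (Or.inl (h.central_trans (by simpa using hX.compl)))
  · obtain rfl : y = w - e := AddMonoidHom.ext fun b => by
      rw [hsum, hin.1, hout.2, add_zero]
    have hεξ := h'.compl.trans_of_isSubprojection h.compl
      (isSubprojection_compl_iff.mpr (isSubprojection_compl_iff.mp (by rwa [sub_sub_cancel])).symm)
    rw [sub_sub_sub_cancel_left] at hεξ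
    exact Or.inr (Or.inr (Or.inr (hεξ.central_trans hX)))
  · obtain rfl : y = AddMonoidHom.id A - w := AddMonoidHom.ext fun b => by
      rw [hsum, hin.2, hout.1, zero_add]
    exact Or.inr (Or.inr (Or.inl (h'.central_trans (by simpa using hX.compl))))
  · obtain rfl : y = 0 := AddMonoidHom.ext fun b => by
      rw [hsum, hin.2, hout.2, add_zero, AddMonoidHom.zero_apply]
    exact Or.inl (hX.central_trans (ε' := AddEquiv.refl A) ⟨hX.1, Or.inl fun b => by simp⟩)

theorem central_iff (hA : IsAdmissible p A) (h : IsReflection ε e) :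
    Central ε ↔ e = 0 ∨ e = AddMonoidHom.id A := by
  refine ⟨fun hcen => ?_, ?_⟩
  · by_contra! hne
    obtain ⟨x, hx⟩ := DFunLike.ne_iff.mp hne.1
    obtain ⟨x', hx'⟩ := DFunLike.ne_iff.mp hne.2
    obtain ⟨f, hef, hfe, y, hy⟩ := exists_hom_ne_zero hA.prime hA.isPGroup hA.reduced h.1 ⟨x, hx⟩
      h.1.compl ⟨x', sub_ne_zero.mpr hx'.symm⟩
    replace hef (b : A) : e (f b) = 0 := by simpa using hef b
    have hff (b : A) : f (f b) = 0 := by rw [← hfe, hef, map_zero]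
    have hcomm := (h.commutes_unipotent_iff hA.bijective_two_nsmul.injective hff).mp (hcen _) y
    exact hy (by rw [← hfe, hcomm, hef])
  · rintro (rfl | rfl)
    · exact h.central_trans (ε' := AddEquiv.refl A) ⟨h.1, Or.inl fun b => by simp⟩
    · exact h.central_trans (ε' := AddEquiv.refl A)
        ⟨h.1, Or.inr fun b => by simp [two_smul]⟩

theorem not_central (hA : IsAdmissible p A) (h : IsReflection ε e) (hew : IsSubprojection e w)
    (hne : e ≠ 0) (hne' : e ≠ w) : ¬ Central ε := by
  rw [h.central_iff hA]
  rintro (rfl | rfl)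
  · exact hne rfl
  · exact hne' (AddMonoidHom.ext hew.1).symm

end IsReflection

theorem isSubprojection_or_isOrthogonal_of_corner (hp : p.Prime) (hA : IsAbelianPGroup p A)
    (hR : IsReducedGroup A) (hq : IsProjection q) (hy : IsProjection y)
    (hqy : ∀ b, q (y b) = y (q b))
    (h : ∀ f : A →+ A, (∀ b, f (f b) = 0) → (∀ b, q (f b) = f b) → (∀ b, f (q b) = f b) →
      ∀ b, f (y b) = y (f b)) :
    IsSubprojection q y ∨ IsOrthogonal q y := by
  suffices hor : (∀ b, y (q b) = q b) ∨ ∀ b, y (q b) = 0 from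
    hor.imp (fun h => ⟨h, fun b => by rw [hqy, h]⟩) fun h => ⟨fun b => by rw [hqy, h], h⟩
  by_contra! hne
  obtain ⟨⟨x', hx'⟩, x, hx⟩ := hne
  have hyq : IsProjection (y.comp q) := fun b => by simp [hqy, hq b, hy (q b)]
  have hsub : IsSubprojection (y.comp q) q :=
    ⟨fun b => by simp [hqy, hq b], fun b => by simp [hq b]⟩
  obtain ⟨f, hf, hfy, z, hz⟩ := exists_hom_ne_zero hp hA hR hyq ⟨x, hx⟩
    (hsub.isProjection_sub hyq hq) ⟨x', sub_ne_zero.mpr hx'.symm⟩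
  have hyf (b : A) : y (f b) = 0 := by rw [← hf]; simp [hy (q (f b))]
  have hqf (b : A) : q (f b) = f b := by rw [← hf, (hsub.sub hq).1]
  have hfq (b : A) : f (q b) = f b := by rw [← hfy, hsub.2, hfy]
  have hff (b : A) : f (f b) = 0 := by
    rw [← hfy, AddMonoidHom.comp_apply, hqf, hyf, map_zero]
  apply hz
  rw [← hfy, AddMonoidHom.comp_apply, h f hff hqf hfq, hyf]

end Center

section Extreme

variable {p : ℕ} {A : Type u} [AddCommGroup A] {ε : A ≃+ A} {e : A →+ A} {a : A} {k : ℕ}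

theorem IsAdmissible.groupExtreme_of_extreme (hA : IsAdmissible p A) (hε : Extreme ε) :
    GroupExtreme ε := by
  have h2 := hA.bijective_two_nsmul.injective
  obtain ⟨e, a, k, hc, he⟩ := hA.exists_isCyclicProjection_of_extreme hε
  have hcore : ∀ {X : A ≃+ A}, (∀ a, X (X a) = a) → Commutes X ε →
      ∃ x, IsReflection X x ∧ IsSubprojection e x :=
    fun hX hXε => hA.exists_isReflection_isSubprojection hc he hX hXε
  refine ⟨he.apply_apply, fun hcen => ?_, fun ξ hξ hξε X hX hXcen => ?_⟩
  · obtain h0 | h1 := (he.central_iff hA).mp hcen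
    · exact hc.ne_zero (by rw [← hc.apply_self, h0, AddMonoidHom.zero_apply])
    · obtain ⟨x, hx⟩ := hA.exists_pow_smul_compl_ne_zero hc.pow_succ_smul_apply 0
      exact hx (by simp [h1])
  obtain ⟨w, hw, hew⟩ := hcore hξ hξε
  obtain ⟨x, hx, hex⟩ := hcore hX (hXcen ε (fun _ => rfl) hξε.symm).symm
  obtain ⟨y, hy, hey⟩ : ∃ y, IsReflection X y ∧ IsOrthogonal e y :=
    ⟨_, hx.compl, isSubprojection_compl_iff.mp (by rwa [sub_sub_cancel])⟩
  have hwy := (hw.commutes_iff_comm h2 hy).mp (hXcen ξ hξε (fun _ => rfl))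
  have hcorner {q : A →+ A} (hq : IsProjection q) (heq : IsOrthogonal q e)
      (hqy : ∀ b, q (y b) = y (q b))
      (hqw : ∀ f : A →+ A, (∀ b, q (f b) = f b) → (∀ b, f (q b) = f b) →
        ∀ b, f (w b) = w (f b)) : IsSubprojection q y ∨ IsOrthogonal q y :=
    isSubprojection_or_isOrthogonal_of_corner hA.prime hA.isPGroup hA.reduced hq hy.1 hqy
      fun f hff hqf hfq => (hy.commutes_unipotent_iff h2 hff).mp
        (hXcen _ ((he.commutes_unipotent_iff h2 hff).mpr (heq.map_eq_of_corner hqf hfq))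
          ((hw.commutes_unipotent_iff h2 hff).mpr (hqw f hqf hfq)))
  have hinner := hcorner (hew.isProjection_sub hc.isProjection hw.1)
    (hew.isOrthogonal_sub hc.isProjection).symm
    (fun b => by simp [hwy, hey.1, hey.2]) fun f => (hew.sub hw.1).map_eq_of_corner
  have houter := hcorner hw.1.compl
    (isSubprojection_compl_iff.mp (by rwa [sub_sub_cancel])).symm
    (fun b => by simp [hwy]) fun f =>
      (isSubprojection_compl_iff.mp ⟨hw.1.compl, hw.1.compl⟩).map_eq_of_corner
  exact he.central_or_central_trans hw hy hew hey hinner houter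

theorem IsCyclicProjection.hom_ne_zero (h : IsCyclicProjection p e a k) : e ≠ 0 := by
  rintro rfl
  exact h.ne_zero h.apply_self.symm

theorem IsReflection.not_groupExtreme (hA : IsAdmissible p A) {c c' : A →+ A}
    (h : IsReflection ε e) (hc : IsProjection c) (hc0 : c ≠ 0) (hce : IsSubprojection c e)
    (hne : c ≠ e) (hc' : IsProjection c') (hc'0 : c' ≠ 0)
    (hce' : IsSubprojection c' (AddMonoidHom.id A - e)) (hne' : c' ≠ AddMonoidHom.id A - e) :
    ¬ GroupExtreme ε := by
  rintro ⟨-, -, hdouble⟩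
  have h2 := hA.bijective_two_nsmul.injective
  have hortho : IsOrthogonal c c' :=
    (isSubprojection_compl_iff.mp hce').symm.mono hce ⟨hc', hc'⟩
  have hX := isReflection_reflection hc
  have hξ := hX.trans_of_isOrthogonal (isReflection_reflection hc') hortho
  have hec' (b : A) : e (c' b) = 0 := (isSubprojection_compl_iff.mp hce').2 b
  have hc'e (b : A) : c' (e b) = 0 := (isSubprojection_compl_iff.mp hce').1 b
  have hcorner (b : A) : c b = e ((c + c') b) := by simp [hce.1, hec']
  have hξX := hX.trans_of_isSubprojection hξ
    ⟨fun b => by simp [hc b, hortho.2], fun b => by simp [hc b, hortho.1]⟩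
  rw [add_sub_cancel_left] at hξX
  rcases hdouble _ hξ.apply_apply ((hξ.commutes_iff_comm h2 h).mpr fun b => by
      simp [hce.1, hce.2, hec', hc'e]) _ hX.apply_apply (fun g hge hgξ => by
      rw [h.commutes_iff h2] at hge
      rw [hξ.commutes_iff h2] at hgξ
      rw [hX.commutes_iff h2]
      intro b
      rw [hcorner, hge, hgξ, ← hcorner]) with hcen | hcen | hcen | hcen
  · exact hX.not_central hA hce hc0 hne hcen
  · exact (hX.trans_of_isSubprojection h hce).not_central hA (hce.sub h.1)
      (sub_ne_zero.mpr hne.symm) (fun h0 => hc0 (sub_eq_self.mp h0)) hcen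
  · exact hξX.not_central hA hce' hc'0 hne' hcen
  · exact (hξX.trans_of_isSubprojection h.compl hce').not_central hA (hce'.sub h.1.compl)
      (sub_ne_zero.mpr hne'.symm) (fun h0 => hc'0 (sub_eq_self.mp h0)) hcen

theorem IsAdmissible.extreme_of_groupExtreme (hA : IsAdmissible p A) (hε : GroupExtreme ε) :
    Extreme ε := by
  obtain ⟨e, he, hεe⟩ := exists_eq_sub_two_nsmul_projection hA.bijective_two_nsmul hε.1
  have hr : IsReflection ε e := ⟨he, Or.inl hεe⟩
  have hcen := hε.2.1
  rw [hr.central_iff hA, not_or] at hcen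
  obtain ⟨x, hx⟩ := DFunLike.ne_iff.mp hcen.1
  obtain ⟨x', hx'⟩ := DFunLike.ne_iff.mp hcen.2
  obtain ⟨k, c, a, hc, hce⟩ :=
    exists_isCyclicProjection_of_ne_zero hA.prime hA.isPGroup hA.reduced he ⟨x, hx⟩
  obtain ⟨k', c', a', hc', hce'⟩ := exists_isCyclicProjection_of_ne_zero hA.prime hA.isPGroup
    hA.reduced he.compl ⟨x', sub_ne_zero.mpr hx'.symm⟩
  by_contra hne
  refine hr.not_groupExtreme hA hc.isProjection hc.hom_ne_zero hce (fun h => hne ?_)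
    hc'.isProjection hc'.hom_ne_zero hce' (fun h => hne ?_) hε
  · exact hA.extreme hc (h ▸ hr)
  · exact hA.extreme hc' (h ▸ hr.compl)

end Extreme

section Sides

variable {p : ℕ} {A : Type u} [AddCommGroup A] {ξ ε ε' g : A ≃+ A} {w e e' f : A →+ A}
  {a a' : A} {k k' : ℕ}

theorem conjHom_eq_of_commutes (h : ∀ b, g (w b) = w (g b)) : conjHom g w = w := by
  ext b
  rw [conjHom_apply, h, AddEquiv.apply_symm_apply]

theorem IsSubprojection.conj (h : IsSubprojection e w) (g : A ≃+ A) :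
    IsSubprojection (conjHom g e) (conjHom g w) :=
  ⟨fun b => by simp [h.1], fun b => by simp [h.2]⟩

theorem conjHom_unipotent (hff : ∀ b, f (f b) = 0) (hef : ∀ b, e (f b) = 0)
    (hfe : ∀ b, f (e b) = f b) : conjHom (unipotent f hff) e = e + f := by
  ext b
  rw [conjHom_apply, unipotent_symm_apply, map_sub, hef, sub_zero, unipotent_apply, hfe,
    AddMonoidHom.add_apply]

theorem IsCyclicProjection.eq_or_isOrthogonal (hp : p.Prime) (h : IsCyclicProjection p e a k)
    (h' : IsCyclicProjection p e' a' k') (hc : ∀ b, e (e' b) = e' (e b)) :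
    e' = e ∨ IsOrthogonal e e' := by
  rcases h'.isSubprojection_or_isOrthogonal hp h.isProjection hc with h1 | h1
  · rcases h.isSubprojection_or_isOrthogonal hp h'.isProjection (fun b => (hc b).symm) with h2 | h2
    · left
      ext b
      rw [← h2.1, h1.2]
    · exact Or.inr h2
  · exact Or.inr h1.symm

theorem not_sameSide (h2 : Function.Injective fun x : A => 2 • x) (hξ : IsReflection ξ w)
    (hε : IsReflection ε e) (hε' : IsReflection ε' e') (hew : IsSubprojection e w)
    (ho : IsOrthogonal w e') : ¬ SameSide ξ ε ε' := by
  rintro ⟨g, hgξ, hn⟩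
  rw [hξ.commutes_iff h2] at hgξ
  have hconj := hew.conj g
  rw [conjHom_eq_of_commutes hgξ] at hconj
  have ho' : IsOrthogonal (conjHom g e) e' := ho.mono hconj ⟨hε'.1, hε'.1⟩
  exact hn (((hε.conj g).commutes_iff_comm h2 hε').mpr fun b => by rw [ho'.1, ho'.2])

theorem ne_of_sameSide (h2 : Function.Injective fun x : A => 2 • x) (hξ : IsReflection ξ w)
    (hε : IsReflection ε e) (hs : SameSide ξ ε ε) : e ≠ w := by
  rintro rfl
  obtain ⟨g, hgξ, hn⟩ := hs
  rw [hξ.commutes_iff h2] at hgξ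
  refine hn (((hε.conj g).commutes_iff_comm h2 hε).mpr fun b => ?_)
  rw [conjHom_eq_of_commutes hgξ]

theorem comm_add_of_not_sameSide (h2 : Function.Injective fun x : A => 2 • x)
    (hξ : IsReflection ξ w) (hε : IsReflection ε e) (hε' : IsReflection ε' e')
    (hew : IsSubprojection e w) (hs : ¬ SameSide ξ ε ε') (hf : ∀ b, (w - e) (f b) = f b)
    (hfe : ∀ b, f (e b) = f b) (b : A) : (e + f) (e' b) = e' ((e + f) b) := by
  have hef (b : A) : e (f b) = 0 := by rw [← hf, (hew.isOrthogonal_sub hε.1).1]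
  have hff (b : A) : f (f b) = 0 := by rw [← hfe, hef, map_zero]
  have hwf (b : A) : w (f b) = f b := by rw [← hf, (hew.sub hξ.1).1]
  have hfw (b : A) : f (w b) = f b := by rw [← hfe, hew.2, hfe]
  have hgξ : Commutes (unipotent f hff) ξ :=
    (hξ.commutes_unipotent_iff h2 hff).mpr fun b => by rw [hwf, hfw]
  have hconj : Commutes (conj (unipotent f hff) ε) ε' := by
    by_contra hn
    exact hs ⟨_, hgξ, hn⟩
  rw [← conjHom_unipotent hff hef hfe]
  exact ((hε.conj _).commutes_iff_comm h2 hε').mp hconj b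

namespace IsAdmissible

theorem sameSide (hA : IsAdmissible p A) (hξ : IsReflection ξ w) (h : IsCyclicProjection p e a k)
    (hε : IsReflection ε e) (h' : IsCyclicProjection p e' a' k') (hε' : IsReflection ε' e')
    (hew : IsSubprojection e w) (he'w : IsSubprojection e' w) (hne : e ≠ w) :
    SameSide ξ ε ε' := by
  by_contra hs
  have hcomm {f : A →+ A} := comm_add_of_not_sameSide (f := f)
    hA.bijective_two_nsmul.injective hξ hε hε' hew hs
  have hee' (b : A) : e (e' b) = e' (e b) := by
    simpa using hcomm (f := 0) (by simp) (by simp) b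
  have hfe' {f : A →+ A} (hf : ∀ b, (w - e) (f b) = f b) (hfe : ∀ b, f (e b) = f b) (b : A) :
      f (e' b) = e' (f b) := by
    simpa [hee'] using hcomm hf hfe b
  have hea : ∃ x, e x ≠ 0 := ⟨a, by rw [h.apply_self]; exact h.ne_zero⟩
  rcases h.eq_or_isOrthogonal hA.prime h' hee' with rfl | ho
  · obtain ⟨x, hx⟩ := DFunLike.ne_iff.mp hne.symm
    obtain ⟨f, hf, hfe, y, hy⟩ := exists_hom_ne_zero hA.prime hA.isPGroup hA.reduced hε.1 hea
      (hew.isProjection_sub hε.1 hξ.1) ⟨x, sub_ne_zero.mpr hx⟩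
    exact hy (by rw [← hfe, hfe' hf hfe, ← hf, (hew.isOrthogonal_sub hε.1).1])
  · obtain ⟨f, hf, hfe, y, hy⟩ := exists_hom_ne_zero hA.prime hA.isPGroup hA.reduced hε.1 hea
      hε'.1 ⟨a', by rw [h'.apply_self]; exact h'.ne_zero⟩
    have hwf (b : A) : (w - e) (f b) = f b := by
      rw [← hf, AddMonoidHom.sub_apply, he'w.1, ho.1, sub_zero]
    exact hy (by rw [← hf, ← hfe' hwf hfe, ← hfe, ho.1, map_zero])

theorem commutes_and_sameSide_iff (hA : IsAdmissible p A) (hξ : IsReflection ξ w)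
    (h : IsCyclicProjection p e a k) (hε : IsReflection ε e) (h' : IsCyclicProjection p e' a' k')
    (hε' : IsReflection ε' e') (hew : IsSubprojection e w) (hne : e ≠ w) :
    Commutes ε' ξ ∧ SameSide ξ ε ε' ↔ IsSubprojection e' w := by
  have h2 := hA.bijective_two_nsmul.injective
  refine ⟨fun ⟨hc, hs⟩ => ?_, fun hle => ⟨(hε'.commutes_iff_comm h2 hξ).mpr fun b => by
    rw [hle.1, hle.2], hA.sameSide hξ h hε h' hε' hew hle hne⟩⟩
  exact (h'.isSubprojection_or_isOrthogonal hA.prime hξ.1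
    ((hξ.commutes_iff_comm h2 hε').mp hc.symm)).resolve_right
      fun ho => not_sameSide h2 hξ hε hε' hew ho.symm hs

theorem commutes_and_not_sameSide_iff (hA : IsAdmissible p A) (hξ : IsReflection ξ w)
    (h : IsCyclicProjection p e a k) (hε : IsReflection ε e) (h' : IsCyclicProjection p e' a' k')
    (hε' : IsReflection ε' e') (hew : IsSubprojection e w) (hne : e ≠ w) :
    Commutes ε' ξ ∧ ¬ SameSide ξ ε ε' ↔ IsOrthogonal w e' := by
  have h2 := hA.bijective_two_nsmul.injective
  refine ⟨fun ⟨hc, hs⟩ => ?_, fun ho => ⟨(hε'.commutes_iff_comm h2 hξ).mpr fun b => by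
    rw [ho.1, ho.2], not_sameSide h2 hξ hε hε' hew ho⟩⟩
  exact ((h'.isSubprojection_or_isOrthogonal hA.prime hξ.1
    ((hξ.commutes_iff_comm h2 hε').mp hc.symm)).resolve_left
      fun hle => hs (hA.sameSide hξ h hε h' hε' hew hle hne)).symm

theorem groupExtreme (hA : IsAdmissible p A) (h : IsCyclicProjection p e a k)
    (hε : IsReflection ε e) : GroupExtreme ε :=
  hA.groupExtreme_of_extreme (hA.extreme h hε)

theorem exists_isCyclicProjection_of_groupExtreme (hA : IsAdmissible p A) (hε : GroupExtreme ε) :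
    ∃ (e : A →+ A) (a : A) (k : ℕ), IsCyclicProjection p e a k ∧ IsReflection ε e :=
  hA.exists_isCyclicProjection_of_extreme (hA.extreme_of_groupExtreme hε)

end IsAdmissible

end Sides

section Orders

variable {p : ℕ} {A : Type u} [AddCommGroup A] {ξ ε ε' u : A ≃+ A} {w e e' f : A →+ A}
  {a a' : A} {k k' m n : ℕ}

theorem commutes_unipotent_iff (hff : ∀ b, f (f b) = 0) :
    Commutes (unipotent f hff) u ↔ ∀ b, f (u b) = u (f b) := by
  simp only [Commutes, unipotent_apply, map_add, add_right_inj]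

theorem IsReflection.ordLe (hε : IsReflection ε e) (hε' : IsReflection ε' e) : OrdLe ε ε' :=
  fun _ _ hu g => hu g (hε'.central_trans hε g)

theorem IsAdmissible.exists_isCyclicProjection_isOrthogonal (hA : IsAdmissible p A)
    (he : IsProjection e) (hb : ∀ x, p ^ n • e x = 0) (N : ℕ) :
    ∃ (K : ℕ) (c : A →+ A) (z : A), N ≤ K ∧ IsCyclicProjection p c z K ∧ IsOrthogonal c e := by
  obtain ⟨K, c, z, hK, hc, hce⟩ := exists_isCyclicProjection_of_pow_smul_ne_zero hA.prime
    hA.isPGroup hA.reduced he.compl (hA.exists_pow_smul_compl_ne_zero hb N)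
  exact ⟨K, c, z, hK, hc, isSubprojection_compl_iff.mp hce⟩

theorem IsAdmissible.exists_zsmul_eq_of_forall_commutes (hA : IsAdmissible p A)
    (hε : IsReflection ε e) (hb : ∀ x, p ^ n • e x = 0)
    (hu : ∀ g, Commutes g ε → Commutes g u) (N : ℕ) :
    ∃ s : ℤ, ∀ y, e y = 0 → p ^ N • y = 0 → u y = s • y := by
  have h2 := hA.bijective_two_nsmul.injective
  obtain ⟨K, c, z, hK, hc, hce⟩ := hA.exists_isCyclicProjection_isOrthogonal hε.1 hb N
  have huc (b : A) : u (c b) = c (u b) :=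
    ((isReflection_reflection hc.isProjection).commutes_iff h2).mp
      (hu _ (((isReflection_reflection hc.isProjection).commutes_iff_comm h2 hε).mpr fun b => by
        rw [hce.1, hce.2])).symm b
  obtain ⟨s, hs⟩ := hc.exists_eq_zsmul (u z)
  rw [← huc, hc.apply_self] at hs
  refine ⟨s, fun y hy hNy => ?_⟩
  have hcy : u (c y) = s • c y := by
    obtain ⟨t, ht⟩ := hc.exists_eq_zsmul y
    rw [ht, map_zsmul, hs, smul_comm]
  -- A homomorphism sending the generator `z` to `y - c y` carries the eigenvalue `s` over.
  have hrest : u (y - c y) = s • (y - c y) := by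
    obtain ⟨f, hfz, hfc, hf⟩ := hc.exists_hom hA.prime (y := y - c y) (by
      refine pow_smul_eq_zero_of_le (hK.trans K.le_succ) ?_
      rw [smul_sub, ← map_nsmul c, hNy, map_zero, sub_zero])
    have hcf (b : A) : c (f b) = 0 := by
      obtain ⟨t, ht⟩ := hf b
      rw [ht, map_zsmul, map_sub, hc.isProjection, sub_self, smul_zero]
    have hef (b : A) : e (f b) = 0 := by
      obtain ⟨t, ht⟩ := hf b
      rw [ht, map_zsmul, map_sub, hy, hce.2, sub_zero, smul_zero]
    have hfe (b : A) : f (e b) = 0 := by rw [← hfc, hce.1, map_zero]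
    have hff (b : A) : f (f b) = 0 := by rw [← hfc, hcf, map_zero]
    have hfu := (commutes_unipotent_iff hff).mp
      (hu _ ((hε.commutes_unipotent_iff h2 hff).mpr fun b => by rw [hef, hfe])) z
    rw [← hfz, ← hfu, hs, map_zsmul]
  rw [← add_sub_cancel (c y) y, map_add, hcy, hrest, smul_add]

theorem IsAdmissible.ordLe_of_le (hA : IsAdmissible p A) (h : IsCyclicProjection p e a k)
    (hε : IsReflection ε e) (h' : IsCyclicProjection p e' a' k') (hε' : IsReflection ε' e')
    (ho : IsOrthogonal e e') (hk : k ≤ k') : OrdLe ε ε' := by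
  intro u hu hu'
  have hscalar (N : ℕ) : ∃ s : ℤ, ∀ x, p ^ N • x = 0 → u x = s • x := by
    obtain ⟨s, hs⟩ := hA.exists_zsmul_eq_of_forall_commutes hε h.pow_succ_smul_apply hu
      (N + (k' + 1))
    have hua' : u a' = s • a' := hs a' (by rw [← h'.apply_self, ho.1])
      (pow_smul_eq_zero_of_le (Nat.le_add_left _ _) h'.pow_succ_smul)
    have hua : u a = s • a := by
      obtain ⟨f, hfa, hfe', hf⟩ := h'.exists_hom hA.prime (y := a)
        (pow_smul_eq_zero_of_le (Nat.succ_le_succ hk) h.pow_succ_smul)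
      have hef (b : A) : e (f b) = f b := by
        obtain ⟨t, ht⟩ := hf b
        rw [ht, map_zsmul, h.apply_self]
      have he'f (b : A) : e' (f b) = 0 := by rw [← hef, ho.2]
      have hfe (b : A) : f (e b) = 0 := by rw [← hfe', ho.2, map_zero]
      have hff (b : A) : f (f b) = 0 := by rw [← hfe', he'f, map_zero]
      have hfu := (commutes_unipotent_iff hff).mp (hu' _
        (((hε.trans_of_isOrthogonal hε' ho).commutes_unipotent_iff
          hA.bijective_two_nsmul.injective hff).mpr fun b => by simp [hef, he'f, hfe, hfe'])) a'
      rw [← hfa, ← hfu, hua', map_zsmul]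
    refine ⟨s, fun x hx => ?_⟩
    have hux : u (e x) = s • e x := by
      obtain ⟨t, ht⟩ := h.exists_eq_zsmul x
      rw [ht, map_zsmul, hua, smul_comm]
    have hrest : u (x - e x) = s • (x - e x) :=
      hs _ (by rw [map_sub, h.isProjection, sub_self]) (pow_smul_eq_zero_of_le
        (Nat.le_add_right N _) (by rw [smul_sub, ← map_nsmul, hx, map_zero, sub_zero]))
    rw [← add_sub_cancel (e x) x, map_add, hux, hrest, smul_add]
  intro g x
  obtain ⟨N, hN⟩ := hA.isPGroup x
  obtain ⟨s, hs⟩ := hscalar N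
  rw [hs x hN, hs (g x) (by rw [← map_nsmul, hN, map_zero]), map_zsmul]

theorem IsProjection.exists_addEquiv_eq_add_pow_smul (he : IsProjection e)
    (hb : ∀ x, p ^ n • e x = 0) (m : ℕ) : ∃ u : A ≃+ A, ∀ b, u b = b + p ^ (m + 1) • e b := by
  let q : AddMonoid.End A := e
  have hidem : IsIdempotentElem q := AddMonoidHom.ext he
  have hnil : IsNilpotent (p ^ (m + 1) • q) := by
    refine ⟨n + 1, ?_⟩
    rw [smul_pow, hidem.pow_succ_eq]
    ext b
    change (p ^ (m + 1)) ^ (n + 1) • e b = 0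
    rw [← pow_mul]
    exact pow_smul_eq_zero_of_le (by nlinarith) (hb b)
  obtain ⟨U, hU⟩ := hnil.isUnit_one_add
  exact ⟨DistribMulAction.toAddEquiv A U, fun b => DFunLike.congr_fun hU b⟩

theorem IsAdmissible.le_of_ordLe (hA : IsAdmissible p A) (h : IsCyclicProjection p e a k)
    (hε : IsReflection ε e) (h' : IsCyclicProjection p e' a' k') (hε' : IsReflection ε' e')
    (ho : IsOrthogonal e e') (hle : OrdLe ε ε') : k ≤ k' := by
  by_contra! hlt
  have h2 := hA.bijective_two_nsmul.injective
  obtain ⟨u, hu⟩ := h.isProjection.exists_addEquiv_eq_add_pow_smul h.pow_succ_smul_apply k'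
  -- As `p ^ (k' + 1)` kills the range of `e'`, also `u = 1 + p ^ (k' + 1) (e + e')`.
  have hu' (b : A) : u b = b + p ^ (k' + 1) • (e + e') b := by
    rw [hu, AddMonoidHom.add_apply, smul_add, h'.pow_succ_smul_apply, add_zero]
  have hcen : Central u := hle u
    (fun g hg b => by
      rw [hε.commutes_iff h2] at hg
      rw [hu, hu, map_add, map_nsmul, hg])
    (fun g hg b => by
      rw [(hε.trans_of_isOrthogonal hε' ho).commutes_iff h2] at hg
      rw [hu', hu', map_add, map_nsmul, hg])
  obtain ⟨K, c, z, hK, hc, hce⟩ :=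
    hA.exists_isCyclicProjection_isOrthogonal h.isProjection h.pow_succ_smul_apply k
  obtain ⟨f, hfa, hfe, hf⟩ := h.exists_hom hA.prime (y := p ^ (K - k) • z) (by
    rw [← mul_smul, ← pow_add]
    exact pow_smul_eq_zero_of_le (by omega) hc.pow_succ_smul)
  have hez : e z = 0 := by rw [← hc.apply_self, hce.2]
  have hef (b : A) : e (f b) = 0 := by
    obtain ⟨t, ht⟩ := hf b
    rw [ht, map_zsmul, map_nsmul, hez, smul_zero, smul_zero]
  have hff (b : A) : f (f b) = 0 := by rw [← hfe, hef, map_zero]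
  have hfu := (commutes_unipotent_iff hff).mp (hcen (unipotent f hff)) a
  have hzero : p ^ (k' + 1) • p ^ (K - k) • z = 0 := by
    rwa [hu, hu, h.apply_self, map_add, map_nsmul, hef, smul_zero, hfa, add_right_inj] at hfu
  rw [← mul_smul, ← pow_add] at hzero
  exact hc.pow_smul_ne_zero (pow_smul_eq_zero_of_le (by omega) hzero)

theorem IsAdmissible.ordLe_iff (hA : IsAdmissible p A) (h : IsCyclicProjection p e a k)
    (hε : IsReflection ε e) (h' : IsCyclicProjection p e' a' k') (hε' : IsReflection ε' e')
    (ho : IsOrthogonal e e') : OrdLe ε ε' ↔ k ≤ k' :=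
  ⟨hA.le_of_ordLe h hε h' hε' ho, hA.ordLe_of_le h hε h' hε' ho⟩

theorem IsAdmissible.ne_of_splitsAt (hA : IsAdmissible p A) (h : IsCyclicProjection p e a k)
    (hw : SplitsAt p w m) : e ≠ w := by
  rintro rfl
  obtain ⟨x, hx⟩ := hA.exists_pow_smul_compl_ne_zero h.pow_succ_smul_apply m
  exact hx (hw.pow_smul_sub_eq_zero x)

theorem IsAdmissible.groupByOrd_iff (hA : IsAdmissible p A) (h : IsCyclicProjection p e a m)
    (hε : IsReflection ε e) (hξ : IsReflection ξ w) (hew : IsSubprojection e w) :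
    GroupByOrd ξ ε ↔ SplitsAt p w m := by
  have h2 := hA.bijective_two_nsmul.injective
  refine ⟨fun hB => ?_, fun hs ε' hε' hcξ hcε => ?_⟩
  · have hne : e ≠ w := ne_of_sameSide h2 hξ hε ((hB ε (hA.groupExtreme h hε)
      ((hε.commutes_iff_comm h2 hξ).mpr fun b => by rw [hew.1, hew.2]) (fun _ => rfl)).mpr
        (hε.ordLe hε))
    refine splitsAt_of_forall hA.prime hA.isPGroup hA.reduced hξ.1 h hew
      fun {e' a' k} h' ho hwe' => ?_
    have hε' := isReflection_reflection h'.isProjection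
    have hcξ := (hε'.commutes_iff_comm h2 hξ).mpr fun b => (hwe' b).symm
    rw [← hA.ordLe_iff h hε h' hε' ho, ← hB _ (hA.groupExtreme h' hε') hcξ
      ((hε'.commutes_iff_comm h2 hε).mpr fun b => by rw [ho.1, ho.2]),
      ← hA.commutes_and_sameSide_iff hξ h hε h' hε' hew hne, and_iff_right hcξ]
  · obtain ⟨e', a', k, h', hε'⟩ := hA.exists_isCyclicProjection_of_groupExtreme hε'
    have hne : e ≠ w := hA.ne_of_splitsAt h hs
    have hwe' := (hξ.commutes_iff_comm h2 hε').mp hcξ.symm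
    rw [← and_iff_right hcξ (b := SameSide ξ ε ε'),
      hA.commutes_and_sameSide_iff hξ h hε h' hε' hew hne]
    rcases h.eq_or_isOrthogonal hA.prime h' ((hε.commutes_iff_comm h2 hε').mp hcε.symm)
      with rfl | ho
    · exact iff_of_true hew (hε.ordLe hε')
    · rw [hA.ordLe_iff h hε h' hε' ho, hs.isSubprojection_iff hA.prime hξ.1 h' hwe']

end Orders

section Coupling

variable {p : ℕ} {A : Type u} [AddCommGroup A] {ξ ξ₁ ε ε₁ ε' f : A ≃+ A}
  {w v e e₁ b c h π δ : A →+ A} {a a₁ d x : A} {m k l j : ℕ}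

theorem couples_unipotent (h2 : Function.Injective fun y : A => 2 • y) (hh : ∀ y, h (h y) = 0)
    (hc : IsCyclicProjection p e x j) (hε : IsReflection ε e) (hb : IsCyclicProjection p b d l)
    (hε' : IsReflection ε' b) (heb : IsOrthogonal e b) (hhx : h x = d)
    (heh : ∀ y, e (h y) = 0) : Couples (unipotent h hh) ε ε' := by
  have hconj (y : A) : conjHom (unipotent h hh) e y = e y + h (e y) := by
    rw [conjHom_apply, unipotent_apply, unipotent_symm_apply, map_sub, heh, sub_zero]
  have hbh (y : A) : b (h (e y)) = h (e y) := by
    obtain ⟨t, ht⟩ := hc.exists_eq_zsmul y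
    rw [ht, map_zsmul, hhx, map_zsmul, hb.apply_self]
  constructor
  · rw [(hε.conj _).commutes_iff_comm h2 (hε.trans_of_isOrthogonal hε' heb)]
    intro y
    simp only [hconj, AddMonoidHom.add_apply, map_add, hc.isProjection y, heb.1, heh, heb.2, hbh,
      map_zero]
    abel
  · rw [(hε.conj _).commutes_iff_comm h2 hε']
    intro hcomm
    have hd := hcomm x
    rw [hconj, hconj, heb.1, map_zero, add_zero, map_add, heb.2, hbh, hc.apply_self, hhx,
      zero_add] at hd
    exact hb.ne_zero hd.symm

theorem IsDetached.apply_apply_eq_zero (hd : IsDetached p f π δ b d)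
    (hc : IsCyclicProjection p e x j) (hb : IsCyclicProjection p b d l)
    (heπ : IsSubprojection e π) (hbδ : IsSubprojection b δ) (hπδ : IsOrthogonal π δ)
    (hsub : IsSubprojection (conjHom f e) (e + b)) : b (f x) = 0 := by
  have hfx : e (f x) + b (f x) = f x := by
    have := hsub.1 (f x)
    rwa [(hc.conj f).apply_self] at this
  obtain ⟨t, ht⟩ := hb.exists_eq_zsmul (f x)
  have hπx : π x = x := by rw [← hc.apply_self, heπ.1]
  have hδf := congrArg δ hfx
  rw [map_add, hbδ.1, ← heπ.1, hπδ.2, zero_add] at hδf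
  rw [ht]
  exact hd.zsmul_eq_zero t x (by rw [← ht, hπx, hδf])

theorem IsDetached.conjHom_apply_eq_zero (hd : IsDetached p f π δ b d)
    (hc : IsCyclicProjection p e x j) (heπ : IsSubprojection e π) (hπδ : IsOrthogonal π δ)
    (hsub : IsSubprojection (conjHom f e) (e + b)) : conjHom f e d = 0 := by
  obtain ⟨v, hδv, hbv, z, hz⟩ := hd.exists_lift (j + 1)
  have hev : e v = 0 := by rw [← heπ.2, ← hδv, hπδ.1, map_zero]
  have hv := hsub.2 v
  rw [AddMonoidHom.add_apply, hev, zero_add, hbv] at hv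
  rw [hv, conjHom_apply, ← heπ.2, hz, map_nsmul, hc.pow_succ_smul_apply, map_zero]

theorem IsDetached.not_couples (hd : IsDetached p f π δ b d) (hA : IsAdmissible p A)
    (hc : IsCyclicProjection p e x j) (hε : IsReflection ε e) (hb : IsCyclicProjection p b d l)
    (hε' : IsReflection ε' b) (heπ : IsSubprojection e π) (hbδ : IsSubprojection b δ)
    (hπδ : IsOrthogonal π δ) : ¬ Couples f ε ε' := by
  rintro ⟨hsum, hnot⟩
  have h2 := hA.bijective_two_nsmul.injective
  have heb : IsOrthogonal e b := hπδ.mono heπ hbδ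
  have hreflection := hε.trans_of_isOrthogonal hε' heb
  have hbsub : IsSubprojection b (e + b) :=
    ⟨fun y => by simp [heb.1, hb.isProjection y], fun y => by simp [heb.2, hb.isProjection y]⟩
  rw [(hε.conj f).commutes_iff_comm h2 hreflection] at hsum
  rw [(hε.conj f).commutes_iff_comm h2 hε'] at hnot
  apply hnot
  rcases (hc.conj f).isSubprojection_or_isOrthogonal hA.prime hreflection.1
    (fun y => (hsum y).symm) with hsub | ho
  · have hbfx := hd.apply_apply_eq_zero hc hb heπ hbδ hπδ hsub
    have hfed := hd.conjHom_apply_eq_zero hc heπ hπδ hsub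
    intro y
    obtain ⟨t, ht⟩ := hb.exists_eq_zsmul y
    obtain ⟨s, hs⟩ := (hc.conj f).exists_eq_zsmul y
    rw [ht, map_zsmul, hfed, hs, map_zsmul, hbfx, smul_zero, smul_zero]
  · have hbo := ho.mono ⟨(hε.conj f).1, (hε.conj f).1⟩ hbsub
    exact fun y => by rw [hbo.1, hbo.2]

section Lies

variable {η : A ≃+ A} {y : A}

theorem IsAdmissible.liesUpper_iff (hA : IsAdmissible p A) (h : IsCyclicProjection p e a m)
    (hε : IsReflection ε e) (hξ : IsReflection ξ w) (hew : IsSubprojection e w) (hne : e ≠ w)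
    (h₁ : IsCyclicProjection p e₁ a₁ k) (hε₁ : IsReflection ε₁ e₁) (hξ₁ : IsReflection ξ₁ v)
    (hev : IsSubprojection e₁ v) (hne₁ : e₁ ≠ v) (hc : IsCyclicProjection p c y j)
    (hη : IsReflection η c) :
    LiesUpper ξ ε ξ₁ ε₁ η ↔ IsSubprojection c w ∧ IsSubprojection c v := by
  rw [← hA.commutes_and_sameSide_iff hξ h hε hc hη hew hne,
    ← hA.commutes_and_sameSide_iff hξ₁ h₁ hε₁ hc hη hev hne₁]
  have hext := hA.groupExtreme hc hη
  unfold LiesUpper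
  tauto

theorem IsAdmissible.liesLower_iff (hA : IsAdmissible p A) (h : IsCyclicProjection p e a m)
    (hε : IsReflection ε e) (hξ : IsReflection ξ w) (hew : IsSubprojection e w) (hne : e ≠ w)
    (h₁ : IsCyclicProjection p e₁ a₁ k) (hε₁ : IsReflection ε₁ e₁) (hξ₁ : IsReflection ξ₁ v)
    (hev : IsSubprojection e₁ v) (hne₁ : e₁ ≠ v) (hc : IsCyclicProjection p c y j)
    (hη : IsReflection η c) :
    LiesLower ξ ε ξ₁ ε₁ η ↔ IsSubprojection c w ∧ IsOrthogonal v c := by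
  rw [← hA.commutes_and_sameSide_iff hξ h hε hc hη hew hne,
    ← hA.commutes_and_not_sameSide_iff hξ₁ h₁ hε₁ hc hη hev hne₁]
  have hext := hA.groupExtreme hc hη
  unfold LiesLower
  tauto

theorem IsAdmissible.pow_smul_sub_eq_zero_of_forall_ordLe (hA : IsAdmissible p A)
    (h : IsCyclicProjection p e a m) (hε : IsReflection ε e) (hξ : IsReflection ξ w)
    (hew : IsSubprojection e w) (hne : e ≠ w) (h₁ : IsCyclicProjection p e₁ a₁ k)
    (hε₁ : IsReflection ε₁ e₁) (hξ₁ : IsReflection ξ₁ v) (hev : IsSubprojection e₁ v)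
    (hne₁ : e₁ ≠ v) (hvw : ∀ x, v (w x) = w (v x))
    (hlow : ∀ b, LiesLower ξ ε ξ₁ ε₁ b → OrdLe b ε₁) (x : A) :
    p ^ (k + 1) • (w - v.comp w) x = 0 := by
  have hπ : IsProjection (v.comp w) := fun y => by
    simp [← hvw, hξ₁.1 (w y), hξ.1 y]
  have hπw : IsSubprojection (v.comp w) w :=
    ⟨fun y => by simp [← hvw, hξ.1 y], fun y => by simp [hξ.1 y]⟩
  have hvδ : IsOrthogonal v (w - v.comp w) :=
    ⟨fun y => by simp [hξ₁.1 (w y)], fun y => by simp [← hvw, hξ₁.1 (w y)]⟩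
  by_contra hx
  obtain ⟨j, c, y, hj, hc, hcδ⟩ := exists_isCyclicProjection_of_pow_smul_ne_zero hA.prime
    hA.isPGroup hA.reduced (hπw.isProjection_sub hπ hξ.1) ⟨x, hx⟩
  have hη := isReflection_reflection hc.isProjection
  have hle := hlow _ ((hA.liesLower_iff h hε hξ hew hne h₁ hε₁ hξ₁ hev hne₁ hc hη).mpr
    ⟨hcδ.trans (hπw.sub hξ.1), hvδ.mono ⟨hξ₁.1, hξ₁.1⟩ hcδ⟩)
  have := hA.le_of_ordLe hc hη h₁ hε₁ (hvδ.mono hev hcδ).symm hle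
  omega

end Lies

theorem IsFinalProjection.exists_forall_couples (hA : IsAdmissible p A)
    (hw : IsFinalProjection p w m) (hv : IsProjection v) (hvw : ∀ y, v (w y) = w (v y))
    (hk : ∀ y, p ^ k • (w - v.comp w) y = 0) :
    ∃ f : A ≃+ A, ∀ {η : A ≃+ A} {b : A →+ A} {d : A} {l : ℕ}, IsCyclicProjection p b d l →
      IsReflection η b → IsSubprojection b w → IsOrthogonal v b →
      ∃ (c : A →+ A) (x : A) (j : ℕ) (hc : IsCyclicProjection p c x j), IsSubprojection c w ∧
        IsSubprojection c v ∧ Couples f (reflection c hc.isProjection) η := by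
  have hπ : IsProjection (v.comp w) := fun y => by simp [← hvw, hv (w y), hw.isProjection y]
  have hπw : IsSubprojection (v.comp w) w :=
    ⟨fun y => by simp [← hvw, hw.isProjection y], fun y => by simp [hw.isProjection y]⟩
  have hπv : IsSubprojection (v.comp w) v :=
    ⟨fun y => by simp [hv (w y)], fun y => by simp [← hvw, hv (w y)]⟩
  obtain ⟨φ, hφδ, hφπ, hφ⟩ := hw.exists_hom_surjective hA hπ hπw hk
  have hvφ (y : A) : v (φ y) = 0 := by
    rw [← hφδ]
    simp [hv (w (φ y))]
  have hφφ (y : A) : φ (φ y) = 0 := by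
    rw [← hφπ, AddMonoidHom.comp_apply, hvw, hvφ, map_zero, map_zero]
  refine ⟨unipotent φ hφφ, fun {η b d l} hb hη hbw hvb => ?_⟩
  obtain ⟨x, c, j, hc, hcπ, hx⟩ := hφ d (by
    rw [← hb.apply_self, AddMonoidHom.sub_apply, AddMonoidHom.comp_apply, hbw.1, hvb.1, sub_zero])
  have hcv := hcπ.trans hπv
  exact ⟨c, x, j, hc, hcπ.trans hπw, hcv,
    couples_unipotent hA.bijective_two_nsmul.injective hφφ hc (isReflection_reflection _) hb hη
      (hvb.mono hcv ⟨hb.isProjection, hb.isProjection⟩) hx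
      fun y => by rw [← hcv.2, hvφ, map_zero]⟩

theorem IsFinalProjection.groupFinal (hA : IsAdmissible p A) (h : IsCyclicProjection p e a m)
    (hε : IsReflection ε e) (hξ : IsReflection ξ w) (hew : IsSubprojection e w)
    (hw : IsFinalProjection p w m) : GroupFinal ξ ε := by
  have h2 := hA.bijective_two_nsmul.injective
  obtain ⟨hinv, hext, hcomm⟩ := hA.pair h hε hξ hew
  refine ⟨hinv, hA.groupExtreme_of_extreme hext, hcomm,
    (hA.groupByOrd_iff h hε hξ hew).mpr hw.toSplitsAt, fun ξ₁ ε₁ hinv₁ hξξ₁ hup hlow => ?_⟩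
  obtain ⟨hext₁, -, hcomm₁, -, hsame₁⟩ := hup
  obtain ⟨e₁, a₁, k, h₁, hε₁⟩ := hA.exists_isCyclicProjection_of_groupExtreme hext₁
  obtain ⟨v, hξ₁, hev⟩ := hA.exists_isReflection_isSubprojection h₁ hε₁ hinv₁ hcomm₁.symm
  have hne := hA.ne_of_splitsAt h hw.toSplitsAt
  have hne₁ := ne_of_sameSide h2 hξ₁ hε₁ hsame₁
  have hvw : ∀ y, v (w y) = w (v y) := (hξ₁.commutes_iff_comm h2 hξ).mp hξξ₁
  obtain ⟨f, hf⟩ := hw.exists_forall_couples hA hξ₁.1 hvw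
    (hA.pow_smul_sub_eq_zero_of_forall_ordLe h hε hξ hew hne h₁ hε₁ hξ₁ hev hne₁ hvw hlow)
  refine ⟨f, fun η hη => ?_⟩
  obtain ⟨b, d, l, hb, hηb⟩ := hA.exists_isCyclicProjection_of_groupExtreme hη.1
  obtain ⟨hbw, hvb⟩ :=
    (hA.liesLower_iff h hε hξ hew hne h₁ hε₁ hξ₁ hev hne₁ hb hηb).mp hη
  obtain ⟨c, x, j, hc, hcw, hcv, hcouples⟩ := hf hb hηb hbw hvb
  exact ⟨_, (hA.liesUpper_iff h hε hξ hew hne h₁ hε₁ hξ₁ hev hne₁ hc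
    (isReflection_reflection _)).mpr ⟨hcw, hcv⟩, hcouples⟩

theorem IsAdmissible.isFinalProjection_of_groupFinal (hA : IsAdmissible p A)
    (h : IsCyclicProjection p e a m) (hε : IsReflection ε e) (hξ : IsReflection ξ w)
    (hew : IsSubprojection e w) (hF : GroupFinal ξ ε) : IsFinalProjection p w m := by
  have h2 := hA.bijective_two_nsmul.injective
  obtain ⟨-, -, -, hord, hF⟩ := hF
  have hs := (hA.groupByOrd_iff h hε hξ hew).mp hord
  refine ⟨hs, hξ.1, fun n => ?_⟩
  by_contra hlt
  obtain ⟨π, e₁, a₁, k, hπ, hπw, hsk, h₁, heπ, hdet⟩ :=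
    hA.exists_forall_isDetached hξ.1 hs (not_le.mp hlt)
  have hξ₁ := isReflection_reflection hπ
  have hε₁ := isReflection_reflection h₁.isProjection
  have hne := hA.ne_of_splitsAt h hs
  have hne₁ := hA.ne_of_splitsAt h₁ hsk
  have hupper {c : A →+ A} {x : A} {j : ℕ} {η : A ≃+ A} :=
    hA.liesUpper_iff (η := η) (c := c) (y := x) (j := j) h hε hξ hew hne h₁ hε₁ hξ₁ heπ hne₁
  have hlower {c : A →+ A} {x : A} {j : ℕ} {η : A ≃+ A} :=
    hA.liesLower_iff (η := η) (c := c) (y := x) (j := j) h hε hξ hew hne h₁ hε₁ hξ₁ heπ hne₁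
  obtain ⟨f, hf⟩ := hF _ _ hξ₁.apply_apply
    ((hξ₁.commutes_iff_comm h2 hξ).mpr fun y => by rw [hπw.1, hπw.2])
    ((hupper h₁ hε₁).mpr ⟨heπ.trans hπw, heπ⟩) fun η hη => by
      obtain ⟨b, d, l, hb, hηb⟩ := hA.exists_isCyclicProjection_of_groupExtreme hη.1
      obtain ⟨-, hπb⟩ := (hlower hb hηb).mp hη
      refine hA.ordLe_of_le hb hηb h₁ hε₁
        (hπb.mono heπ ⟨hb.isProjection, hb.isProjection⟩).symm
        (hb.lt_of_forall_pow_smul_eq_zero (w := AddMonoidHom.id A - π)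
          (isSubprojection_compl_iff.mpr hπb.symm) hsk.pow_smul_sub_eq_zero).le
  have hπδ := hπw.isOrthogonal_sub hπ
  obtain ⟨b, d, l, hb, hbδ, hd⟩ := hdet f
  have hηb := isReflection_reflection hb.isProjection
  obtain ⟨η, hη, hcouples⟩ := hf _ ((hlower hb hηb).mpr
    ⟨hbδ.trans (hπw.sub hξ.1), hπδ.mono ⟨hπ, hπ⟩ hbδ⟩)
  obtain ⟨c, x, j, hc, hηc⟩ := hA.exists_isCyclicProjection_of_groupExtreme hη.1
  exact hd.not_couples hA hc hηc hb hηb ((hupper hc hηc).mp hη).2 hbδ hπδ hcouples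

theorem IsAdmissible.groupFinal_iff (hA : IsAdmissible p A) :
    GroupFinal ξ ε ↔ Pair ξ ε ∧ Final ξ ε := by
  constructor
  · intro hF
    have hext := hA.extreme_of_groupExtreme hF.2.1
    obtain ⟨e, a, m, h, hε⟩ := hA.exists_isCyclicProjection_of_extreme hext
    obtain ⟨w, hξ, hew⟩ := hA.exists_isReflection_isSubprojection h hε hF.1 hF.2.2.1
    exact ⟨⟨hF.1, hext, hF.2.2.1⟩,
      (hA.isFinalProjection_of_groupFinal h hε hξ hew hF).final hA h hε hξ hew⟩
  · rintro ⟨hP, hF⟩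
    obtain ⟨e, a, m, h, hε⟩ := hA.exists_isCyclicProjection_of_extreme hP.2.1
    obtain ⟨w, hξ, hew⟩ := hA.exists_isReflection_isSubprojection h hε hP.1 hP.2.2
    exact (hA.isFinalProjection_of_final h hε hξ hew hF).groupFinal hA h hε hξ hew

end Coupling

section Formulas

open FirstOrder Language

/-- `f`, which assigns an automorphism of `A` to each `v : α → Aut A` for every group `A`, is the
value of a single term of the language of groups. -/
def ExpressibleTerm (α : Type) (f : ∀ (A : Type u) [AddCommGroup A], (α → A ≃+ A) → A ≃+ A) :
    Prop :=
  ∃ t : groupLang.Term α, ∀ (A : Type u) [AddCommGroup A] (v : α → A ≃+ A), t.realize v = f A v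

/-- `R`, a property of families `v : α → Aut A` for every group `A`, is expressed by a single
formula of the language of groups. A quantified variable is the element `none` of the larger index
type `Option α`. -/
def Expressible (α : Type) (R : ∀ (A : Type u) [AddCommGroup A], (α → A ≃+ A) → Prop) : Prop :=
  ∃ φ : groupLang.Formula α, ∀ (A : Type u) [AddCommGroup A] (v : α → A ≃+ A), φ.Realize v ↔ R A v

variable {α : Type} {f g ξ ε ξ₁ ε₁ : ∀ (A : Type u) [AddCommGroup A], (α → A ≃+ A) → A ≃+ A}
  {R Q : ∀ (A : Type u) [AddCommGroup A], (α → A ≃+ A) → Prop}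
  {P : ∀ (A : Type u) [AddCommGroup A], (α → A ≃+ A) → A ≃+ A → Prop}

namespace ExpressibleTerm

theorem var (i : α) : ExpressibleTerm.{u} α fun _ _ v => v i :=
  ⟨Term.var i, fun _ _ _ => rfl⟩

theorem lift (hf : ExpressibleTerm α f) :
    ExpressibleTerm (Option α) fun A _ v => f A fun i => v (some i) := by
  obtain ⟨t, ht⟩ := hf
  exact ⟨t.relabel some, fun A _ v => by rw [Term.realize_relabel, ht]; rfl⟩

theorem refl : ExpressibleTerm.{u} α fun A _ _ => AddEquiv.refl A :=
  ⟨Term.func GroupFunc.one ![], fun _ _ _ => rfl⟩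

theorem symm (hf : ExpressibleTerm α f) : ExpressibleTerm α fun A _ v => (f A v).symm := by
  obtain ⟨t, ht⟩ := hf
  refine ⟨Term.func GroupFunc.inv ![t], fun A _ v => ?_⟩
  beta_reduce
  rw [← ht]
  rfl

theorem trans (hf : ExpressibleTerm α f) (hg : ExpressibleTerm α g) :
    ExpressibleTerm α fun A _ v => (f A v).trans (g A v) := by
  obtain ⟨t, ht⟩ := hf
  obtain ⟨s, hs⟩ := hg
  refine ⟨Term.func GroupFunc.mul ![s, t], fun A _ v => ?_⟩
  beta_reduce
  rw [← ht, ← hs]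
  rfl

theorem conj (hf : ExpressibleTerm α f) (hg : ExpressibleTerm α g) :
    ExpressibleTerm α fun A _ v => conj (f A v) (g A v) :=
  (hf.symm.trans hg).trans hf

end ExpressibleTerm

namespace Expressible

open ExpressibleTerm (var)

theorem eq (hf : ExpressibleTerm α f) (hg : ExpressibleTerm α g) :
    Expressible α fun A _ v => f A v = g A v := by
  obtain ⟨t, ht⟩ := hf
  obtain ⟨s, hs⟩ := hg
  exact ⟨t.equal s, fun A _ v => by rw [Formula.realize_equal, ht, hs]⟩

theorem not (hR : Expressible α R) : Expressible α fun A _ v => ¬ R A v := by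
  obtain ⟨φ, hφ⟩ := hR
  exact ⟨φ.not, fun A _ v => by rw [Formula.realize_not, hφ]⟩

theorem imp (hR : Expressible α R) (hQ : Expressible α Q) :
    Expressible α fun A _ v => R A v → Q A v := by
  obtain ⟨φ, hφ⟩ := hR
  obtain ⟨ψ, hψ⟩ := hQ
  exact ⟨φ.imp ψ, fun A _ v => by rw [Formula.realize_imp, hφ, hψ]⟩

theorem congr (hR : Expressible α R)
    (h : ∀ (A : Type u) [AddCommGroup A] (v : α → A ≃+ A), R A v ↔ Q A v) : Expressible α Q := by
  obtain ⟨φ, hφ⟩ := hR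
  exact ⟨φ, fun A _ v => (hφ A v).trans (h A v)⟩

theorem and (hR : Expressible α R) (hQ : Expressible α Q) :
    Expressible α fun A _ v => R A v ∧ Q A v :=
  (hR.imp hQ.not).not.congr fun _ _ _ => by rw [← not_and, not_not]

theorem or (hR : Expressible α R) (hQ : Expressible α Q) :
    Expressible α fun A _ v => R A v ∨ Q A v :=
  (hR.not.imp hQ).congr fun _ _ _ => or_iff_not_imp_left.symm

theorem iff (hR : Expressible α R) (hQ : Expressible α Q) :
    Expressible α fun A _ v => R A v ↔ Q A v :=
  ((hR.imp hQ).and (hQ.imp hR)).congr fun _ _ _ => iff_iff_implies_and_implies.symm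

theorem all (hP : Expressible (Option α) fun A _ v => P A (fun i => v (some i)) (v none)) :
    Expressible α fun A _ v => ∀ x, P A v x := by
  obtain ⟨φ, hφ⟩ := hP
  refine ⟨(φ.relabel fun o => o.elim (Sum.inr ()) Sum.inl).iAlls Unit, fun A _ v => ?_⟩
  rw [Formula.realize_iAlls]
  constructor
  · intro h x
    have hx := h fun _ => x
    rw [Formula.realize_relabel, hφ] at hx
    exact hx
  · intro h i
    rw [Formula.realize_relabel, hφ]
    exact h (i ())

theorem ex (hP : Expressible (Option α) fun A _ v => P A (fun i => v (some i)) (v none)) :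
    Expressible α fun A _ v => ∃ x, P A v x :=
  (all (P := fun A _ v x => ¬ P A v x) hP.not).not.congr fun _ _ _ => by rw [not_forall_not]

theorem involutive (hf : ExpressibleTerm α f) :
    Expressible α fun A _ v => ∀ x, f A v (f A v x) = x :=
  (eq (hf.trans hf) .refl).congr fun _ _ _ => DFunLike.ext_iff

theorem commutes (hf : ExpressibleTerm α f) (hg : ExpressibleTerm α g) :
    Expressible α fun A _ v => Commutes (f A v) (g A v) :=
  (eq (hg.trans hf) (hf.trans hg)).congr fun _ _ _ => DFunLike.ext_iff

theorem central (hf : ExpressibleTerm α f) : Expressible α fun A _ v => Central (f A v) :=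
  all (commutes (var none) hf.lift)

theorem forall_commutes_imp_commutes (hf : ExpressibleTerm α f) (hg : ExpressibleTerm α g) :
    Expressible α fun A _ v => ∀ x, Commutes x (f A v) → Commutes x (g A v) :=
  all (imp (commutes (var none) hf.lift) (commutes (var none) hg.lift))

theorem groupExtreme (hε : ExpressibleTerm α ε) :
    Expressible α fun A _ v => GroupExtreme (ε A v) := by
  have hε' := hε.lift.lift
  have hξ : ExpressibleTerm.{u} (Option (Option α)) fun _ _ v => v (some none) := var _
  have hx : ExpressibleTerm.{u} (Option (Option α)) fun _ _ v => v none := var _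
  have hcentral := or (central hx) (or (central (hε'.trans hx)) (or (central (hξ.trans hx))
    (central ((hε'.trans hξ).trans hx))))
  exact and (involutive hε) (and (not (central hε)) (all (imp (involutive (var none))
    (imp (commutes (var none) hε.lift) (all (imp (involutive hx) (imp
      (all (imp (commutes (var none) hε'.lift) (imp (commutes (var none) hξ.lift)
        (commutes (var none) hx.lift)))) hcentral)))))))

theorem sameSide (hξ : ExpressibleTerm α ξ) (hf : ExpressibleTerm α f)
    (hg : ExpressibleTerm α g) : Expressible α fun A _ v => SameSide (ξ A v) (f A v) (g A v) :=
  ex (and (commutes (var none) hξ.lift) (not (commutes (.conj (var none) hf.lift) hg.lift)))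

theorem ordLe (hf : ExpressibleTerm α f) (hg : ExpressibleTerm α g) :
    Expressible α fun A _ v => OrdLe (f A v) (g A v) :=
  all (imp (forall_commutes_imp_commutes hf.lift (var none))
    (imp (forall_commutes_imp_commutes (hg.trans hf).lift (var none)) (central (var none))))

theorem groupByOrd (hξ : ExpressibleTerm α ξ) (hε : ExpressibleTerm α ε) :
    Expressible α fun A _ v => GroupByOrd (ξ A v) (ε A v) :=
  all (imp (groupExtreme (var none)) (imp (commutes (var none) hξ.lift)
    (imp (commutes (var none) hε.lift)
      (iff (sameSide hξ.lift hε.lift (var none)) (ordLe hε.lift (var none))))))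

theorem liesUpper (hξ : ExpressibleTerm α ξ) (hε : ExpressibleTerm α ε)
    (hξ₁ : ExpressibleTerm α ξ₁) (hε₁ : ExpressibleTerm α ε₁) (hf : ExpressibleTerm α f) :
    Expressible α fun A _ v => LiesUpper (ξ A v) (ε A v) (ξ₁ A v) (ε₁ A v) (f A v) :=
  and (groupExtreme hf) (and (commutes hf hξ) (and (commutes hf hξ₁)
    (and (sameSide hξ hε hf) (sameSide hξ₁ hε₁ hf))))

theorem liesLower (hξ : ExpressibleTerm α ξ) (hε : ExpressibleTerm α ε)
    (hξ₁ : ExpressibleTerm α ξ₁) (hε₁ : ExpressibleTerm α ε₁) (hf : ExpressibleTerm α f) :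
    Expressible α fun A _ v => LiesLower (ξ A v) (ε A v) (ξ₁ A v) (ε₁ A v) (f A v) :=
  and (groupExtreme hf) (and (commutes hf hξ) (and (commutes hf hξ₁)
    (and (sameSide hξ hε hf) (not (sameSide hξ₁ hε₁ hf)))))

theorem couples (hf : ExpressibleTerm α f) (hε : ExpressibleTerm α ε)
    (hg : ExpressibleTerm α g) : Expressible α fun A _ v => Couples (f A v) (ε A v) (g A v) :=
  and (commutes (hf.conj hε) (hg.trans hε)) (not (commutes (hf.conj hε) hg))

theorem exists_forall_liesLower_couples (hξ : ExpressibleTerm α ξ) (hε : ExpressibleTerm α ε)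
    (hξ₁ : ExpressibleTerm α ξ₁) (hε₁ : ExpressibleTerm α ε₁) :
    Expressible α fun A _ v => ∃ f : A ≃+ A,
      ∀ b, LiesLower (ξ A v) (ε A v) (ξ₁ A v) (ε₁ A v) b →
        ∃ a, LiesUpper (ξ A v) (ε A v) (ξ₁ A v) (ε₁ A v) a ∧ Couples f a b :=
  ex (all (imp (liesLower hξ.lift.lift hε.lift.lift hξ₁.lift.lift hε₁.lift.lift (var none))
    (ex (and (liesUpper hξ.lift.lift.lift hε.lift.lift.lift hξ₁.lift.lift.lift hε₁.lift.lift.lift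
      (var none)) (couples (var (some (some none))) (var none) (var (some none)))))))

theorem groupFinal (hξ : ExpressibleTerm α ξ) (hε : ExpressibleTerm α ε) :
    Expressible α fun A _ v => GroupFinal (ξ A v) (ε A v) := by
  have hξ' := hξ.lift.lift
  have hε' := hε.lift.lift
  have hξ₁ : ExpressibleTerm.{u} (Option (Option α)) fun _ _ v => v (some none) := var _
  have hε₁ : ExpressibleTerm.{u} (Option (Option α)) fun _ _ v => v none := var _
  exact and (involutive hξ) (and (groupExtreme hε) (and (commutes hξ hε) (and (groupByOrd hξ hε)
    (all (all (imp (involutive hξ₁) (imp (commutes hξ₁ hξ') (imp (liesUpper hξ' hε' hξ₁ hε₁ hε₁)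
      (imp (all (imp (liesLower hξ'.lift hε'.lift hξ₁.lift hε₁.lift (var none))
        (ordLe (var none) hε₁.lift)))
        (exists_forall_liesLower_couples hξ' hε' hξ₁ hε₁))))))))))

end Expressible

end Formulas

end AutFinal


theorem lemma1 :
    ∃ φ : AutFinal.groupLang.Formula (Fin 2),
      ∀ (p : ℕ), p.Prime → p ≠ 2 →
      ∀ (A : Type*) [AddCommGroup A], AutFinal.IsAbelianPGroup p A →
        AutFinal.IsReducedGroup A → AutFinal.IsUnboundedGroup A →
        (∀ ξ ε : A ≃+ A,
          φ.Realize ![ξ, ε] ↔ AutFinal.Pair ξ ε ∧ AutFinal.Final ξ ε) ∧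
        (∀ A₁ A₂ : AddSubgroup A,
          (∃ ξ₀ ε₀ : A ≃+ A, AutFinal.Pair ξ₀ ε₀ ∧ AutFinal.Final ξ₀ ε₀ ∧
            AutFinal.pairCompl ξ₀ ε₀ = A₁ ∧ AutFinal.pairPart ξ₀ ε₀ = A₂) ↔
          AutFinal.IsLowFin p A₁ A₂) ∧
        (∃ A₁ A₂ : AddSubgroup A, AutFinal.IsLowFin p A₁ A₂) := by
  obtain ⟨φ, hφ⟩ := AutFinal.Expressible.groupFinal (AutFinal.ExpressibleTerm.var (0 : Fin 2))
    (AutFinal.ExpressibleTerm.var (1 : Fin 2))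
  refine ⟨φ, fun p hp hp2 A _ hpA hR hU => ?_⟩
  have hA : AutFinal.IsAdmissible p A := ⟨hp, hp2, hpA, hR, hU⟩
  obtain ⟨w, m, hw⟩ := hA.exists_isFinalProjection
  exact ⟨fun ξ ε => (hφ A _).trans hA.groupFinal_iff, fun _ _ => hA.exists_pair_iff,
    _, _, hw.isLowFin hA⟩
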